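/- Let $\bar I_u>0$ and $\sigma_u>0$. For every resolution $N\ge 1$ put $n=2^N-1$, and let $I_{u_1},\dots,I_{u_n}$ be i.i.d. normal random variables (the unit currents) with mean $\bar I_u$ and variance $\sigma_u^2$. Put $I_{\rm lsb}=\frac1n\sum_{j=1}^n I_{u_j}$. For a code $k\in\{0,\dots,n\}$ let $B_{k,m}\in\{0,1\}$, $m=1,\dots,N$, be the binary digits of $k$, i.e. $k=\sum_{m=1}^N B_{k,m}2^{m-1}$. The binary DAC has the output currents $$I_{{\rm out}_k}=\sum_{m=1}^N B_{k,m}\sum_{j=2^{m-1}}^{2^m-1}I_{u_j},\qquad {\rm INL}_k=\frac{I_{{\rm out}_k}-k\,I_{\rm lsb}}{I_{\rm lsb}},\qquad {\rm INL}_{\max}=\max_{k=0,\dots,n}|{\rm INL}_k| .$$ Let $Z_1,Z_2,\dots$ be i.i.d. standard normal random variables and $$M=\frac12\sum_{l=1}^\infty 2^{-(l+1)/2}\,\Big|\sum_{j=1}^{l-1}2^{-(l-j)/2}Z_j-Z_l\Big| .$$ This series converges almost surely, $M$ is square integrable, and the following holds. (i) As $n=2^N-1\to\infty$, $$\frac{I_{\rm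 lsb}}{\sigma_u\sqrt n}\,{\rm INL}_{\max}\longrightarrow M$$ in distribution, and also in $L^1$ and in $L^2$ in the following sense: the unit currents for all resolutions $N$ and the sequence $(Z_l)$ can be realized on a common probability space (with the distributions above for each $N$) such that the random variables on the left are square integrable and converge to $M$ in $L^1$ and in $L^2$. (ii) The expectation of $M$ is $$\mathbb E[M]=(2\pi)^{-1/2}\sum_{l=1}^\infty\big(2^{-l}-2^{-2l}\big)^{1/2}\approx 0.839792 .$$ (iii) With $v_l=2^{-l}-2^{-2l}$ and $\rho_{lk}=-2^{-(l+k)}/(\sqrt{v_l}\sqrt{v_k})$, the variance of $M$ is $$\operatorname{Var}(M)=\frac1\pi\sum_{1\le l<k}\sqrt{v_l}\sqrt{v_k}\,\Big(\sqrt{1-\rho_{lk}^2}-1+\rho_{lk}\arcsin\rho_{lk}\Big)+\frac16\Big(1-\frac2\pi\Big)\approx 0.08007 .$$ All the series converge, and the numerical values are correct up to half a unit of the last digit given. -/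

import Mathlib

open MeasureTheory ProbabilityTheory Filter Topology

noncomputable section

namespace BinaryDAC

/-- The real random variables `X j`, `j ∈ S`, are independent and each of them is normal with
mean `m` and variance `v`. Nothing is required of `X j` for `j ∉ S`. -/
structure IIDGaussianOn {Ω : Type*} [MeasurableSpace Ω] (S : Set ℕ) (X : ℕ → Ω → ℝ)
    (m v : ℝ) (P : Measure Ω) : Prop where
  indep : iIndepFun (fun j : S => X j) P
  law : ∀ j ∈ S, HasLaw (X j) (gaussianReal m v.toNNReal) P

/-- The number `n = 2 ^ N - 1` of unit currents of a binary DAC of resolution `N`. -/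
def numUnits (N : ℕ) : ℕ := 2 ^ N - 1

/-- The entry `B_{k,m}` of the switching matrix: the `m`-th binary digit of `k`, where `m = 1`
is the least significant one. -/
def switching (k m : ℕ) : ℝ := if k.testBit (m - 1) then 1 else 0

/-- The output current of the binary DAC for the code `k`, given the unit currents
`x 1, …, x n`: the `m`-th bit switches the block `x j`, `2 ^ (m - 1) ≤ j ≤ 2 ^ m - 1`. -/
def outCurrent (N : ℕ) (x : ℕ → ℝ) (k : ℕ) : ℝ :=
  ∑ m ∈ Finset.Icc 1 N, switching k m * ∑ j ∈ Finset.Icc (2 ^ (m - 1)) (2 ^ m - 1), x j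

/-- The least significant bit current: the full-scale current divided by `n`. -/
def lsbCurrent (N : ℕ) (x : ℕ → ℝ) : ℝ :=
  (∑ j ∈ Finset.Icc 1 (numUnits N), x j) / (numUnits N : ℝ)

/-- The integrated non-linearity at the code `k`, in units of the LSB current. -/
def INL (N : ℕ) (x : ℕ → ℝ) (k : ℕ) : ℝ :=
  (outCurrent N x k - (k : ℝ) * lsbCurrent N x) / lsbCurrent N x

/-- The maximum of `|INL_k|` over the codes `k = 0, …, n`. -/
def INLmax (N : ℕ) (x : ℕ → ℝ) : ℝ :=
  (Finset.range (numUnits N + 1)).sup' Finset.nonempty_range_add_one (fun k => |INL N x k|)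

/-- The rescaled statistic `(I_lsb / (σ √n)) · INL_max`. -/
def scaledINLmax (σ : ℝ) (N : ℕ) (x : ℕ → ℝ) : ℝ :=
  lsbCurrent N x / (σ * √(numUnits N : ℝ)) * INLmax N x

/-- The summand of index `l ≥ 1` in the series that defines `M`. -/
def limitTerm (z : ℕ → ℝ) (l : ℕ) : ℝ :=
  (2 : ℝ) ^ (-((l : ℝ) + 1) / 2) *
    |(∑ j ∈ Finset.Ico 1 l, (2 : ℝ) ^ (-((l : ℝ) - (j : ℝ)) / 2) * z j) - z l|

/-- The limit `M` as a function of the values `z 1, z 2, …` of the standard normals; the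
summation index is shifted by one, so that the series runs over `l = 1, 2, …`. -/
def limitM (z : ℕ → ℝ) : ℝ := 1 / 2 * ∑' l : ℕ, limitTerm z (l + 1)

/-- `v_l = 2^{-l} - 2^{-2l}`. -/
def blockVar (l : ℕ) : ℝ := (2 : ℝ) ^ (-(l : ℤ)) - (2 : ℝ) ^ (-(2 * (l : ℤ)))

/-- `ρ_{lk} = -2^{-(l+k)} / (√v_l √v_k)`. -/
def blockCorr (l k : ℕ) : ℝ :=
  -(2 : ℝ) ^ (-((l : ℤ) + (k : ℤ))) / (√(blockVar l) * √(blockVar k))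

/-- The summand of index `(l, k)` in the series for the variance of `M`. -/
def varTerm (l k : ℕ) : ℝ :=
  √(blockVar l) * √(blockVar k) *
    (√(1 - blockCorr l k ^ 2) - 1 + blockCorr l k * Real.arcsin (blockCorr l k))

end BinaryDAC

end

/-! Since `n + 1 = 2 ^ N`, the codes are exactly the subsets of the `N` bits. The numerator of
`INL_k` is the sum, over the bits set in `k`, of the deviations `d_i` of the bit currents from their
ideal values. The `d_i` add up to zero because the LSB current is the mean unit current, so the
largest absolute subset sum is `(1/2) ∑ |d_i|` (`INLmax_eq`). Thus the scaled statistic is, up to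
the sign of the LSB current, `absDevSum`.

The partial sums of the unit currents, with the linear trend removed, form a Gaussian walk pinned at
both ends, and the `d_i` are its increments over dyadic blocks. The limit is the same functional of
a Brownian bridge `B`: the recursion that bisects `[0, 2^(-l)]` shows that the terms of `M` are half
the absolute values of `B(2^(-l)) - B(2^(-l-1))` (`limitTerm_succ`). Convergence is proved by
coupling. A single Brownian motion, made of the bridge and an independent endpoint, prescribes the
block sums at every resolution, and independent noise fills in the currents inside each block
(`stdUnit`). The endpoint cancels from the `d_i`, and the pathwise distance between `absDevSum` and
`M` is controlled by `2^N / n - 1`, by `B(2^(-N))` and by the tail of the series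
(`abs_absDevSum_sub_limitM_le`). All three contributions vanish in `L²`. The wrong sign of the LSB
current occurs with probability tending to zero and costs at most a multiple of `M`, which is square
integrable. For arbitrary realizations only laws matter, so convergence in distribution is
transferred from the coupling by `IIDGaussianOn.identDistrib`.

Expectation and variance are computed term by term, which is legitimate because `∑ √v_l` converges.
The variance needs `E|X||Y|` for correlated normals, found in polar coordinates
(`IsStdGaussian.integral_abs_mul_abs`). The decimals come from finitely many rational bounds for
`√v_l`, polynomial bounds for `√(1 - t²) + t arcsin t`, and geometric tails. -/

noncomputable section

namespace BinaryDAC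

/-! ### The maximal INL as half an absolute sum -/

/-- The deviation of the current of the bit of weight `2 ^ i` from its ideal value. -/
def bitDev (N : ℕ) (x : ℕ → ℝ) (i : ℕ) : ℝ :=
  (∑ j ∈ Finset.Ico (2 ^ i) (2 ^ (i + 1)), x j) - 2 ^ i * lsbCurrent N x

lemma sum_testBit_two_pow (k N : ℕ) :
    ∑ i ∈ Finset.range N, (if k.testBit i then 2 ^ i else 0) = k % 2 ^ N := by
  induction N with
  | zero => simp [Nat.mod_one]
  | succ N ih =>
    rw [Finset.sum_range_succ, ih, Nat.mod_pow_succ, Nat.testBit_eq_decide_div_mod_eq]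
    rcases Nat.mod_two_eq_zero_or_one (k / 2 ^ N) with h | h <;> simp [h]

lemma sum_switching_two_pow {k N : ℕ} (hk : k < 2 ^ N) :
    ∑ i ∈ Finset.range N, switching k (i + 1) * (2 : ℝ) ^ i = k := by
  have h := sum_testBit_two_pow k N
  rw [Nat.mod_eq_of_lt hk] at h
  conv_rhs => rw [← h]
  push_cast
  refine Finset.sum_congr rfl fun i _ => ?_
  simp [switching]

lemma sum_Ico_two_pow (x : ℕ → ℝ) (N : ℕ) :
    ∑ i ∈ Finset.range N, ∑ j ∈ Finset.Ico (2 ^ i) (2 ^ (i + 1)), x j =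
      ∑ j ∈ Finset.Icc 1 (numUnits N), x j := by
  have h : Finset.Icc 1 (numUnits N) = Finset.Ico 1 (2 ^ N) := by
    ext j
    have := Nat.one_le_two_pow (n := N)
    simp only [numUnits, Finset.mem_Icc, Finset.mem_Ico]
    omega
  rw [h]
  induction N with
  | zero => simp
  | succ N ih =>
    rw [Finset.sum_range_succ, ih, Finset.sum_Ico_consecutive _ Nat.one_le_two_pow]
    · exact Nat.pow_le_pow_right (by norm_num) (by omega)
    · ext j
      have := Nat.one_le_two_pow (n := N)
      simp only [numUnits, Finset.mem_Icc, Finset.mem_Ico]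
      omega

lemma outCurrent_eq (N : ℕ) (x : ℕ → ℝ) (k : ℕ) :
    outCurrent N x k = ∑ i ∈ Finset.range N, switching k (i + 1) *
      ∑ j ∈ Finset.Ico (2 ^ i) (2 ^ (i + 1)), x j := by
  have h : Finset.Icc 1 N = Finset.Ico 1 (N + 1) := by ext; simp
  rw [outCurrent, h, Finset.sum_Ico_eq_sum_range]
  refine Finset.sum_congr rfl fun i _ => ?_
  rw [add_comm 1 i]
  congr 2
  ext j
  have := Nat.one_le_two_pow (n := i + 1)
  simp only [Finset.mem_Icc, Finset.mem_Ico, Nat.add_sub_cancel]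
  omega

lemma outCurrent_sub {N k : ℕ} (hk : k < 2 ^ N) (x : ℕ → ℝ) :
    outCurrent N x k - k * lsbCurrent N x =
      ∑ i ∈ Finset.range N, switching k (i + 1) * bitDev N x i := by
  rw [outCurrent_eq, ← sum_switching_two_pow hk, Finset.sum_mul, ← Finset.sum_sub_distrib]
  refine Finset.sum_congr rfl fun i _ => ?_
  rw [bitDev]; ring

lemma numUnits_cast (N : ℕ) : (numUnits N : ℝ) = 2 ^ N - 1 := by
  rw [numUnits, Nat.cast_sub Nat.one_le_two_pow]; simp

lemma numUnits_pos {N : ℕ} (hN : N ≠ 0) : (0 : ℝ) < numUnits N := by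
  rw [numUnits_cast, sub_pos]
  exact one_lt_pow₀ (by norm_num) hN

/-- The bit weights add up to `n`, and `n` times the LSB current is by definition the sum of all
unit currents. -/
lemma sum_bitDev {N : ℕ} (hN : N ≠ 0) (x : ℕ → ℝ) :
    ∑ i ∈ Finset.range N, bitDev N x i = 0 := by
  have h := numUnits_pos hN
  have h2 : ∑ i ∈ Finset.range N, (2 : ℝ) ^ i = numUnits N := by
    rw [geom_sum_eq (by norm_num), numUnits_cast]; norm_num
  simp only [bitDev]
  rw [Finset.sum_sub_distrib, ← Finset.sum_mul, h2, sum_Ico_two_pow, lsbCurrent]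
  field_simp
  ring

/-- Subset sums of numbers that add up to zero are bounded by half of the sum of the absolute
values. -/
lemma abs_sum_switching_mul_le {N : ℕ} {d : ℕ → ℝ} (hd : ∑ i ∈ Finset.range N, d i = 0) (k : ℕ) :
    |∑ i ∈ Finset.range N, switching k (i + 1) * d i| ≤
      1 / 2 * ∑ i ∈ Finset.range N, |d i| := by
  have h : ∑ i ∈ Finset.range N, switching k (i + 1) * d i =
      1 / 2 * ∑ i ∈ Finset.range N, (2 * switching k (i + 1) - 1) * d i := by
    simp only [sub_mul, one_mul, Finset.sum_sub_distrib, hd, mul_assoc, ← Finset.mul_sum]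
    ring
  rw [h, abs_mul, abs_of_pos (by norm_num : (0 : ℝ) < 1 / 2)]
  gcongr
  refine (Finset.abs_sum_le_sum_abs _ _).trans (Finset.sum_le_sum fun i _ => ?_)
  rw [abs_mul]
  have : |2 * switching k (i + 1) - 1| = 1 := by
    unfold switching; split_ifs <;> norm_num
  rw [this, one_mul]

/-- The bound of `abs_sum_switching_mul_le` is attained. -/
lemma exists_sum_switching_mul_eq {N : ℕ} {d : ℕ → ℝ} (hd : ∑ i ∈ Finset.range N, d i = 0) :
    ∃ k < 2 ^ N, ∑ i ∈ Finset.range N, switching k (i + 1) * d i =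
      1 / 2 * ∑ i ∈ Finset.range N, |d i| := by
  refine ⟨Nat.ofBits fun i : Fin N => decide (0 < d i), Nat.ofBits_lt_two_pow _, ?_⟩
  -- The bits of the chosen code mark the indices with `d i > 0`. Adding the zero sum turns half the
  -- absolute sum into the sum of the positive parts `(|d i| + d i) / 2`.
  have h : ∑ i ∈ Finset.range N, |d i| = ∑ i ∈ Finset.range N, (|d i| + d i) := by
    rw [Finset.sum_add_distrib, hd, add_zero]
  rw [h, Finset.mul_sum]
  refine Finset.sum_congr rfl fun i hi => ?_
  rw [switching, Nat.add_sub_cancel, Nat.testBit_ofBits_lt _ _ (Finset.mem_range.1 hi)]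
  rcases lt_or_ge 0 (d i) with h0 | h0
  · simp [h0, abs_of_pos h0, ← two_mul]
  · simp [h0, abs_of_nonpos h0]

lemma INLmax_eq {N : ℕ} (hN : N ≠ 0) (x : ℕ → ℝ) :
    INLmax N x = (1 / 2 * ∑ i ∈ Finset.range N, |bitDev N x i|) / |lsbCurrent N x| := by
  have hn : numUnits N + 1 = 2 ^ N := by
    have := Nat.one_le_two_pow (n := N); unfold numUnits; omega
  have hs := sum_bitDev hN x
  have hI : ∀ k < 2 ^ N, |INL N x k| =
      |∑ i ∈ Finset.range N, switching k (i + 1) * bitDev N x i| / |lsbCurrent N x| := by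
    intro k hk
    rw [INL, outCurrent_sub hk, abs_div]
  apply le_antisymm
  · refine Finset.sup'_le _ _ fun k hk => ?_
    rw [Finset.mem_range, hn] at hk
    rw [hI k hk]
    exact div_le_div_of_nonneg_right (abs_sum_switching_mul_le hs k) (abs_nonneg _)
  · obtain ⟨k, hk, h⟩ := exists_sum_switching_mul_eq hs
    rw [← h]
    refine le_trans ?_ (Finset.le_sup' (fun k => |INL N x k|)
      (Finset.mem_range.2 (hn.symm ▸ hk) : k ∈ Finset.range (numUnits N + 1)))
    rw [hI k hk]
    exact div_le_div_of_nonneg_right (le_abs_self _) (abs_nonneg _)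

/-- Half of the sum of the normalized absolute deviations of the bits. -/
def absDevSum (σ : ℝ) (N : ℕ) (x : ℕ → ℝ) : ℝ :=
  1 / 2 * ∑ i ∈ Finset.range N, |bitDev N x i / (σ * √(numUnits N : ℝ))|

lemma absDevSum_nonneg (σ : ℝ) (N : ℕ) (x : ℕ → ℝ) : 0 ≤ absDevSum σ N x := by
  unfold absDevSum; positivity

/-- The LSB current in the prefactor cancels the denominator of the INL except for its sign. With `0
/ 0 = 0` the identity also covers a vanishing LSB current, and for `N = 0` both sides are zero. -/
lemma scaledINLmax_eq {σ : ℝ} (hσ : 0 < σ) (N : ℕ) (x : ℕ → ℝ) :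
    scaledINLmax σ N x = lsbCurrent N x / |lsbCurrent N x| * absDevSum σ N x := by
  rcases eq_or_ne N 0 with rfl | hN
  · simp [scaledINLmax, absDevSum, numUnits]
  rw [scaledINLmax, INLmax_eq hN, absDevSum]
  have h : 0 < σ * √(numUnits N : ℝ) := mul_pos hσ (Real.sqrt_pos.2 (numUnits_pos hN))
  simp only [abs_div, abs_of_pos h, ← Finset.sum_div]
  ring

lemma abs_scaledINLmax_le {σ : ℝ} (hσ : 0 < σ) (N : ℕ) (x : ℕ → ℝ) :
    |scaledINLmax σ N x| ≤ absDevSum σ N x := by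
  rw [scaledINLmax_eq hσ, abs_mul, abs_div, abs_abs, abs_of_nonneg (absDevSum_nonneg σ N x)]
  exact mul_le_of_le_one_left (absDevSum_nonneg σ N x) (div_self_le_one _)

lemma scaledINLmax_eq_absDevSum {σ : ℝ} (hσ : 0 < σ) {N : ℕ} {x : ℕ → ℝ}
    (h : 0 < lsbCurrent N x) : scaledINLmax σ N x = absDevSum σ N x := by
  rw [scaledINLmax_eq hσ, abs_of_pos h, div_self h.ne', one_mul]

lemma measurable_lsbCurrent (N : ℕ) : Measurable (lsbCurrent N) := by
  unfold lsbCurrent; fun_prop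

lemma measurable_bitDev (N i : ℕ) : Measurable fun x => bitDev N x i := by
  have := measurable_lsbCurrent N
  unfold bitDev; fun_prop

lemma measurable_absDevSum (σ : ℝ) (N : ℕ) : Measurable (absDevSum σ N) := by
  have := measurable_bitDev N
  unfold absDevSum
  fun_prop

lemma measurable_scaledINLmax {σ : ℝ} (hσ : 0 < σ) (N : ℕ) : Measurable (scaledINLmax σ N) := by
  have h := measurable_lsbCurrent N
  have h' := measurable_absDevSum σ N
  have : scaledINLmax σ N = fun x => lsbCurrent N x / |lsbCurrent N x| * absDevSum σ N x :=
    funext fun x => scaledINLmax_eq hσ N x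
  rw [this]
  fun_prop

lemma lsbCurrent_congr {N : ℕ} {x y : ℕ → ℝ}
    (h : ∀ j ∈ Set.Icc 1 (numUnits N), x j = y j) : lsbCurrent N x = lsbCurrent N y := by
  unfold lsbCurrent
  rw [Finset.sum_congr rfl fun j hj => h j (by simpa using hj)]

lemma bitDev_congr {N i : ℕ} (hi : i < N) {x y : ℕ → ℝ}
    (h : ∀ j ∈ Set.Icc 1 (numUnits N), x j = y j) : bitDev N x i = bitDev N y i := by
  unfold bitDev
  rw [lsbCurrent_congr h, Finset.sum_congr rfl fun j hj => h j ?_]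
  have h1 := Nat.one_le_two_pow (n := i)
  have h2 : 2 ^ (i + 1) ≤ 2 ^ N := Nat.pow_le_pow_right (by norm_num) hi
  simp only [Finset.mem_Ico] at hj
  simp only [numUnits, Set.mem_Icc]
  omega

/-- Currents with index outside `1, …, n` are unconstrained, so passing to another realization
requires that the statistic ignore them. -/
lemma scaledINLmax_congr {σ : ℝ} (hσ : 0 < σ) {N : ℕ} {x y : ℕ → ℝ}
    (h : ∀ j ∈ Set.Icc 1 (numUnits N), x j = y j) :
    scaledINLmax σ N x = scaledINLmax σ N y := by
  rw [scaledINLmax_eq hσ, scaledINLmax_eq hσ, lsbCurrent_congr h, absDevSum, absDevSum,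
    Finset.sum_congr rfl fun i hi => by rw [bitDev_congr (Finset.mem_range.1 hi) h]]

/-! ### Standard Gaussian families and their linear spans -/

section Gaussian

variable {Ω ι κ : Type*} [MeasurableSpace Ω] {P : Measure Ω}

lemma isGaussianProcess_of_mem_span {X : ι → Ω → ℝ} {Y : κ → Ω → ℝ} (hX : IsGaussianProcess X P)
    (h : ∀ s, Y s ∈ Submodule.span ℝ (Set.range X)) : IsGaussianProcess Y P := by
  refine hX.of_isGaussianProcess fun s => ?_
  obtain ⟨c, hc⟩ := Finsupp.mem_span_range_iff_exists_finsupp.1 (h s)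
  refine ⟨c.support, ∑ i : c.support, c i • ContinuousLinearMap.proj i, fun ω => ?_⟩
  rw [← hc]
  simp only [Finsupp.sum, Finset.sum_apply, Pi.smul_apply, sum_apply,
    smul_apply, ContinuousLinearMap.proj_apply, Finset.restrict_def]
  exact (Finset.sum_coe_sort c.support fun i => c i • X i ω).symm

lemma isGaussianProcess_of_iIndepFun {X : ι → Ω → ℝ} (h : iIndepFun X P)
    (hX : ∀ i, HasGaussianLaw (X i) P) : IsGaussianProcess X P where
  hasGaussianLaw I :=
    iIndepFun.hasGaussianLaw (X := fun i : I => X i) (fun i => hX i)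
      (h.precomp Subtype.val_injective)

/-- A centered jointly Gaussian family whose covariance is the identity. -/
structure IsStdGaussian (X : ι → Ω → ℝ) (P : Measure Ω) : Prop where
  gaussian : IsGaussianProcess X P
  mean : ∀ i, ∫ ω, X i ω ∂P = 0
  cov_self : ∀ i, cov[X i, X i; P] = 1
  cov_ne : ∀ i j, i ≠ j → cov[X i, X j; P] = 0

lemma isStdGaussian_of_iIndepFun {X : ι → Ω → ℝ} (h : iIndepFun X P)
    (hX : ∀ i, HasLaw (X i) (gaussianReal 0 1) P) : IsStdGaussian X P := by
  have hG : ∀ i, HasGaussianLaw (X i) P := fun i => (hX i).hasGaussianLaw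
  refine ⟨isGaussianProcess_of_iIndepFun h hG, fun i => ?_, fun i => ?_, fun i j hij => ?_⟩
  · rw [(hX i).integral_eq]; simp
  · rw [covariance_self (hX i).aemeasurable, (hX i).variance_eq]; simp
  · exact (h.indepFun hij).covariance_eq_zero (hG i).memLp_two (hG j).memLp_two

namespace IsStdGaussian

variable {X : ι → Ω → ℝ}

lemma hasLaw (h : IsStdGaussian X P) (i : ι) : HasLaw (X i) (gaussianReal 0 1) P := by
  have hG := h.gaussian.hasGaussianLaw_eval i
  refine ⟨hG.aemeasurable, ?_⟩
  rw [hG.map_eq_gaussianReal, h.mean, ← covariance_self hG.aemeasurable, h.cov_self]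
  simp

/-- Jointly Gaussian uncorrelated variables are independent. The one-point fibre `Unit` fits the
family into the criterion for independent families of processes. -/
lemma iIndepFun (h : IsStdGaussian X P) : iIndepFun X P := by
  have := IsGaussianProcess.iIndepFun_of_covariance_eq_zero (S := fun _ : ι => Unit)
    (X := fun i _ => X i) (P := P)
    (h.gaussian.comp_right (fun p : (_ : ι) × Unit => p.1))
    (fun i _ => h.gaussian.aemeasurable i) (fun i j hij _ _ => h.cov_ne i j hij)
  exact this.comp (fun _ f => f ()) (fun _ => by fun_prop)

lemma comp_injective (h : IsStdGaussian X P) {f : κ → ι} (hf : f.Injective) :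
    IsStdGaussian (fun k => X (f k)) P :=
  ⟨h.gaussian.comp_right f, fun _ => h.mean _, fun _ => h.cov_self _,
    fun _ _ hij => h.cov_ne _ _ (hf.ne hij)⟩

lemma memLp_of_mem_span (h : IsStdGaussian X P) {f : Ω → ℝ}
    (hf : f ∈ Submodule.span ℝ (Set.range X)) : MemLp f 2 P := by
  have := isGaussianProcess_of_mem_span (Y := fun _ : Unit => f) h.gaussian fun _ => hf
  exact (this.hasGaussianLaw_eval ()).memLp_two

lemma mean_of_mem_span (h : IsStdGaussian X P) {f : Ω → ℝ}
    (hf : f ∈ Submodule.span ℝ (Set.range X)) : ∫ ω, f ω ∂P = 0 := by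
  have := h.gaussian.isProbabilityMeasure
  induction hf using Submodule.span_induction with
  | mem f hf => obtain ⟨i, rfl⟩ := hf; exact h.mean i
  | zero => simp
  | add f g hf hg ihf ihg =>
    simp only [Pi.add_apply]
    rw [integral_add ((h.memLp_of_mem_span hf).integrable (by norm_num))
      ((h.memLp_of_mem_span hg).integrable (by norm_num)), ihf, ihg, add_zero]
  | smul c f hf ih => simp [integral_const_mul, ih]

/-- A family of linear combinations of standard normals with identity covariance. -/
lemma of_mem_span (h : IsStdGaussian X P) {Y : κ → Ω → ℝ}
    (hY : ∀ k, Y k ∈ Submodule.span ℝ (Set.range X)) (h1 : ∀ k, cov[Y k, Y k; P] = 1)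
    (h0 : ∀ k l, k ≠ l → cov[Y k, Y l; P] = 0) : IsStdGaussian Y P :=
  ⟨isGaussianProcess_of_mem_span h.gaussian hY, fun k => h.mean_of_mem_span (hY k), h1, h0⟩

end IsStdGaussian

end Gaussian

/-! ### The Brownian bridge at dyadic points -/

/-- The values of a Brownian bridge at the points `2 ^ (-l)`, built from standard normals by
successive bisection. -/
def bridge {V : Type*} [AddCommGroup V] [Module ℝ V] (z : ℕ → V) : ℕ → V
  | 0 => 0
  | l + 1 => (1 / 2 : ℝ) • bridge z l + (((√2)⁻¹ ^ (l + 2) : ℝ)) • z (l + 1)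

/-- The increment of `bridge` over the interval from `2 ^ (-(l + 1))` to `2 ^ (-l)`. -/
def bridgeInc {V : Type*} [AddCommGroup V] [Module ℝ V] (z : ℕ → V) (l : ℕ) : V :=
  bridge z l - bridge z (l + 1)

lemma bridge_apply {Ω : Type*} (Z : ℕ → Ω → ℝ) (l : ℕ) (ω : Ω) :
    bridge Z l ω = bridge (fun j => Z j ω) l := by
  induction l with
  | zero => simp [bridge]
  | succ l ih => simp [bridge, ih]

lemma bridgeInc_apply {Ω : Type*} (Z : ℕ → Ω → ℝ) (l : ℕ) (ω : Ω) :
    bridgeInc Z l ω = bridgeInc (fun j => Z j ω) l := by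
  simp [bridgeInc, bridge_apply]

lemma bridge_mem {V : Type*} [AddCommGroup V] [Module ℝ V] {z : ℕ → V} {S : Submodule ℝ V}
    (h : ∀ j, 1 ≤ j → z j ∈ S) (l : ℕ) : bridge z l ∈ S := by
  induction l with
  | zero => exact S.zero_mem
  | succ l ih => exact S.add_mem (S.smul_mem _ ih) (S.smul_mem _ (h _ (by omega)))

lemma bridgeInc_mem {V : Type*} [AddCommGroup V] [Module ℝ V] {z : ℕ → V} {S : Submodule ℝ V}
    (h : ∀ j, 1 ≤ j → z j ∈ S) (l : ℕ) : bridgeInc z l ∈ S :=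
  S.sub_mem (bridge_mem h l) (bridge_mem h (l + 1))

lemma inv_sqrt_two_sq : ((√2)⁻¹ : ℝ) ^ 2 = 1 / 2 := by
  rw [inv_pow, Real.sq_sqrt (by norm_num)]; norm_num

lemma inv_sqrt_two_pow (k : ℕ) : ((√2)⁻¹ : ℝ) ^ k = (2 : ℝ) ^ (-(k : ℝ) / 2) := by
  rw [Real.sqrt_eq_rpow, ← Real.rpow_neg (by norm_num), ← Real.rpow_natCast,
    ← Real.rpow_mul (by norm_num)]
  congr 1; ring

/-- Unrolling the bisection recursion: each step halves the earlier contributions, and since `1/2 =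
(√2)⁻¹ ^ 2` the weights become those in `limitTerm`. -/
lemma bridge_eq_sum (z : ℕ → ℝ) (l : ℕ) :
    bridge z l = 2 * ((√2)⁻¹ ^ (l + 2) *
      ∑ j ∈ Finset.Ico 1 (l + 1), (2 : ℝ) ^ (-(((l + 1 : ℕ) : ℝ) - (j : ℝ)) / 2) * z j) := by
  induction l with
  | zero => simp [bridge]
  | succ l ih =>
    rw [Finset.sum_Ico_succ_top (by omega)]
    have h : ∀ j ∈ Finset.Ico 1 (l + 1),
        (2 : ℝ) ^ (-(((l + 1 + 1 : ℕ) : ℝ) - (j : ℝ)) / 2) * z j =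
          (√2)⁻¹ * ((2 : ℝ) ^ (-(((l + 1 : ℕ) : ℝ) - (j : ℝ)) / 2) * z j) := by
      intro j _
      have := inv_sqrt_two_pow 1
      rw [pow_one] at this
      rw [this, ← mul_assoc, ← Real.rpow_add (by norm_num)]
      congr 2; push_cast; ring
    rw [Finset.sum_congr rfl h, ← Finset.mul_sum, bridge, ih]
    have h1 : (2 : ℝ) ^ (-(((l + 1 + 1 : ℕ) : ℝ) - ((l + 1 : ℕ) : ℝ)) / 2) = (√2)⁻¹ := by
      have := inv_sqrt_two_pow 1
      rw [pow_one] at this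
      rw [this]; congr 1; push_cast; ring
    rw [h1]
    have h2 := inv_sqrt_two_sq
    generalize (√2)⁻¹ = r at *
    simp only [smul_eq_mul]
    have h3 : r ^ (l + 1 + 2) = r ^ (l + 2) * r := by ring
    rw [h3]
    generalize r ^ (l + 2) = q
    linear_combination (-2 * q * (∑ j ∈ Finset.Ico 1 (l + 1),
      (2 : ℝ) ^ (-(((l + 1 : ℕ) : ℝ) - (j : ℝ)) / 2) * z j) - 2 * q * z (l + 1)) * h2

/-- One bisection step gives `B(2^(-l)) - B(2^(-l-1)) = B(2^(-l)) / 2 - 2^(-(l+2)/2) z_{l+1}`. This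
identifies `M` as a functional of the bridge. -/
lemma limitTerm_succ (z : ℕ → ℝ) (l : ℕ) : limitTerm z (l + 1) = |bridgeInc z l| := by
  have h : bridgeInc z l = (√2)⁻¹ ^ (l + 2) *
      ((∑ j ∈ Finset.Ico 1 (l + 1), (2 : ℝ) ^ (-(((l + 1 : ℕ) : ℝ) - (j : ℝ)) / 2) * z j) -
        z (l + 1)) := by
    rw [bridgeInc, bridge, bridge_eq_sum]
    simp only [smul_eq_mul]
    ring
  rw [h, abs_mul, limitTerm, inv_sqrt_two_pow, abs_of_pos (Real.rpow_pos_of_pos (by norm_num) _)]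
  congr 3
  push_cast; ring

section Covariance

variable {Ω : Type*} [MeasurableSpace Ω] {P : Measure Ω} {Z : ℕ → Ω → ℝ}

lemma memLp_bridge (hZ : ∀ j, 1 ≤ j → MemLp (Z j) 2 P) (l : ℕ) : MemLp (bridge Z l) 2 P := by
  induction l with
  | zero => exact MemLp.zero
  | succ l ih => exact (ih.const_smul _).add ((hZ _ (by omega)).const_smul _)

lemma memLp_bridgeInc (hZ : ∀ j, 1 ≤ j → MemLp (Z j) 2 P) (l : ℕ) :
    MemLp (bridgeInc Z l) 2 P :=
  (memLp_bridge hZ l).sub (memLp_bridge hZ (l + 1))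

variable [IsProbabilityMeasure P]

lemma cov_bridge_succ_left (hZ : ∀ j, 1 ≤ j → MemLp (Z j) 2 P) {W : Ω → ℝ} (hW : MemLp W 2 P)
    (l : ℕ) : cov[bridge Z (l + 1), W; P] =
      1 / 2 * cov[bridge Z l, W; P] + (√2)⁻¹ ^ (l + 2) * cov[Z (l + 1), W; P] := by
  rw [bridge, covariance_add_left ((memLp_bridge hZ l).const_smul _)
    ((hZ _ (by omega)).const_smul _) hW, covariance_smul_left, covariance_smul_left]

/-- The value after `l` bisections involves only `Z 1, …, Z l`. -/
lemma cov_bridge_eq_zero (hZ : ∀ j, 1 ≤ j → MemLp (Z j) 2 P) {W : Ω → ℝ} (hW : MemLp W 2 P)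
    {l : ℕ} (h : ∀ j, 1 ≤ j → j ≤ l → cov[Z j, W; P] = 0) : cov[bridge Z l, W; P] = 0 := by
  induction l with
  | zero => simp [bridge]
  | succ l ih =>
    rw [cov_bridge_succ_left hZ hW, ih fun j hj hjl => h j hj (by omega),
      h (l + 1) (by omega) le_rfl]
    simp

lemma cov_bridge_self (hZ : ∀ j, 1 ≤ j → MemLp (Z j) 2 P)
    (h1 : ∀ j, 1 ≤ j → cov[Z j, Z j; P] = 1)
    (h0 : ∀ i j, 1 ≤ i → 1 ≤ j → i ≠ j → cov[Z i, Z j; P] = 0) (l : ℕ) :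
    cov[bridge Z l, bridge Z l; P] = (1 / 2) ^ l * (1 - (1 / 2) ^ l) := by
  induction l with
  | zero => simp [bridge]
  | succ l ih =>
    have hz := hZ (l + 1) (by omega)
    have hc : cov[bridge Z l, Z (l + 1); P] = 0 :=
      cov_bridge_eq_zero hZ hz fun j hj hjl => h0 _ _ hj (by omega) (by omega)
    have hc' : cov[Z (l + 1), bridge Z l; P] = 0 := by rw [covariance_comm, hc]
    rw [cov_bridge_succ_left hZ (memLp_bridge hZ _), covariance_comm,
      cov_bridge_succ_left hZ (memLp_bridge hZ _), covariance_comm (Z (l + 1)) (bridge Z (l + 1)),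
      cov_bridge_succ_left hZ hz, ih, hc, hc', h1 _ (by omega)]
    have h2 : ((√2)⁻¹ : ℝ) ^ (l + 2) * (√2)⁻¹ ^ (l + 2) = (1 / 2) ^ (l + 2) := by
      rw [← inv_sqrt_two_sq]; ring
    simp only [mul_zero, add_zero, zero_add, mul_one]
    rw [h2]; ring

/-- The bridge covariance `s (1 - t)` for `s ≤ t`, with `s = 2^(-(l+d))` and `t = 2^(-l)`. Further
bisections only halve it, as the new normals are uncorrelated with the past. -/
lemma cov_bridge_add (hZ : ∀ j, 1 ≤ j → MemLp (Z j) 2 P)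
    (h1 : ∀ j, 1 ≤ j → cov[Z j, Z j; P] = 1)
    (h0 : ∀ i j, 1 ≤ i → 1 ≤ j → i ≠ j → cov[Z i, Z j; P] = 0) (l d : ℕ) :
    cov[bridge Z l, bridge Z (l + d); P] = (1 / 2) ^ (l + d) * (1 - (1 / 2) ^ l) := by
  induction d with
  | zero => exact cov_bridge_self hZ h1 h0 l
  | succ d ih =>
    rw [covariance_comm, ← add_assoc, cov_bridge_succ_left hZ (memLp_bridge hZ _),
      covariance_comm, ih, covariance_comm (Z _), cov_bridge_eq_zero hZ (hZ _ (by omega))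
        fun j hj hjl => h0 _ _ hj (by omega) (by omega)]
    ring

lemma cov_bridgeInc_self (hZ : ∀ j, 1 ≤ j → MemLp (Z j) 2 P)
    (h1 : ∀ j, 1 ≤ j → cov[Z j, Z j; P] = 1)
    (h0 : ∀ i j, 1 ≤ i → 1 ≤ j → i ≠ j → cov[Z i, Z j; P] = 0) (l : ℕ) :
    cov[bridgeInc Z l, bridgeInc Z l; P] = (1 / 2) ^ (l + 1) - (1 / 2) ^ (2 * (l + 1)) := by
  have hm := memLp_bridge hZ
  rw [bridgeInc, covariance_sub_sub (hm _) (hm _) (hm _) (hm _),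
    covariance_comm (bridge Z (l + 1)) (bridge Z l), cov_bridge_self hZ h1 h0,
    cov_bridge_self hZ h1 h0, cov_bridge_add hZ h1 h0 l 1]
  ring

lemma cov_bridgeInc_of_lt (hZ : ∀ j, 1 ≤ j → MemLp (Z j) 2 P)
    (h1 : ∀ j, 1 ≤ j → cov[Z j, Z j; P] = 1)
    (h0 : ∀ i j, 1 ≤ i → 1 ≤ j → i ≠ j → cov[Z i, Z j; P] = 0) {l k : ℕ} (hlk : l < k) :
    cov[bridgeInc Z l, bridgeInc Z k; P] = -(1 / 2) ^ ((l + 1) + (k + 1)) := by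
  have hm := memLp_bridge hZ
  obtain ⟨d, rfl⟩ := Nat.exists_eq_add_of_lt hlk
  have h2 := cov_bridge_add hZ h1 h0 l (d + 1)
  have h3 := cov_bridge_add hZ h1 h0 l (d + 2)
  have h4 := cov_bridge_add hZ h1 h0 (l + 1) d
  have h5 := cov_bridge_add hZ h1 h0 (l + 1) (d + 1)
  rw [show l + 1 + d = l + d + 1 by ring] at h4
  rw [show l + 1 + (d + 1) = l + d + 1 + 1 by ring] at h5
  rw [bridgeInc, bridgeInc, covariance_sub_sub (hm _) (hm _) (hm _) (hm _), h4, h5]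
  -- The indices `l + (d + 1)` and `l + d + 1` agree only up to definitional unfolding.
  erw [h2, h3]
  ring

lemma cov_bridgeInc_ne (hZ : ∀ j, 1 ≤ j → MemLp (Z j) 2 P)
    (h1 : ∀ j, 1 ≤ j → cov[Z j, Z j; P] = 1)
    (h0 : ∀ i j, 1 ≤ i → 1 ≤ j → i ≠ j → cov[Z i, Z j; P] = 0) {l k : ℕ} (hlk : l ≠ k) :
    cov[bridgeInc Z l, bridgeInc Z k; P] = -(1 / 2) ^ ((l + 1) + (k + 1)) := by
  rcases lt_or_gt_of_ne hlk with h | h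
  · exact cov_bridgeInc_of_lt hZ h1 h0 h
  · rw [covariance_comm, cov_bridgeInc_of_lt hZ h1 h0 h, add_comm]

end Covariance

/-! ### Absolute moments of correlated normals -/

/-- Starting the period at `-β` leaves one sign change, at `π + β`; the sign on either side is read
off from the product formula for `sin φ + sin β`. -/
lemma integral_abs_sin_add_sin {β : ℝ} (h1 : -(Real.pi / 2) ≤ β) (h2 : β ≤ Real.pi / 2) :
    ∫ φ in (-β)..(-β + 2 * Real.pi), |Real.sin φ + Real.sin β| =
      4 * Real.cos β + 4 * β * Real.sin β := by
  have hcont : ∀ a b : ℝ, IntervalIntegrable (fun φ => |Real.sin φ + Real.sin β|) volume a b :=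
    fun a b => Continuous.intervalIntegrable (by fun_prop) a b
  have hc : ∀ a b : ℝ, ∫ φ in a..b, (Real.sin φ + Real.sin β) =
      Real.cos a - Real.cos b + (b - a) * Real.sin β := by
    intro a b
    rw [intervalIntegral.integral_add (Real.continuous_sin.intervalIntegrable a b) (by simp)]
    simp
  have hfac : ∀ φ, Real.sin φ + Real.sin β =
      2 * Real.sin ((φ + β) / 2) * Real.cos ((φ - β) / 2) := by
    intro φ
    have := Real.sin_sub_sin φ (-β)
    rw [Real.sin_neg] at this
    rw [sub_neg_eq_add] at this
    rw [this]; ring_nf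
  have hpi := Real.pi_pos
  rw [← intervalIntegral.integral_add_adjacent_intervals (hcont (-β) (Real.pi + β))
    (hcont (Real.pi + β) _)]
  have e1 : ∫ φ in (-β)..(Real.pi + β), |Real.sin φ + Real.sin β| =
      ∫ φ in (-β)..(Real.pi + β), (Real.sin φ + Real.sin β) := by
    refine intervalIntegral.integral_congr fun φ hφ => ?_
    rw [Set.uIcc_of_le (by linarith)] at hφ
    refine abs_of_nonneg ?_
    rw [hfac]
    have := Real.sin_nonneg_of_nonneg_of_le_pi (x := (φ + β) / 2)
      (by linarith [hφ.1]) (by linarith [hφ.2])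
    have := Real.cos_nonneg_of_mem_Icc (x := (φ - β) / 2)
      ⟨by linarith [hφ.1], by linarith [hφ.2]⟩
    positivity
  have e2 : ∫ φ in (Real.pi + β)..(-β + 2 * Real.pi), |Real.sin φ + Real.sin β| =
      ∫ φ in (Real.pi + β)..(-β + 2 * Real.pi), -(Real.sin φ + Real.sin β) := by
    refine intervalIntegral.integral_congr fun φ hφ => ?_
    rw [Set.uIcc_of_le (by linarith)] at hφ
    refine abs_of_nonpos ?_
    rw [hfac]
    have h3 := Real.sin_nonneg_of_nonneg_of_le_pi (x := (φ + β) / 2)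
      (by linarith [hφ.1]) (by linarith [hφ.2])
    have h4 := Real.cos_nonpos_of_pi_div_two_le_of_le (x := (φ - β) / 2)
      (by linarith [hφ.1]) (by linarith [hφ.2])
    exact mul_nonpos_of_nonneg_of_nonpos (by positivity) h4
  rw [e1, e2, intervalIntegral.integral_neg, hc, hc]
  have h3 : Real.cos (Real.pi + β) = -Real.cos β := by rw [add_comm, Real.cos_add_pi]
  have h4 : Real.cos (-β + 2 * Real.pi) = Real.cos β := by
    rw [Real.cos_add_two_pi, Real.cos_neg]
  rw [h3, h4, Real.cos_neg]
  ring

/-- The integrand is `|cos θ sin (θ + β)| = |sin (2θ + β) + sin β| / 2`, and the substitution `φ =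
2θ + β` runs through two full periods. -/
lemma integral_abs_cos_mul_abs {β : ℝ} (h1 : -(Real.pi / 2) ≤ β) (h2 : β ≤ Real.pi / 2) :
    ∫ θ in (-Real.pi)..Real.pi,
      |Real.cos θ| * |Real.sin β * Real.cos θ + Real.cos β * Real.sin θ| =
      2 * Real.cos β + 2 * β * Real.sin β := by
  have hper : Function.Periodic (fun φ => |Real.sin φ + Real.sin β|) (2 * Real.pi) := by
    intro φ; simp
  have hcont : ∀ a b : ℝ, IntervalIntegrable (fun φ => |Real.sin φ + Real.sin β|) volume a b :=
    fun a b => Continuous.intervalIntegrable (by fun_prop) a b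
  have e : ∀ θ, |Real.cos θ| * |Real.sin β * Real.cos θ + Real.cos β * Real.sin θ| =
      1 / 2 * |Real.sin (2 * θ + β) + Real.sin β| := by
    intro θ
    rw [← abs_mul]
    have : Real.cos θ * (Real.sin β * Real.cos θ + Real.cos β * Real.sin θ) =
        1 / 2 * (Real.sin (2 * θ + β) + Real.sin β) := by
      rw [Real.sin_add, Real.sin_two_mul, Real.cos_two_mul]; ring
    rw [this, abs_mul, abs_of_pos (by norm_num : (0 : ℝ) < 1 / 2)]
  simp_rw [e]
  rw [intervalIntegral.integral_const_mul,
    intervalIntegral.integral_comp_mul_add (fun φ => |Real.sin φ + Real.sin β|) two_ne_zero,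
    ← intervalIntegral.integral_add_adjacent_intervals (hcont _ β) (hcont β _)]
  have p1 := hper.intervalIntegral_add_eq (2 * -Real.pi + β) (-β)
  have p2 := hper.intervalIntegral_add_eq β (-β)
  rw [show 2 * -Real.pi + β + 2 * Real.pi = β by ring] at p1
  rw [show β + 2 * Real.pi = 2 * Real.pi + β by ring] at p2
  rw [p1, p2, integral_abs_sin_add_sin h1 h2, smul_eq_mul]
  ring

lemma integral_cube_mul_exp : ∫ r in Set.Ioi (0 : ℝ), r ^ 3 * Real.exp (-r ^ 2 / 2) = 2 := by
  have h := integral_rpow_mul_exp_neg_mul_rpow (p := 2) (q := 3) (b := 1 / 2)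
    (by norm_num) (by norm_num) (by norm_num)
  have e : ∫ r in Set.Ioi (0 : ℝ), r ^ 3 * Real.exp (-r ^ 2 / 2) =
      ∫ x in Set.Ioi (0 : ℝ), x ^ (3 : ℝ) * Real.exp (-(1 / 2) * x ^ (2 : ℝ)) := by
    refine setIntegral_congr_fun measurableSet_Ioi fun r _ => ?_
    have h3 : r ^ (3 : ℝ) = r ^ 3 := by exact_mod_cast Real.rpow_natCast r 3
    have h2 : r ^ (2 : ℝ) = r ^ 2 := by exact_mod_cast Real.rpow_natCast r 2
    simp only [h3, h2]
    congr 2; ring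
  rw [e, h]
  have hG : Real.Gamma ((3 + 1) / 2) = 1 := by norm_num
  rw [hG]
  have : (1 / 2 : ℝ) ^ (-(3 + 1 : ℝ) / 2) = 4 := by
    rw [show (-(3 + 1 : ℝ) / 2) = ((-2 : ℤ) : ℝ) by norm_num, Real.rpow_intCast]
    norm_num
  rw [this]; norm_num

lemma integral_mul_exp : ∫ r in Set.Ioi (0 : ℝ), r * Real.exp (-r ^ 2 / 2) = 1 := by
  have h := integral_rpow_mul_exp_neg_mul_rpow (p := 2) (q := 1) (b := 1 / 2)
    (by norm_num) (by norm_num) (by norm_num)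
  have e : ∫ r in Set.Ioi (0 : ℝ), r * Real.exp (-r ^ 2 / 2) =
      ∫ x in Set.Ioi (0 : ℝ), x ^ (1 : ℝ) * Real.exp (-(1 / 2) * x ^ (2 : ℝ)) := by
    refine setIntegral_congr_fun measurableSet_Ioi fun r _ => ?_
    have h2 : r ^ (2 : ℝ) = r ^ 2 := by exact_mod_cast Real.rpow_natCast r 2
    simp only [h2, Real.rpow_one]
    congr 2; ring
  rw [e, h]
  have hG : Real.Gamma ((1 + 1) / 2) = 1 := by norm_num
  rw [hG]
  have : (1 / 2 : ℝ) ^ (-(1 + 1 : ℝ) / 2) = 2 := by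
    rw [show (-(1 + 1 : ℝ) / 2) = ((-1 : ℤ) : ℝ) by norm_num, Real.rpow_intCast]
    norm_num
  rw [this]; norm_num

lemma gaussianPDFReal_std (x : ℝ) :
    gaussianPDFReal 0 1 x = (√(2 * Real.pi))⁻¹ * Real.exp (-x ^ 2 / 2) := by
  simp [gaussianPDFReal]

lemma integral_abs_gaussianReal : ∫ x, |x| ∂(gaussianReal 0 1) = √(2 / Real.pi) := by
  rw [integral_gaussianReal_eq_integral_smul (by norm_num)]
  have e : ∀ x : ℝ, gaussianPDFReal 0 1 x • |x| =
      (fun t => (√(2 * Real.pi))⁻¹ * (t * Real.exp (-t ^ 2 / 2))) |x| := by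
    intro x; simp only [gaussianPDFReal_std, smul_eq_mul, sq_abs]; ring
  simp_rw [e]
  rw [integral_comp_abs (f := fun t => (√(2 * Real.pi))⁻¹ * (t * Real.exp (-t ^ 2 / 2))),
    integral_const_mul, integral_mul_exp]
  have hp := Real.pi_pos
  rw [Real.sqrt_div (by norm_num), Real.sqrt_mul (by norm_num)]
  have h2 : √2 * √2 = 2 := Real.mul_self_sqrt (by norm_num)
  have : 0 < √2 := by positivity
  have : 0 < √Real.pi := by positivity
  field_simp
  linarith

/-- In polar coordinates the integrand has degree two and the Jacobian adds one power of `r`, so the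
integral factors into the radial integral of `r³ e^(-r²/2)` and the angular integral above. -/
lemma integral_abs_mul_abs_prod_gaussianReal {β : ℝ} (h1 : -(Real.pi / 2) ≤ β)
    (h2 : β ≤ Real.pi / 2) :
    ∫ p : ℝ × ℝ, |p.1| * |Real.sin β * p.1 + Real.cos β * p.2|
      ∂((gaussianReal 0 1).prod (gaussianReal 0 1)) =
      2 / Real.pi * (Real.cos β + β * Real.sin β) := by
  have hg : gaussianReal 0 1 = volume.withDensity (gaussianPDF 0 1) :=
    gaussianReal_of_var_ne_zero 0 (by norm_num)
  rw [hg, prod_withDensity (measurable_gaussianPDF 0 1) (measurable_gaussianPDF 0 1),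
    integral_withDensity_eq_integral_toReal_smul (by fun_prop)
      (ae_of_all _ fun p => ENNReal.mul_lt_top gaussianPDF_lt_top gaussianPDF_lt_top),
    ← Measure.volume_eq_prod, ← integral_comp_polarCoord_symm]
  have e : ∀ p ∈ polarCoord.target, p.1 • ((gaussianPDF 0 1 (polarCoord.symm p).1 *
      gaussianPDF 0 1 (polarCoord.symm p).2).toReal • (|(polarCoord.symm p).1| *
        |Real.sin β * (polarCoord.symm p).1 + Real.cos β * (polarCoord.symm p).2|)) =
      ((2 * Real.pi)⁻¹ * (p.1 ^ 3 * Real.exp (-p.1 ^ 2 / 2))) *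
      (|Real.cos p.2| * |Real.sin β * Real.cos p.2 + Real.cos β * Real.sin p.2|) := by
    rintro ⟨r, θ⟩ hp
    have hr : 0 < r := hp.1
    simp only [polarCoord_symm_apply, ENNReal.toReal_mul, toReal_gaussianPDF,
      gaussianPDFReal_std, smul_eq_mul]
    have ha : Real.sin β * (r * Real.cos θ) + Real.cos β * (r * Real.sin θ) =
        r * (Real.sin β * Real.cos θ + Real.cos β * Real.sin θ) := by ring
    rw [ha, abs_mul, abs_mul, abs_of_pos hr]
    have hexp : Real.exp (-(r * Real.cos θ) ^ 2 / 2) * Real.exp (-(r * Real.sin θ) ^ 2 / 2) =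
        Real.exp (-r ^ 2 / 2) := by
      rw [← Real.exp_add]; congr 1
      linear_combination (-r ^ 2 / 2) * Real.sin_sq_add_cos_sq θ
    have hs : (√(2 * Real.pi))⁻¹ * (√(2 * Real.pi))⁻¹ = (2 * Real.pi)⁻¹ := by
      rw [← mul_inv, Real.mul_self_sqrt (by positivity)]
    rw [← hexp, ← hs]; ring
  rw [setIntegral_congr_fun polarCoord.open_target.measurableSet e, polarCoord_target,
    Measure.volume_eq_prod, setIntegral_prod_mul (fun r : ℝ => (2 * Real.pi)⁻¹ * (r ^ 3 * Real.exp (-r ^ 2 / 2)))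
      (fun θ : ℝ => |Real.cos θ| * |Real.sin β * Real.cos θ + Real.cos β * Real.sin θ|),
    integral_const_mul, integral_cube_mul_exp, ← integral_Ioc_eq_integral_Ioo,
    ← intervalIntegral.integral_of_le (by linarith [Real.pi_pos]),
    integral_abs_cos_mul_abs h1 h2]
  have := Real.pi_pos
  field_simp

section

variable {Ω : Type*} [MeasurableSpace Ω] {P : Measure Ω}

lemma integral_abs_of_hasGaussianLaw {X : Ω → ℝ} (hX : HasGaussianLaw X P)
    (h0 : ∫ ω, X ω ∂P = 0) : ∫ ω, |X ω| ∂P = √(2 / Real.pi) * √(cov[X, X; P]) := by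
  have hp := hX.isProbabilityMeasure
  have hm := hX.map_eq_gaussianReal
  rw [h0, ← covariance_self hX.aemeasurable] at hm
  set v := cov[X, X; P] with hv
  have hv0 : 0 ≤ v := by rw [hv, covariance_self hX.aemeasurable]; exact variance_nonneg _ _
  have h2 : gaussianReal 0 v.toNNReal = (gaussianReal 0 1).map (√v * ·) := by
    rw [gaussianReal_map_const_mul]
    congr 1
    · simp
    · ext; simp [hv0]
  rw [← integral_map (f := fun x => |x|) hX.aemeasurable (by fun_prop), hm, h2,
    integral_map (by fun_prop) (by fun_prop)]
  simp_rw [abs_mul, abs_of_nonneg (Real.sqrt_nonneg v)]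
  rw [integral_const_mul, integral_abs_gaussianReal, mul_comm]

lemma IsStdGaussian.integral_abs {ι : Type*} {Z : ι → Ω → ℝ} (hZ : IsStdGaussian Z P) {X : Ω → ℝ}
    (hX : X ∈ Submodule.span ℝ (Set.range Z)) :
    ∫ ω, |X ω| ∂P = √(2 / Real.pi) * √(cov[X, X; P]) :=
  integral_abs_of_hasGaussianLaw ((isGaussianProcess_of_mem_span (Y := fun _ : Unit => X)
    hZ.gaussian fun _ => hX).hasGaussianLaw_eval ()) (hZ.mean_of_mem_span hX)

lemma IsStdGaussian.integral_abs_mul_abs {ι : Type*} {Z : ι → Ω → ℝ} (hZ : IsStdGaussian Z P)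
    {X Y : Ω → ℝ} {a b ρ : ℝ} (hX : X ∈ Submodule.span ℝ (Set.range Z))
    (hY : Y ∈ Submodule.span ℝ (Set.range Z)) (ha : 0 < a) (hb : 0 < b) (hρ : ρ ^ 2 < 1)
    (hXX : cov[X, X; P] = a ^ 2) (hYY : cov[Y, Y; P] = b ^ 2) (hXY : cov[X, Y; P] = ρ * a * b) :
    ∫ ω, |X ω| * |Y ω| ∂P = 2 / Real.pi * (a * b) * (√(1 - ρ ^ 2) + ρ * Real.arcsin ρ) := by
  have hP := hZ.gaussian.isProbabilityMeasure
  have hs : 0 < √(1 - ρ ^ 2) := Real.sqrt_pos.2 (by linarith)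
  have hs2 : √(1 - ρ ^ 2) ^ 2 = 1 - ρ ^ 2 := Real.sq_sqrt (by linarith)
  set s := √(1 - ρ ^ 2) with hsdef
  have hYX : cov[Y, X; P] = ρ * a * b := by rw [covariance_comm, hXY]
  -- Gram–Schmidt: `X = a X'` and `Y = b (ρ X' + s W)` with `X'`, `W` independent standard normals.
  -- The angle is then `β = arcsin ρ`.
  let X' : Ω → ℝ := a⁻¹ • X
  let W : Ω → ℝ := (s * b)⁻¹ • Y - (s⁻¹ * ρ) • X'
  have hX' : X' ∈ Submodule.span ℝ (Set.range Z) := Submodule.smul_mem _ _ hX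
  have hY' := Submodule.smul_mem (Submodule.span ℝ (Set.range Z)) (s * b)⁻¹ hY
  have hX'' := Submodule.smul_mem (Submodule.span ℝ (Set.range Z)) (s⁻¹ * ρ) hX'
  have hW : W ∈ Submodule.span ℝ (Set.range Z) := Submodule.sub_mem _ hY' hX''
  have c1 : cov[X', X'; P] = 1 := by
    simp only [X', covariance_smul_left, covariance_smul_right, hXX]
    field_simp
  have cX'Y : cov[X', Y; P] = ρ * b := by
    simp only [X', covariance_smul_left, hXY]
    field_simp
  have c0 : cov[X', W; P] = 0 := by
    simp only [W]
    rw [covariance_sub_right (hZ.memLp_of_mem_span hX') (hZ.memLp_of_mem_span hY')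
      (hZ.memLp_of_mem_span hX''), covariance_smul_right, covariance_smul_right, c1, cX'Y]
    field_simp
    ring
  have cW : cov[W, W; P] = 1 := by
    have : cov[W, W; P] = (s * b)⁻¹ * cov[Y, W; P] := by
      conv_lhs => rw [show W = (s * b)⁻¹ • Y - (s⁻¹ * ρ) • X' from rfl]
      rw [covariance_sub_left (hZ.memLp_of_mem_span hY') (hZ.memLp_of_mem_span hX'')
        (hZ.memLp_of_mem_span hW), covariance_smul_left, covariance_smul_left]
      rw [c0, mul_zero, sub_zero]
    rw [this]
    simp only [W]
    rw [covariance_sub_right (hZ.memLp_of_mem_span hY) (hZ.memLp_of_mem_span hY')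
      (hZ.memLp_of_mem_span hX''), covariance_smul_right, covariance_smul_right, hYY,
      covariance_comm Y X', cX'Y]
    field_simp
    linarith
  have hF : IsStdGaussian ![X', W] P := by
    refine hZ.of_mem_span ?_ ?_ ?_
    · intro k; fin_cases k <;> assumption
    · intro k; fin_cases k <;> assumption
    · intro k l hkl
      fin_cases k <;> fin_cases l
      · exact absurd rfl hkl
      · exact c0
      · rw [covariance_comm]; exact c0
      · exact absurd rfl hkl
  have hlX : HasLaw X' (gaussianReal 0 1) P := hF.hasLaw 0
  have hlW : HasLaw W (gaussianReal 0 1) P := hF.hasLaw 1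
  have hind : IndepFun X' W P := hF.iIndepFun.indepFun (i := 0) (j := 1) (by decide)
  have hmap : P.map (fun ω => (X' ω, W ω)) = (gaussianReal 0 1).prod (gaussianReal 0 1) := by
    rw [(indepFun_iff_map_prod_eq_prod_map_map hlX.aemeasurable hlW.aemeasurable).1 hind,
      hlX.map_eq, hlW.map_eq]
  have hρ' : -1 ≤ ρ ∧ ρ ≤ 1 := abs_le.1 ((sq_lt_one_iff_abs_lt_one ρ).1 hρ).le
  have key := integral_abs_mul_abs_prod_gaussianReal (β := Real.arcsin ρ)
    (Real.neg_pi_div_two_le_arcsin ρ) (Real.arcsin_le_pi_div_two ρ)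
  rw [← hmap, integral_map (hlX.aemeasurable.prodMk hlW.aemeasurable)
    (by fun_prop), Real.sin_arcsin hρ'.1 hρ'.2, Real.cos_arcsin, ← hsdef] at key
  have e : ∀ ω, |X ω| * |Y ω| = a * b * (|X' ω| * |ρ * X' ω + s * W ω|) := by
    intro ω
    have e1 : X ω = a * X' ω := by simp only [X', Pi.smul_apply, smul_eq_mul]; field_simp
    have e2 : Y ω = b * (ρ * X' ω + s * W ω) := by
      simp only [W, Pi.sub_apply, Pi.smul_apply, smul_eq_mul]
      field_simp
      ring
    rw [e2, abs_mul, abs_of_pos hb]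
    conv_lhs => rw [e1, abs_mul, abs_of_pos ha]
    ring
  simp_rw [e]
  rw [integral_const_mul, key]
  ring

end

/-! ### Polynomial bounds for `absCov` -/

/-- The excess of `√(1 - t²) + t arcsin t` over its value at `0`: up to a factor `2 / π`, the
covariance of the absolute values of two standard normals with correlation `t`. -/
def absCov (t : ℝ) : ℝ := √(1 - t ^ 2) - 1 + t * Real.arcsin t

lemma absCov_neg (t : ℝ) : absCov (-t) = absCov t := by simp [absCov]

lemma absCov_zero : absCov 0 = 0 := by simp [absCov]

lemma hasDerivAt_absCov {t : ℝ} (h0 : -1 < t) (h1 : t < 1) :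
    HasDerivAt absCov (Real.arcsin t) t := by
  have hp : 0 < 1 - t ^ 2 := by nlinarith
  have hs : HasDerivAt (fun t : ℝ => 1 - t ^ 2) (-(2 * t)) t := by
    simpa using (hasDerivAt_pow 2 t).const_sub 1
  have := ((hs.sqrt hp.ne').sub_const 1).add
    ((hasDerivAt_id t).mul (Real.hasDerivAt_arcsin h0.ne' h1.ne))
  refine this.congr_deriv ?_
  have : 0 < √(1 - t ^ 2) := Real.sqrt_pos.2 hp
  simp only [id]
  field_simp
  ring

/-- A function whose second derivative is nonnegative on `[0, T)`, with vanishing initial data,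
is nonnegative there. -/
lemma nonneg_of_second_deriv_nonneg {g g' g'' : ℝ → ℝ} {T : ℝ}
    (h1 : ∀ t, 0 ≤ t → t < T → HasDerivAt g (g' t) t)
    (h2 : ∀ t, 0 ≤ t → t < T → HasDerivAt g' (g'' t) t)
    (h3 : ∀ t, 0 ≤ t → t < T → 0 ≤ g'' t) (h0 : g 0 = 0) (h0' : g' 0 = 0)
    {t : ℝ} (ht : 0 ≤ t) (htT : t < T) : 0 ≤ g t := by
  have mono : ∀ {u u' : ℝ → ℝ}, (∀ t, 0 ≤ t → t < T → HasDerivAt u (u' t) t) →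
      (∀ t, 0 ≤ t → t < T → 0 ≤ u' t) → u 0 = 0 → ∀ t, 0 ≤ t → t < T → 0 ≤ u t := by
    intro u u' hu hu' hu0 t ht htT
    have hm : MonotoneOn u (Set.Ico 0 T) := by
      refine monotoneOn_of_hasDerivWithinAt_nonneg (f' := u') (convex_Ico 0 T)
        (fun x hx => (hu x hx.1 hx.2).continuousAt.continuousWithinAt) ?_ ?_
      · intro x hx
        rw [interior_Ico] at hx
        exact (hu x hx.1.le hx.2).hasDerivWithinAt
      · intro x hx
        rw [interior_Ico] at hx
        exact hu' x hx.1.le hx.2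
    have := hm ⟨le_rfl, ht.trans_lt htT⟩ ⟨ht, htT⟩ ht
    rwa [hu0] at this
  exact mono h1 (mono h2 h3 h0') h0 t ht htT

/-- The second derivative of `absCov` is `1 / √(1 - t²)`, so a comparison of second derivatives
suffices; squaring makes it the polynomial inequality `h3`. -/
lemma le_absCov {p p' p'' : ℝ → ℝ} (h1 : ∀ t, HasDerivAt p (p' t) t)
    (h2 : ∀ t, HasDerivAt p' (p'' t) t) (h0 : p 0 = 0) (h0' : p' 0 = 0)
    (h3 : ∀ t, 0 ≤ t → t < 1 → p'' t ^ 2 * (1 - t ^ 2) ≤ 1) {t : ℝ} (ht : 0 ≤ t) (ht1 : t < 1) :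
    p t ≤ absCov t := by
  refine sub_nonneg.1 (nonneg_of_second_deriv_nonneg (g := fun t => absCov t - p t)
    (g' := fun t => Real.arcsin t - p' t) (g'' := fun t => 1 / √(1 - t ^ 2) - p'' t) (T := 1)
    (fun t h h' => (hasDerivAt_absCov (by linarith) h').sub (h1 t))
    (fun t h h' => (Real.hasDerivAt_arcsin (by linarith) h'.ne).sub (h2 t)) ?_
    (by simp [absCov_zero, h0]) (by simp [h0']) ht ht1)
  intro t h h'
  have hp : 0 < √(1 - t ^ 2) := Real.sqrt_pos.2 (by nlinarith)
  rw [sub_nonneg, le_div_iff₀ hp]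
  refine abs_le_of_sq_le_sq' ?_ zero_le_one |>.2
  rw [mul_pow, Real.sq_sqrt (by nlinarith), one_pow]
  exact h3 t h h'

lemma absCov_le {p p' p'' : ℝ → ℝ} {T : ℝ} (hT : T ≤ 1) (h1 : ∀ t, HasDerivAt p (p' t) t)
    (h2 : ∀ t, HasDerivAt p' (p'' t) t) (h0 : p 0 = 0) (h0' : p' 0 = 0)
    (h4 : ∀ t, 0 ≤ p'' t)
    (h3 : ∀ t, 0 ≤ t → t < T → 1 ≤ p'' t ^ 2 * (1 - t ^ 2)) {t : ℝ} (ht : 0 ≤ t) (ht1 : t < T) :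
    absCov t ≤ p t := by
  refine sub_nonneg.1 (nonneg_of_second_deriv_nonneg (g := fun t => p t - absCov t)
    (g' := fun t => p' t - Real.arcsin t) (g'' := fun t => p'' t - 1 / √(1 - t ^ 2)) (T := T)
    (fun t h h' => (h1 t).sub (hasDerivAt_absCov (by linarith) (by linarith)))
    (fun t h h' => (h2 t).sub (Real.hasDerivAt_arcsin (by linarith) (by linarith))) ?_
    (by simp [absCov_zero, h0]) (by simp [h0']) ht ht1)
  intro t h h'
  have hp : 0 < √(1 - t ^ 2) := Real.sqrt_pos.2 (by nlinarith)
  rw [sub_nonneg, div_le_iff₀ hp]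
  refine le_of_sq_le_sq ?_ (mul_nonneg (h4 t) hp.le)
  have hle := h3 t h h'
  rwa [mul_pow, Real.sq_sqrt (by nlinarith), one_pow]

/-- A partial sum of the Taylor series of `absCov`, as a function of `t ^ 2`. -/
def absCovLower (x : ℝ) : ℝ :=
  x / 2 + x ^ 2 / 24 + x ^ 3 / 80 + 5 * x ^ 4 / 896 + 7 * x ^ 5 / 2304 + 21 * x ^ 6 / 11264

/-- An upper bound for `absCov`, as a function of `t ^ 2`. -/
def absCovUpper (x : ℝ) : ℝ :=
  x / 2 + x ^ 2 / 24 + x ^ 3 / 80 + 5 * x ^ 4 / 896 + x ^ 5 / 225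

lemma hasDerivAt_monomial (c : ℝ) (n : ℕ) (t : ℝ) :
    HasDerivAt (fun t : ℝ => c * t ^ n) (c * (n * t ^ (n - 1))) t :=
  (hasDerivAt_pow n t).const_mul c

/-- Here `p''` truncates the Taylor series of `1 / √(1 - t²)`, so `1 - p''² (1 - t²)` starts at `t ^
12`; all its coefficients are positive. -/
lemma absCovLower_le {t : ℝ} (h0 : 0 ≤ t) (h1 : t < 1) : absCovLower (t ^ 2) ≤ absCov t := by
  have hd := hasDerivAt_monomial
  refine le_absCov (p := fun t => absCovLower (t ^ 2))
    (p' := fun t => t + t ^ 3 / 6 + 3 * t ^ 5 / 40 + 5 * t ^ 7 / 112 + 35 * t ^ 9 / 1152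
      + 63 * t ^ 11 / 2816)
    (p'' := fun t => 1 + t ^ 2 / 2 + 3 * t ^ 4 / 8 + 5 * t ^ 6 / 16 + 35 * t ^ 8 / 128
      + 63 * t ^ 10 / 256) ?_ ?_ (by simp [absCovLower]) (by simp) ?_ h0 h1
  · intro t
    refine ((((((hd (1 / 2) 2 t).add (hd (1 / 24) 4 t)).add (hd (1 / 80) 6 t)).add
      (hd (5 / 896) 8 t)).add (hd (7 / 2304) 10 t)).add (hd (21 / 11264) 12 t)).congr_deriv
      (by push_cast; ring) |>.congr_of_eventuallyEq (Eventually.of_forall fun t => ?_)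
    simp only [absCovLower, Pi.add_apply]; ring
  · intro t
    refine ((((((hd 1 1 t).add (hd (1 / 6) 3 t)).add (hd (3 / 40) 5 t)).add
      (hd (5 / 112) 7 t)).add (hd (35 / 1152) 9 t)).add (hd (63 / 2816) 11 t)).congr_deriv
      (by push_cast; ring) |>.congr_of_eventuallyEq (Eventually.of_forall fun t => ?_)
    simp only [Pi.add_apply]; ring
  · intro t _ _
    have : 0 ≤ t ^ 12 * (231 / 512 + 99 / 512 * t ^ 2 + 2079 / 16384 * t ^ 4 +
        385 / 4096 * t ^ 6 + 4851 / 65536 * t ^ 8 + 3969 / 65536 * t ^ 10) := by positivity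
    linarith

/-- The last Taylor coefficient `35/128` of `p''` is raised to `2/5` to absorb the rest of the
series. This works up to `0.58`, just above the largest `|ρ| = 1/√3`. -/
lemma absCov_le_upper {t : ℝ} (h0 : 0 ≤ t) (h1 : t < 0.58) : absCov t ≤ absCovUpper (t ^ 2) := by
  have hd := hasDerivAt_monomial
  refine absCov_le (T := 0.58) (p := fun t => absCovUpper (t ^ 2))
    (p' := fun t => t + t ^ 3 / 6 + 3 * t ^ 5 / 40 + 5 * t ^ 7 / 112 + 2 * t ^ 9 / 45)
    (p'' := fun t => 1 + t ^ 2 / 2 + 3 * t ^ 4 / 8 + 5 * t ^ 6 / 16 + 2 * t ^ 8 / 5)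
    (by norm_num) ?_ ?_ (by simp [absCovUpper]) (by simp) (fun t => by positivity) ?_ h0 h1
  · intro t
    refine (((((hd (1 / 2) 2 t).add (hd (1 / 24) 4 t)).add (hd (1 / 80) 6 t)).add
      (hd (5 / 896) 8 t)).add (hd (1 / 225) 10 t)).congr_deriv
      (by push_cast; ring) |>.congr_of_eventuallyEq (Eventually.of_forall fun t => ?_)
    simp only [absCovUpper, Pi.add_apply]; ring
  · intro t
    refine (((((hd 1 1 t).add (hd (1 / 6) 3 t)).add (hd (3 / 40) 5 t)).add
      (hd (5 / 112) 7 t)).add (hd (2 / 45) 9 t)).congr_deriv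
      (by push_cast; ring) |>.congr_of_eventuallyEq (Eventually.of_forall fun t => ?_)
    simp only [Pi.add_apply]; ring
  · intro t h0 h1
    have h2 : t ^ 2 ≤ 0.34 := by nlinarith
    have hx : 0 ≤ t ^ 2 := sq_nonneg t
    have h4 : (t ^ 2) ^ 2 ≤ 0.34 ^ 2 := by gcongr
    have h6 : (t ^ 2) ^ 3 ≤ 0.34 ^ 3 := by gcongr
    have h8 : (t ^ 2) ^ 4 ≤ 0.34 ^ 4 := by gcongr
    have h10 : (t ^ 2) ^ 5 ≤ 0.34 ^ 5 := by gcongr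
    have h : 0 ≤ t ^ 8 * (81 / 320 - 99 / 160 * t ^ 2 - 303 / 1280 * (t ^ 2) ^ 2 -
        189 / 1280 * (t ^ 2) ^ 3 - 9 / 100 * (t ^ 2) ^ 4 - 4 / 25 * (t ^ 2) ^ 5) := by
      refine mul_nonneg (by positivity) ?_
      norm_num at *
      linarith
    linarith

lemma absCov_nonneg {t : ℝ} (h0 : 0 ≤ t) (h1 : t < 1) : 0 ≤ absCov t :=
  le_trans (by unfold absCovLower; positivity) (absCovLower_le h0 h1)

lemma absCovUpper_le {x : ℝ} (h0 : 0 ≤ x) (h1 : x ≤ 1 / 3) : absCovUpper x ≤ 0.53 * x := by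
  have h2 : x ^ 2 ≤ (1 / 3) ^ 2 := by gcongr
  have h3 : x ^ 3 ≤ (1 / 3) ^ 3 := by gcongr
  have h4 : x ^ 4 ≤ (1 / 3) ^ 4 := by gcongr
  have h : 0 ≤ x * (0.03 - x / 24 - x ^ 2 / 80 - 5 * x ^ 3 / 896 - x ^ 4 / 225) := by
    refine mul_nonneg h0 ?_
    norm_num at *
    linarith
  unfold absCovUpper
  linarith

/-! ### The terms of the variance series -/

lemma blockVar_eq (l : ℕ) : blockVar l = (1 / 2) ^ l - (1 / 2) ^ (2 * l) := by
  unfold blockVar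
  rw [zpow_neg, zpow_neg, one_div, inv_pow, inv_pow]
  norm_cast

lemma blockVar_eq_mul (l : ℕ) : blockVar l = ((1 / 2) ^ l) ^ 2 * (2 ^ l - 1) := by
  have h : (1 / 2 : ℝ) ^ l * 2 ^ l = 1 := by rw [← mul_pow]; norm_num
  rw [blockVar_eq, pow_mul']
  linear_combination (-(1 / 2 : ℝ) ^ l) * h

lemma one_le_two_pow_sub_one {l : ℕ} (hl : 1 ≤ l) : (1 : ℝ) ≤ 2 ^ l - 1 := by
  have : (2 : ℝ) ^ 1 ≤ 2 ^ l := pow_le_pow_right₀ (by norm_num) hl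
  linarith

lemma three_le_two_pow_sub_one {l : ℕ} (hl : 2 ≤ l) : (3 : ℝ) ≤ 2 ^ l - 1 := by
  have : (2 : ℝ) ^ 2 ≤ 2 ^ l := pow_le_pow_right₀ (by norm_num) hl
  linarith

lemma blockVar_pos {l : ℕ} (hl : 1 ≤ l) : 0 < blockVar l := by
  have := one_le_two_pow_sub_one hl
  rw [blockVar_eq_mul]; positivity

lemma blockVar_le (l : ℕ) : blockVar l ≤ (1 / 2) ^ l := by
  rw [blockVar_eq]
  have : (0 : ℝ) ≤ (1 / 2) ^ (2 * l) := by positivity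
  linarith

lemma sqrt_blockVar (l : ℕ) : √(blockVar l) = (1 / 2) ^ l * √(2 ^ l - 1) := by
  rw [blockVar_eq_mul, Real.sqrt_mul (by positivity), Real.sqrt_sq (by positivity)]

lemma blockCorr_eq {l k : ℕ} (hl : 1 ≤ l) (hk : 1 ≤ k) :
    blockCorr l k = -(√((2 ^ l - 1) * (2 ^ k - 1)))⁻¹ := by
  have h1 := one_le_two_pow_sub_one hl
  have h2 := one_le_two_pow_sub_one hk
  have h3 : 0 < √((2 : ℝ) ^ l - 1) := Real.sqrt_pos.2 (by linarith)
  have h4 : 0 < √((2 : ℝ) ^ k - 1) := Real.sqrt_pos.2 (by linarith)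
  have h5 : (2 : ℝ) ^ (-((l : ℤ) + (k : ℤ))) = (1 / 2) ^ l * (1 / 2) ^ k := by
    rw [zpow_neg, ← pow_add, one_div, inv_pow]; norm_cast
  rw [blockCorr, sqrt_blockVar, sqrt_blockVar, Real.sqrt_mul (by linarith), h5]
  field_simp

/-- The square is rational, which is why the bounds for `absCov` are stated as functions of `t ^ 2`.
-/
lemma blockCorr_sq {l k : ℕ} (hl : 1 ≤ l) (hk : 1 ≤ k) :
    blockCorr l k ^ 2 = ((2 ^ l - 1) * (2 ^ k - 1))⁻¹ := by
  have h1 := one_le_two_pow_sub_one hl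
  have h2 := one_le_two_pow_sub_one hk
  rw [blockCorr_eq hl hk, neg_sq, inv_pow, Real.sq_sqrt (mul_nonneg (by linarith) (by linarith))]

lemma blockCorr_sq_le {l k : ℕ} (hl : 1 ≤ l) (hlk : l < k) : blockCorr l k ^ 2 ≤ 1 / 3 := by
  rw [blockCorr_sq hl (by omega), one_div]
  have h1 := one_le_two_pow_sub_one hl
  have h2 := three_le_two_pow_sub_one (l := k) (by omega)
  exact inv_anti₀ (by norm_num) (by nlinarith)

lemma blockCorr_nonpos (l k : ℕ) : blockCorr l k ≤ 0 := by
  unfold blockCorr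
  exact div_nonpos_of_nonpos_of_nonneg (neg_nonpos.2 (by positivity)) (by positivity)

lemma neg_blockCorr_lt {l k : ℕ} (hl : 1 ≤ l) (hlk : l < k) : -blockCorr l k < 0.58 := by
  have := blockCorr_sq_le hl hlk
  nlinarith [blockCorr_nonpos l k]

lemma varTerm_eq (l k : ℕ) :
    varTerm l k = √(blockVar l) * √(blockVar k) * absCov (-blockCorr l k) := by
  rw [absCov_neg]; rfl

lemma le_varTerm {l k : ℕ} (hl : 1 ≤ l) (hlk : l < k) :
    √(blockVar l) * √(blockVar k) * absCovLower ((2 ^ l - 1) * (2 ^ k - 1))⁻¹ ≤ varTerm l k := by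
  have h := absCovLower_le (neg_nonneg.2 (blockCorr_nonpos l k))
    ((neg_blockCorr_lt hl hlk).trans (by norm_num))
  rw [neg_sq, blockCorr_sq hl (by omega)] at h
  rw [varTerm_eq]
  gcongr

lemma varTerm_le {l k : ℕ} (hl : 1 ≤ l) (hlk : l < k) :
    varTerm l k ≤ √(blockVar l) * √(blockVar k) * absCovUpper ((2 ^ l - 1) * (2 ^ k - 1))⁻¹ := by
  have h := absCov_le_upper (neg_nonneg.2 (blockCorr_nonpos l k)) (neg_blockCorr_lt hl hlk)
  rw [neg_sq, blockCorr_sq hl (by omega)] at h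
  rw [varTerm_eq]
  gcongr

lemma varTerm_nonneg {l k : ℕ} (hl : 1 ≤ l) (hlk : l < k) : 0 ≤ varTerm l k := by
  rw [varTerm_eq]
  have := absCov_nonneg (neg_nonneg.2 (blockCorr_nonpos l k))
    ((neg_blockCorr_lt hl hlk).trans (by norm_num))
  positivity

/-- With `x = ρ²` one has `√v_l √v_k = 2^(-l-k) / √x`, while `absCov ≤ 0.53 x`; what remains is
`0.53 · 2^(-l-k) √x`, and `√x ≤ 1/c`. The choice `c = 1` gives summability, and a larger `c` a sharp
numerical tail. -/
lemma varTerm_le_div {l k : ℕ} (hl : 1 ≤ l) (hlk : l < k) {c : ℝ} (hc : 0 < c)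
    (hck : c ^ 2 ≤ 2 ^ k - 1) : varTerm l k ≤ 0.53 / c * ((1 / 2) ^ l * (1 / 2) ^ k) := by
  have h1 := one_le_two_pow_sub_one hl
  have h2 := one_le_two_pow_sub_one (l := k) (by omega)
  have hx := blockCorr_sq_le hl hlk
  rw [blockCorr_sq hl (by omega)] at hx
  have hpos : (0 : ℝ) < (2 ^ l - 1) * (2 ^ k - 1) := mul_pos (by linarith) (by linarith)
  refine (varTerm_le hl hlk).trans ?_
  have h3 := absCovUpper_le (inv_nonneg.2 hpos.le) hx
  have hs : √(blockVar l) * √(blockVar k) =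
      (1 / 2) ^ l * (1 / 2) ^ k * √((2 ^ l - 1) * (2 ^ k - 1)) := by
    rw [sqrt_blockVar, sqrt_blockVar, Real.sqrt_mul (by linarith)]; ring
  have hsq : √(((2 : ℝ) ^ l - 1) * (2 ^ k - 1)) * ((2 ^ l - 1) * (2 ^ k - 1))⁻¹ ≤ c⁻¹ := by
    have hs0 : 0 < √(((2 : ℝ) ^ l - 1) * (2 ^ k - 1)) := Real.sqrt_pos.2 hpos
    have : √(((2 : ℝ) ^ l - 1) * (2 ^ k - 1)) * ((2 ^ l - 1) * (2 ^ k - 1))⁻¹ =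
        (√(((2 : ℝ) ^ l - 1) * (2 ^ k - 1)))⁻¹ := by
      nth_rw 2 [← Real.mul_self_sqrt hpos.le]
      field_simp
    rw [this]
    refine inv_anti₀ hc (Real.le_sqrt_of_sq_le ?_)
    nlinarith
  calc √(blockVar l) * √(blockVar k) * absCovUpper ((2 ^ l - 1) * (2 ^ k - 1))⁻¹
      ≤ √(blockVar l) * √(blockVar k) * (0.53 * ((2 ^ l - 1) * (2 ^ k - 1))⁻¹) := by gcongr
    _ = 0.53 * ((1 / 2) ^ l * (1 / 2) ^ k) *
        (√(((2 : ℝ) ^ l - 1) * (2 ^ k - 1)) * ((2 ^ l - 1) * (2 ^ k - 1))⁻¹) := by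
      rw [hs]; ring
    _ ≤ 0.53 * ((1 / 2) ^ l * (1 / 2) ^ k) * c⁻¹ := by gcongr
    _ = _ := by ring

lemma summable_half_mul_half : Summable fun p : ℕ × ℕ => (1 / 2 : ℝ) ^ p.1 * (1 / 2) ^ p.2 :=
  summable_geometric_two.mul_of_nonneg summable_geometric_two (fun _ => by positivity)
    (fun _ => by positivity)

/-- `varTerm`, extended by zero to all pairs of indices. -/
def varTermExt (p : ℕ × ℕ) : ℝ :=
  {p : ℕ × ℕ | 1 ≤ p.1 ∧ p.1 < p.2}.indicator (fun p => varTerm p.1 p.2) p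

lemma varTermExt_nonneg (p : ℕ × ℕ) : 0 ≤ varTermExt p :=
  Set.indicator_nonneg (fun _ hp => varTerm_nonneg hp.1 hp.2) p

lemma summable_varTermExt : Summable varTermExt := by
  refine Summable.of_nonneg_of_le varTermExt_nonneg (fun p => ?_) summable_half_mul_half
  unfold varTermExt
  by_cases hp : 1 ≤ p.1 ∧ p.1 < p.2
  · rw [Set.indicator_of_mem (show p ∈ {p : ℕ × ℕ | 1 ≤ p.1 ∧ p.1 < p.2} from hp)]
    refine (varTerm_le_div hp.1 hp.2 one_pos ?_).trans ?_
    · simpa using one_le_two_pow_sub_one (l := p.2) (by omega)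
    · refine mul_le_of_le_one_left (by positivity) (by norm_num)
  · rw [Set.indicator_of_notMem (show p ∉ {p : ℕ × ℕ | 1 ≤ p.1 ∧ p.1 < p.2} from hp)]
    positivity

lemma summable_varTerm :
    Summable fun p : {p : ℕ × ℕ // 1 ≤ p.1 ∧ p.1 < p.2} => varTerm p.1.1 p.1.2 :=
  summable_subtype_iff_indicator.2 summable_varTermExt

lemma tsum_varTerm :
    ∑' p : {p : ℕ × ℕ // 1 ≤ p.1 ∧ p.1 < p.2}, varTerm p.1.1 p.1.2 = ∑' p, varTermExt p :=
  tsum_subtype {p : ℕ × ℕ | 1 ≤ p.1 ∧ p.1 < p.2} fun p => varTerm p.1 p.2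

lemma summable_sqrt_blockVar : Summable fun l : ℕ => √(blockVar (l + 1)) := by
  have h : Summable fun l : ℕ => ((√2)⁻¹ : ℝ) ^ l := by
    refine summable_geometric_of_lt_one (by positivity) ?_
    exact inv_lt_one_of_one_lt₀ (by rw [Real.lt_sqrt] <;> norm_num)
  refine Summable.of_nonneg_of_le (fun _ => Real.sqrt_nonneg _) (fun l => ?_)
    ((summable_nat_add_iff 1).2 h)
  refine (Real.sqrt_le_sqrt (blockVar_le _)).trans (le_of_eq ?_)
  rw [← inv_sqrt_two_sq, ← pow_mul, mul_comm, pow_mul, Real.sqrt_sq (by positivity)]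

/-! ### Square integrability, mean and variance of `M` -/

section

variable {Ω : Type*} [MeasurableSpace Ω] {P : Measure Ω}

/-- Minkowski's inequality for the partial sums, followed by Fatou: they converge almost everywhere
when the norms are summable. -/
lemma eLpNorm_tsum_le {p : ENNReal} (hp : 1 ≤ p) {f : ℕ → Ω → ℝ}
    (hf : ∀ l, AEStronglyMeasurable (f l) P) (h : ∑' l, eLpNorm (f l) p P ≠ ⊤) :
    eLpNorm (fun ω => ∑' l, f l ω) p P ≤ ∑' l, eLpNorm (f l) p P := by
  have hs := summable_norm_of_tsum_eLpNorm_ne_top hp hf h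
  have hlim : ∀ᵐ ω ∂P, Tendsto (fun n => (∑ l ∈ Finset.range n, f l) ω) atTop
      (𝓝 (∑' l, f l ω)) := by
    filter_upwards [hs] with ω hω
    simpa using hω.of_norm.hasSum.tendsto_sum_nat
  refine (Lp.eLpNorm_lim_le_liminf_eLpNorm
    (fun n => Finset.aestronglyMeasurable_sum _ fun l _ => hf l) _ hlim).trans ?_
  refine liminf_le_of_frequently_le' (Eventually.frequently (Eventually.of_forall fun n => ?_))
  exact (eLpNorm_sum_le (fun l _ => hf l) hp).trans (ENNReal.sum_le_tsum _)

lemma eLpNorm_two_eq {f : Ω → ℝ} (hf : MemLp f 2 P) :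
    eLpNorm f 2 P = ENNReal.ofReal (√(∫ ω, f ω ^ 2 ∂P)) := by
  rw [hf.eLpNorm_eq_integral_rpow_norm (by norm_num) (by norm_num), Real.sqrt_eq_rpow]
  simp

end

lemma IIDGaussianOn.isStdGaussian {Ω : Type*} [MeasurableSpace Ω] {P : Measure Ω} {Z : ℕ → Ω → ℝ}
    {S : Set ℕ} (hZ : IIDGaussianOn S Z 0 1 P) :
    IsStdGaussian (fun j : S => Z j) P :=
  isStdGaussian_of_iIndepFun hZ.indep fun j => by simpa using hZ.law j j.2

section

variable {Ω : Type*} {Z : ℕ → Ω → ℝ}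

lemma bridgeInc_mem_span (l : ℕ) :
    bridgeInc Z l ∈ Submodule.span ℝ (Set.range fun j : Set.Ici 1 => Z j) :=
  bridgeInc_mem (fun j hj => Submodule.subset_span (Set.mem_range_self (⟨j, hj⟩ : Set.Ici 1))) l

lemma limitM_eq (z : ℕ → ℝ) : limitM z = 1 / 2 * ∑' l, |bridgeInc z l| := by
  simp only [limitM, limitTerm_succ]

lemma limitM_apply (Z : ℕ → Ω → ℝ) (ω : Ω) :
    limitM (fun j => Z j ω) = 1 / 2 * ∑' l, |bridgeInc Z l ω| := by
  simp only [limitM_eq, bridgeInc_apply]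

end

namespace IsStdGaussian

variable {Ω : Type*} [MeasurableSpace Ω] {P : Measure Ω} {Z : ℕ → Ω → ℝ}

lemma memLp_ici (hZ : IsStdGaussian (fun j : Set.Ici 1 => Z j) P) (j : ℕ) (hj : 1 ≤ j) :
    MemLp (Z j) 2 P :=
  (hZ.gaussian.hasGaussianLaw_eval ⟨j, hj⟩).memLp_two

lemma cov_bridgeInc_self (hZ : IsStdGaussian (fun j : Set.Ici 1 => Z j) P) (l : ℕ) :
    cov[bridgeInc Z l, bridgeInc Z l; P] = blockVar (l + 1) := by
  have := hZ.gaussian.isProbabilityMeasure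
  rw [BinaryDAC.cov_bridgeInc_self hZ.memLp_ici (fun j hj => hZ.cov_self ⟨j, hj⟩)
    (fun i j hi hj hij => hZ.cov_ne ⟨i, hi⟩ ⟨j, hj⟩ fun h => hij (congrArg Subtype.val h)), blockVar_eq]

lemma cov_bridgeInc_ne (hZ : IsStdGaussian (fun j : Set.Ici 1 => Z j) P) {l k : ℕ} (hlk : l ≠ k) :
    cov[bridgeInc Z l, bridgeInc Z k; P] = -(1 / 2) ^ ((l + 1) + (k + 1)) := by
  have := hZ.gaussian.isProbabilityMeasure
  exact BinaryDAC.cov_bridgeInc_ne hZ.memLp_ici (fun j hj => hZ.cov_self ⟨j, hj⟩)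
    (fun i j hi hj hij => hZ.cov_ne ⟨i, hi⟩ ⟨j, hj⟩ fun h => hij (congrArg Subtype.val h)) hlk

lemma integral_sq_of_mem_span {ι : Type*} {X : ι → Ω → ℝ} (hX : IsStdGaussian X P) {f : Ω → ℝ}
    (hf : f ∈ Submodule.span ℝ (Set.range X)) : ∫ ω, f ω ^ 2 ∂P = cov[f, f; P] := by
  have := hX.gaussian.isProbabilityMeasure
  rw [covariance_eq_sub (hX.memLp_of_mem_span hf) (hX.memLp_of_mem_span hf),
    hX.mean_of_mem_span hf]
  simp [sq]

lemma eLpNorm_of_mem_span {ι : Type*} {X : ι → Ω → ℝ} (hX : IsStdGaussian X P) {f : Ω → ℝ}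
    (hf : f ∈ Submodule.span ℝ (Set.range X)) :
    eLpNorm f 2 P = ENNReal.ofReal (√(cov[f, f; P])) := by
  rw [eLpNorm_two_eq (hX.memLp_of_mem_span hf), hX.integral_sq_of_mem_span hf]

lemma eLpNorm_bridgeInc (hZ : IsStdGaussian (fun j : Set.Ici 1 => Z j) P) (l : ℕ) :
    eLpNorm (fun ω => |bridgeInc Z l ω|) 2 P = ENNReal.ofReal (√(blockVar (l + 1))) := by
  have h : eLpNorm (fun ω => |bridgeInc Z l ω|) 2 P = eLpNorm (bridgeInc Z l) 2 P :=
    eLpNorm_norm (bridgeInc Z l)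
  rw [h, hZ.eLpNorm_of_mem_span (bridgeInc_mem_span l), hZ.cov_bridgeInc_self]

lemma memLp_bridgeInc (hZ : IsStdGaussian (fun j : Set.Ici 1 => Z j) P) (l : ℕ) :
    MemLp (bridgeInc Z l) 2 P :=
  hZ.memLp_of_mem_span (bridgeInc_mem_span l)

lemma tsum_eLpNorm_bridgeInc_ne_top (hZ : IsStdGaussian (fun j : Set.Ici 1 => Z j) P) :
    ∑' l, eLpNorm (fun ω => |bridgeInc Z l ω|) 2 P ≠ ⊤ := by
  simp_rw [hZ.eLpNorm_bridgeInc]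
  exact summable_sqrt_blockVar.tsum_ofReal_ne_top

lemma ae_summable_bridgeInc (hZ : IsStdGaussian (fun j : Set.Ici 1 => Z j) P) :
    ∀ᵐ ω ∂P, Summable fun l => |bridgeInc Z l ω| := by
  filter_upwards [summable_norm_of_tsum_eLpNorm_ne_top (by norm_num)
    (fun l => (hZ.memLp_bridgeInc l).abs.1) hZ.tsum_eLpNorm_bridgeInc_ne_top] with ω hω
  simpa using hω

lemma aestronglyMeasurable_limitM (hZ : IsStdGaussian (fun j : Set.Ici 1 => Z j) P) :
    AEStronglyMeasurable (fun ω => limitM fun j => Z j ω) P := by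
  simp only [limitM_apply]
  refine AEStronglyMeasurable.const_mul ?_ _
  refine aestronglyMeasurable_of_tendsto_ae atTop
    (f := fun n ω => ∑ l ∈ Finset.range n, |bridgeInc Z l ω|) (fun n => ?_) ?_
  · exact Finset.aestronglyMeasurable_fun_sum _ fun l _ => (hZ.memLp_bridgeInc l).abs.1
  · filter_upwards [hZ.ae_summable_bridgeInc] with ω hω
    exact hω.hasSum.tendsto_sum_nat

lemma memLp_limitM (hZ : IsStdGaussian (fun j : Set.Ici 1 => Z j) P) :
    MemLp (fun ω => limitM fun j => Z j ω) 2 P := by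
  refine ⟨hZ.aestronglyMeasurable_limitM, ?_⟩
  simp only [limitM_apply]
  refine (eLpNorm_const_smul_le (c := (1 / 2 : ℝ)) (f := fun ω => ∑' l, |bridgeInc Z l ω|)).trans_lt
    (ENNReal.mul_lt_top enorm_lt_top ?_)
  exact (eLpNorm_tsum_le (by norm_num) (fun l => (hZ.memLp_bridgeInc l).abs.1)
    hZ.tsum_eLpNorm_bridgeInc_ne_top).trans_lt hZ.tsum_eLpNorm_bridgeInc_ne_top.lt_top

lemma integral_abs_bridgeInc (hZ : IsStdGaussian (fun j : Set.Ici 1 => Z j) P) (l : ℕ) :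
    ∫ ω, |bridgeInc Z l ω| ∂P = √(2 / Real.pi) * √(blockVar (l + 1)) := by
  rw [hZ.integral_abs (bridgeInc_mem_span l), hZ.cov_bridgeInc_self]

lemma integral_limitM_eq (hZ : IsStdGaussian (fun j : Set.Ici 1 => Z j) P) :
    ∫ ω, (limitM fun j => Z j ω) ∂P = 1 / 2 * ∑' l, ∫ ω, |bridgeInc Z l ω| ∂P := by
  have := hZ.gaussian.isProbabilityMeasure
  simp only [limitM_apply]
  rw [integral_const_mul, ← integral_tsum_of_summable_integral_norm]
  · exact fun l => (hZ.memLp_bridgeInc l).abs.integrable (by norm_num)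
  · simp only [Real.norm_eq_abs, abs_abs, hZ.integral_abs_bridgeInc]
    exact summable_sqrt_blockVar.mul_left _

lemma integral_limitM (hZ : IsStdGaussian (fun j : Set.Ici 1 => Z j) P) :
    ∫ ω, (limitM fun j => Z j ω) ∂P = (√(2 * Real.pi))⁻¹ * ∑' l, √(blockVar (l + 1)) := by
  rw [hZ.integral_limitM_eq]
  simp only [hZ.integral_abs_bridgeInc]
  rw [tsum_mul_left, ← mul_assoc]
  congr 1
  rw [Real.sqrt_div (by norm_num), Real.sqrt_mul (by norm_num)]
  have h2 : √2 * √2 = 2 := Real.mul_self_sqrt (by norm_num)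
  have : 0 < √2 := by positivity
  have : 0 < √Real.pi := Real.sqrt_pos.2 Real.pi_pos
  field_simp
  linarith

lemma integrable_abs_mul_abs (hZ : IsStdGaussian (fun j : Set.Ici 1 => Z j) P) (p : ℕ × ℕ) :
    Integrable (fun ω => |bridgeInc Z p.1 ω| * |bridgeInc Z p.2 ω|) P :=
  (hZ.memLp_bridgeInc p.1).abs.integrable_mul (hZ.memLp_bridgeInc p.2).abs

/-- The covariance `-2^(-(l+1)-(k+1))` of the two increments is `blockCorr` times their standard
deviations, so the formula for correlated normals applies. -/
lemma integral_abs_bridgeInc_mul_ne (hZ : IsStdGaussian (fun j : Set.Ici 1 => Z j) P)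
    {l k : ℕ} (hlk : l < k) :
    ∫ ω, |bridgeInc Z l ω| * |bridgeInc Z k ω| ∂P =
      2 / Real.pi * (√(blockVar (l + 1)) * √(blockVar (k + 1)) + varTerm (l + 1) (k + 1)) := by
  have h1 := blockVar_pos (l := l + 1) (by omega)
  have h2 := blockVar_pos (l := k + 1) (by omega)
  have hl : 0 < √(blockVar (l + 1)) := Real.sqrt_pos.2 h1
  have hk : 0 < √(blockVar (k + 1)) := Real.sqrt_pos.2 h2
  have h5 : (2 : ℝ) ^ (-(((l + 1 : ℕ) : ℤ) + ((k + 1 : ℕ) : ℤ))) =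
      (1 / 2) ^ ((l + 1) + (k + 1)) := by
    rw [zpow_neg, one_div, inv_pow]; norm_cast
  rw [hZ.integral_abs_mul_abs (bridgeInc_mem_span l) (bridgeInc_mem_span k) hl hk
    (ρ := blockCorr (l + 1) (k + 1))
    ((blockCorr_sq_le (by omega) (by omega)).trans_lt (by norm_num))
    (by rw [hZ.cov_bridgeInc_self, Real.sq_sqrt h1.le])
    (by rw [hZ.cov_bridgeInc_self, Real.sq_sqrt h2.le])
    (by rw [hZ.cov_bridgeInc_ne hlk.ne, blockCorr, h5]; field_simp), varTerm]
  ring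

lemma integral_abs_bridgeInc_mul_self (hZ : IsStdGaussian (fun j : Set.Ici 1 => Z j) P) (l : ℕ) :
    ∫ ω, |bridgeInc Z l ω| * |bridgeInc Z l ω| ∂P = blockVar (l + 1) := by
  rw [← hZ.cov_bridgeInc_self, ← hZ.integral_sq_of_mem_span (bridgeInc_mem_span l)]
  simp [sq]

/-- The terms of the double series for the variance. -/
lemma cov_abs_bridgeInc (hZ : IsStdGaussian (fun j : Set.Ici 1 => Z j) P) (p : ℕ × ℕ) :
    ∫ ω, |bridgeInc Z p.1 ω| * |bridgeInc Z p.2 ω| ∂P -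
      (∫ ω, |bridgeInc Z p.1 ω| ∂P) * ∫ ω, |bridgeInc Z p.2 ω| ∂P =
      2 / Real.pi * varTermExt (p.1 + 1, p.2 + 1) + 2 / Real.pi * varTermExt (p.2 + 1, p.1 + 1) +
        if p.1 = p.2 then (1 - 2 / Real.pi) * blockVar (p.1 + 1) else 0 := by
  obtain ⟨l, k⟩ := p
  have hs : √(2 / Real.pi) * √(2 / Real.pi) = 2 / Real.pi :=
    Real.mul_self_sqrt (div_nonneg (by norm_num) Real.pi_pos.le)
  have hlt : ∀ {a b : ℕ}, a < b → varTermExt (a + 1, b + 1) = varTerm (a + 1) (b + 1) := by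
    intro a b hab
    exact Set.indicator_of_mem
      (show (a + 1, b + 1) ∈ {p : ℕ × ℕ | 1 ≤ p.1 ∧ p.1 < p.2} from ⟨by simp, by simpa using hab⟩) _
  have hge : ∀ {a b : ℕ}, b ≤ a → varTermExt (a + 1, b + 1) = 0 := by
    intro a b hab
    exact Set.indicator_of_notMem
      (show (a + 1, b + 1) ∉ {p : ℕ × ℕ | 1 ≤ p.1 ∧ p.1 < p.2} by simpa using hab) _
  simp only [hZ.integral_abs_bridgeInc]
  rcases lt_trichotomy l k with h | rfl | h
  · rw [hlt h, hge h.le, if_neg h.ne, hZ.integral_abs_bridgeInc_mul_ne h]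
    linear_combination (-√(blockVar (l + 1)) * √(blockVar (k + 1))) * hs
  · rw [hge le_rfl, if_pos rfl, hZ.integral_abs_bridgeInc_mul_self]
    have := Real.mul_self_sqrt (blockVar_pos (l := l + 1) (by omega)).le
    linear_combination (-√(blockVar (l + 1)) * √(blockVar (l + 1))) * hs - 2 / Real.pi * this
  · rw [hlt h, hge h.le, if_neg h.ne']
    have := hZ.integral_abs_bridgeInc_mul_ne h
    simp_rw [mul_comm |bridgeInc Z l _|]
    rw [this]
    linear_combination (-√(blockVar (l + 1)) * √(blockVar (k + 1))) * hs

/-- Cauchy–Schwarz bounds each mixed moment by `√v √v`, a product of summable sequences. This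
justifies integrating the squared series term by term. -/
lemma summable_integral_abs_mul_abs (hZ : IsStdGaussian (fun j : Set.Ici 1 => Z j) P) :
    Summable fun p : ℕ × ℕ => ∫ ω, |bridgeInc Z p.1 ω| * |bridgeInc Z p.2 ω| ∂P := by
  have h1 : Summable fun p : ℕ × ℕ => √(blockVar (p.1 + 1)) * √(blockVar (p.2 + 1)) :=
    summable_sqrt_blockVar.mul_of_nonneg summable_sqrt_blockVar
      (fun _ => Real.sqrt_nonneg _) (fun _ => Real.sqrt_nonneg _)
  refine Summable.of_nonneg_of_le (fun p => integral_nonneg fun ω => by positivity)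
    (fun p => ?_) h1
  have h := integral_mul_le_Lp_mul_Lq_of_nonneg (μ := P) (f := fun ω => |bridgeInc Z p.1 ω|)
    (g := fun ω => |bridgeInc Z p.2 ω|) Real.HolderConjugate.two_two
    (ae_of_all _ fun _ => abs_nonneg _) (ae_of_all _ fun _ => abs_nonneg _)
    (by rw [ENNReal.ofReal_ofNat]; exact (hZ.memLp_bridgeInc p.1).abs)
    (by rw [ENNReal.ofReal_ofNat]; exact (hZ.memLp_bridgeInc p.2).abs)
  refine h.trans (le_of_eq ?_)
  simp only [Real.rpow_two, sq_abs, hZ.integral_sq_of_mem_span (bridgeInc_mem_span _),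
    hZ.cov_bridgeInc_self, Real.sqrt_eq_rpow]

lemma variance_limitM_eq (hZ : IsStdGaussian (fun j : Set.Ici 1 => Z j) P) :
    variance (fun ω => limitM fun j => Z j ω) P =
      1 / 4 * ∑' p : ℕ × ℕ, (∫ ω, |bridgeInc Z p.1 ω| * |bridgeInc Z p.2 ω| ∂P -
        (∫ ω, |bridgeInc Z p.1 ω| ∂P) * ∫ ω, |bridgeInc Z p.2 ω| ∂P) := by
  have := hZ.gaussian.isProbabilityMeasure
  have hE : Summable fun l => ∫ ω, |bridgeInc Z l ω| ∂P := by
    simp only [hZ.integral_abs_bridgeInc]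
    exact summable_sqrt_blockVar.mul_left _
  have hEE : Summable fun p : ℕ × ℕ =>
      (∫ ω, |bridgeInc Z p.1 ω| ∂P) * ∫ ω, |bridgeInc Z p.2 ω| ∂P :=
    hE.mul_of_nonneg hE (fun _ => integral_nonneg fun _ => abs_nonneg _)
      (fun _ => integral_nonneg fun _ => abs_nonneg _)
  have hsq : ∫ ω, (limitM fun j => Z j ω) ^ 2 ∂P =
      1 / 4 * ∑' p : ℕ × ℕ, ∫ ω, |bridgeInc Z p.1 ω| * |bridgeInc Z p.2 ω| ∂P := by
    rw [integral_tsum_of_summable_integral_norm hZ.integrable_abs_mul_abs, ← integral_const_mul]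
    · refine integral_congr_ae ?_
      filter_upwards [hZ.ae_summable_bridgeInc] with ω hω
      simp only [limitM_apply]
      rw [← hω.tsum_mul_tsum hω (hω.mul_of_nonneg hω (fun _ => abs_nonneg _)
        (fun _ => abs_nonneg _))]
      ring
    · simpa using hZ.summable_integral_abs_mul_abs
  rw [variance_eq_sub hZ.memLp_limitM, hZ.integral_limitM_eq,
    hZ.summable_integral_abs_mul_abs.tsum_sub hEE, ← hE.tsum_mul_tsum hE hEE]
  simp only [Pi.pow_apply]
  rw [hsq]
  ring

/-- The two off-diagonal halves of the double series agree by symmetry. The diagonal gives `(1/4) (1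
- 2/π) ∑ v_l`, where `∑ v_l = 1 - 1/3 = 2/3`. -/
lemma variance_limitM (hZ : IsStdGaussian (fun j : Set.Ici 1 => Z j) P) :
    variance (fun ω => limitM fun j => Z j ω) P =
      1 / Real.pi * (∑' p : {p : ℕ × ℕ // 1 ≤ p.1 ∧ p.1 < p.2}, varTerm p.1.1 p.1.2) +
        1 / 6 * (1 - 2 / Real.pi) := by
  have hinj : Function.Injective fun p : ℕ × ℕ => (p.1 + 1, p.2 + 1) := by
    rintro ⟨a, b⟩ ⟨c, d⟩ h
    simpa using h
  have hsum : Summable fun p : ℕ × ℕ => varTermExt (p.1 + 1, p.2 + 1) :=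
    summable_varTermExt.comp_injective hinj
  have htsum : ∑' p : ℕ × ℕ, varTermExt (p.1 + 1, p.2 + 1) = ∑' p, varTermExt p := by
    refine hinj.tsum_eq (f := varTermExt) ?_
    rintro ⟨a, b⟩ hab
    have hm : (a, b) ∈ {p : ℕ × ℕ | 1 ≤ p.1 ∧ p.1 < p.2} := by
      by_contra h
      exact hab (Set.indicator_of_notMem h _)
    have h1 : 1 ≤ a := hm.1
    have h2 : a < b := hm.2
    exact ⟨(a - 1, b - 1), by simp; omega⟩
  have hswap : HasSum (fun p : ℕ × ℕ => varTermExt (p.2 + 1, p.1 + 1)) (∑' p, varTermExt p) := by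
    have := (Equiv.prodComm ℕ ℕ).hasSum_iff.2 (htsum ▸ hsum.hasSum)
    exact this
  have hv : HasSum (fun l : ℕ => blockVar (l + 1)) (2 / 3) := by
    have h1 : HasSum (fun l : ℕ => (1 / 2 : ℝ) * (1 / 2) ^ l) (1 / 2 * 2) :=
      hasSum_geometric_two.mul_left _
    have h2 := (hasSum_geometric_of_lt_one (r := (1 / 4 : ℝ)) (by norm_num)
      (by norm_num)).mul_left (1 / 4)
    have e : (fun l : ℕ => blockVar (l + 1)) =
        fun l => 1 / 2 * (1 / 2) ^ l - 1 / 4 * (1 / 4) ^ l := by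
      funext l
      rw [blockVar_eq, show (1 / 4 : ℝ) = (1 / 2) ^ 2 by norm_num, ← pow_mul]
      ring
    rw [e]
    have h3 := h1.sub h2
    rwa [show (1 / 2 * 2 - 1 / 4 * (1 - 1 / 4)⁻¹ : ℝ) = 2 / 3 by norm_num] at h3
  have hdiag : HasSum (fun p : ℕ × ℕ => if p.1 = p.2 then
      (1 - 2 / Real.pi) * blockVar (p.1 + 1) else 0) ((1 - 2 / Real.pi) * (2 / 3)) := by
    have hi : Function.Injective fun l : ℕ => (l, l) := fun a b h => (Prod.mk.inj h).1
    rw [← hi.hasSum_iff]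
    · simpa [Function.comp_def] using hv.mul_left (1 - 2 / Real.pi)
    · rintro ⟨a, b⟩ h
      refine if_neg fun hab => h ⟨a, ?_⟩
      simpa using hab
  have hall := (((htsum ▸ hsum.hasSum).mul_left (2 / Real.pi)).add
    (hswap.mul_left (2 / Real.pi))).add hdiag
  rw [hZ.variance_limitM_eq, tsum_varTerm]
  simp_rw [hZ.cov_abs_bridgeInc]
  rw [hall.tsum_eq]
  ring

end IsStdGaussian

/-! ### Numerical evaluation -/

/-- Decimal approximations of `10 ^ 9 * √(blockVar l)`, rounded down. -/
def sqrtTable : ℕ → ℝ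
  | 1 => 500000000
  | 2 => 433012701
  | 3 => 330718913
  | 4 => 242061459
  | 5 => 173992636
  | 6 => 124019592
  | 7 => 88042403
  | 8 => 62377810
  | 9 => 44150994
  | 10 => 31234737
  | 11 => 22091691
  | 12 => 15623092
  | 13 => 11047869
  | 14 => 7812261
  | 15 => 5524187
  | 16 => 3906220
  | _ => 0

lemma sqrtTable_nonneg (l : ℕ) : 0 ≤ sqrtTable l := by
  unfold sqrtTable; split <;> norm_num

lemma sqrt_blockVar_mem {l : ℕ} (h1 : 1 ≤ l) (h2 : l ≤ 16) :
    sqrtTable l / 10 ^ 9 ≤ √(blockVar l) ∧ √(blockVar l) ≤ (sqrtTable l + 1) / 10 ^ 9 := by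
  have h0 := sqrtTable_nonneg l
  suffices h : (sqrtTable l / 10 ^ 9) ^ 2 ≤ blockVar l ∧
      blockVar l ≤ ((sqrtTable l + 1) / 10 ^ 9) ^ 2 from
    ⟨Real.le_sqrt_of_sq_le h.1, Real.sqrt_le_iff.2 ⟨by positivity, h.2⟩⟩
  rw [blockVar_eq]
  interval_cases l <;> constructor <;> norm_num [sqrtTable]

lemma sum_indicator_lt_eq (f : ℕ × ℕ → ℝ) (K : ℕ) :
    ∑ p ∈ Finset.range K ×ˢ Finset.range K,
      {p : ℕ × ℕ | 1 ≤ p.1 ∧ p.1 < p.2}.indicator f p =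
      ∑ k ∈ Finset.range K, ∑ l ∈ Finset.Ico 1 k, f (l, k) := by
  rw [Finset.sum_product_right]
  refine Finset.sum_congr rfl fun k hk => ?_
  have hsub : Finset.Ico 1 k ⊆ Finset.range K := fun l hl => by
    simp only [Finset.mem_Ico, Finset.mem_range] at *; omega
  rw [← Finset.sum_subset hsub]
  · refine Finset.sum_congr rfl fun l hl => ?_
    exact Set.indicator_of_mem (by simpa using hl) _
  · intro l _ hl
    exact Set.indicator_of_notMem (by simpa using hl) _

lemma absCovLower_ge {x : ℝ} (hx : 0 ≤ x) : x / 2 + x ^ 2 / 24 ≤ absCovLower x := by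
  have : 0 ≤ x ^ 3 / 80 + 5 * x ^ 4 / 896 + 7 * x ^ 5 / 2304 + 21 * x ^ 6 / 11264 := by positivity
  unfold absCovLower; linarith

lemma absCovUpper_le_of_le {x : ℝ} (h0 : 0 ≤ x) (h1 : x ≤ 1 / 3) :
    absCovUpper x ≤ x / 2 + x ^ 2 / 20 := by
  have h3 : x ^ 2 ≤ (1 / 3) ^ 2 := by gcongr
  have h4 : x ^ 3 ≤ (1 / 3) ^ 3 := by gcongr
  have h : 0 ≤ x ^ 2 * (1 / 120 - x / 80 - 5 * x ^ 2 / 896 - x ^ 3 / 225) := by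
    refine mul_nonneg (by positivity) ?_
    norm_num at *
    linarith
  unfold absCovUpper
  linarith

/-- Only the pairs with `k < 4` need the long polynomial; for `4 ≤ k < 13` the value of `x` is so
small that two terms are accurate enough. -/
lemma le_sum_absCovLower : (0.0612675 : ℝ) ≤
    (∑ k ∈ Finset.range 4, ∑ l ∈ Finset.Ico 1 k,
      sqrtTable l / 10 ^ 9 * (sqrtTable k / 10 ^ 9) *
        absCovLower ((2 ^ l - 1) * (2 ^ k - 1))⁻¹) +
    ∑ k ∈ Finset.Ico 4 13, ∑ l ∈ Finset.Ico 1 k,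
      sqrtTable l / 10 ^ 9 * (sqrtTable k / 10 ^ 9) *
        (((2 ^ l - 1) * (2 ^ k - 1))⁻¹ / 2 + ((2 ^ l - 1) * (2 ^ k - 1))⁻¹ ^ 2 / 24) := by
  norm_num [Finset.sum_range_succ, Finset.sum_Ico_succ_top, sqrtTable, absCovLower]

lemma sum_absCovUpper_le :
    (∑ k ∈ Finset.range 4, ∑ l ∈ Finset.Ico 1 k,
      (sqrtTable l + 1) / 10 ^ 9 * ((sqrtTable k + 1) / 10 ^ 9) *
        absCovUpper ((2 ^ l - 1) * (2 ^ k - 1))⁻¹) +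
    ∑ k ∈ Finset.Ico 4 13, ∑ l ∈ Finset.Ico 1 k,
      (sqrtTable l + 1) / 10 ^ 9 * ((sqrtTable k + 1) / 10 ^ 9) *
        (((2 ^ l - 1) * (2 ^ k - 1))⁻¹ / 2 + ((2 ^ l - 1) * (2 ^ k - 1))⁻¹ ^ 2 / 20) ≤
      (0.06129 : ℝ) := by
  norm_num [Finset.sum_range_succ, Finset.sum_Ico_succ_top, sqrtTable, absCovUpper]

lemma inv_mul_nonneg_and_le {l k : ℕ} (hl : 1 ≤ l) (hlk : l < k) :
    (0 : ℝ) ≤ ((2 ^ l - 1) * (2 ^ k - 1))⁻¹ ∧ (((2 : ℝ) ^ l - 1) * (2 ^ k - 1))⁻¹ ≤ 1 / 3 := by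
  rw [← blockCorr_sq hl (by omega)]
  exact ⟨sq_nonneg _, blockCorr_sq_le hl hlk⟩

lemma le_sum_varTerm :
    (0.0612675 : ℝ) ≤ ∑ k ∈ Finset.range 13, ∑ l ∈ Finset.Ico 1 k, varTerm l k := by
  rw [← Finset.sum_range_add_sum_Ico _ (by norm_num : 4 ≤ 13)]
  refine le_sum_absCovLower.trans (add_le_add ?_ ?_) <;>
  refine Finset.sum_le_sum fun k hk => Finset.sum_le_sum fun l hl => ?_ <;>
  simp only [Finset.mem_range, Finset.mem_Ico] at hk hl <;>
  refine le_trans ?_ (le_varTerm hl.1 hl.2) <;>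
  have hx := inv_mul_nonneg_and_le hl.1 hl.2 <;>
  have h1 := (sqrt_blockVar_mem (l := l) hl.1 (by omega)).1 <;>
  have h2 := (sqrt_blockVar_mem (l := k) (by omega) (by omega)).1 <;>
  have h3 := sqrtTable_nonneg l <;>
  have h4 := sqrtTable_nonneg k
  · have : 0 ≤ absCovLower ((2 ^ l - 1) * (2 ^ k - 1))⁻¹ := by
      refine le_trans ?_ (absCovLower_ge hx.1); have := hx.1; positivity
    gcongr
  · have h5 := absCovLower_ge hx.1
    have := hx.1
    gcongr

lemma sum_varTerm_le :
    ∑ k ∈ Finset.range 13, ∑ l ∈ Finset.Ico 1 k, varTerm l k ≤ 0.06129 := by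
  rw [← Finset.sum_range_add_sum_Ico _ (by norm_num : 4 ≤ 13)]
  refine (add_le_add ?_ ?_).trans sum_absCovUpper_le <;>
  refine Finset.sum_le_sum fun k hk => Finset.sum_le_sum fun l hl => ?_ <;>
  simp only [Finset.mem_range, Finset.mem_Ico] at hk hl <;>
  refine (varTerm_le hl.1 hl.2).trans ?_ <;>
  have hx := inv_mul_nonneg_and_le hl.1 hl.2 <;>
  have h1 := (sqrt_blockVar_mem (l := l) hl.1 (by omega)).2 <;>
  have h2 := (sqrt_blockVar_mem (l := k) (by omega) (by omega)).2 <;>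
  have h3 := sqrtTable_nonneg l <;>
  have h4 := sqrtTable_nonneg k <;>
  have h6 : 0 ≤ absCovUpper ((2 ^ l - 1) * (2 ^ k - 1))⁻¹ := by
    { have := hx.1; unfold absCovUpper; positivity }
  · gcongr
  · have h5 := absCovUpper_le_of_le hx.1 hx.2
    gcongr

lemma le_tsum_varTermExt : (0.0612675 : ℝ) ≤ ∑' p, varTermExt p := by
  refine le_sum_varTerm.trans (le_trans (le_of_eq ?_) (summable_varTermExt.sum_le_tsum
    (Finset.range 13 ×ˢ Finset.range 13) fun p _ => varTermExt_nonneg p))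
  exact (sum_indicator_lt_eq (fun p => varTerm p.1 p.2) 13).symm

/-- Beyond the `13 × 13` square the second index of a nonzero term is at least `13`. There `c = 90`
is admissible, as `90² = 8100 ≤ 2^13 - 1`, and the total tail is below `3 · 10^(-6)`. -/
lemma varTermExt_le (p : ℕ × ℕ) : varTermExt p ≤
    ((Finset.range 13 ×ˢ Finset.range 13 : Finset (ℕ × ℕ)) : Set (ℕ × ℕ)).indicator varTermExt p +
      0.53 / 90 * ((1 / 2) ^ p.1 * (Set.Ici 13).indicator (fun k => (1 / 2) ^ k) p.2) := by
  obtain ⟨l, k⟩ := p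
  have hnn : 0 ≤ (Set.Ici 13).indicator (fun k => (1 / 2 : ℝ) ^ k) k :=
    Set.indicator_nonneg (fun _ _ => by positivity) _
  by_cases hp : (l, k) ∈
      ((Finset.range 13 ×ˢ Finset.range 13 : Finset (ℕ × ℕ)) : Set (ℕ × ℕ))
  · rw [Set.indicator_of_mem hp]
    have : 0 ≤ 0.53 / 90 * ((1 / 2) ^ l * (Set.Ici 13).indicator (fun k => (1 / 2 : ℝ) ^ k) k) := by
      positivity
    linarith
  · rw [Set.indicator_of_notMem hp, zero_add]
    by_cases hq : (l, k) ∈ {p : ℕ × ℕ | 1 ≤ p.1 ∧ p.1 < p.2}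
    · have hl : 1 ≤ l := hq.1
      have hlk : l < k := hq.2
      have hk : k ∈ Set.Ici 13 := by
        simp only [Finset.coe_product, Finset.coe_range, Set.mem_prod, Set.mem_Iio] at hp
        simp only [Set.mem_Ici]; omega
      rw [Set.indicator_of_mem hk]
      refine (le_of_eq (Set.indicator_of_mem hq _)).trans
        (varTerm_le_div hl hlk (by norm_num) ?_)
      have : (2 : ℝ) ^ 13 ≤ 2 ^ k := pow_le_pow_right₀ (by norm_num) hk
      norm_num at this ⊢
      linarith
    · refine (le_of_eq (Set.indicator_of_notMem hq _)).trans ?_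
      positivity

lemma tsum_varTermExt_le : ∑' p, varTermExt p ≤ 0.061293 := by
  have h1 : HasSum (((Finset.range 13 ×ˢ Finset.range 13 : Finset (ℕ × ℕ)) :
      Set (ℕ × ℕ)).indicator varTermExt) (∑ p ∈ Finset.range 13 ×ˢ Finset.range 13, varTermExt p) :=
    hasSum_subtype_iff_indicator.1 (Finset.hasSum _ _)
  have h2 : HasSum ((Set.Ici 13).indicator fun k : ℕ => (1 / 2 : ℝ) ^ k) ((1 / 2) ^ 12) := by
    have hi : Function.Injective fun k : ℕ => k + 13 := add_left_injective 13
    rw [← hi.hasSum_iff]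
    · have h3 := hasSum_geometric_two.mul_left ((1 / 2 : ℝ) ^ 13)
      rw [show ((1 / 2 : ℝ) ^ 13 * 2) = (1 / 2) ^ 12 by norm_num] at h3
      refine Eq.mpr (congrArg (fun f => HasSum f _) (funext fun k => ?_)) h3
      rw [Function.comp_apply, Set.indicator_of_mem (by simp), pow_add, mul_comm]
    · intro k hk
      refine Set.indicator_of_notMem (fun h => hk ⟨k - 13, ?_⟩) _
      exact Nat.sub_add_cancel h
  have h3 : HasSum (fun p : ℕ × ℕ => (1 / 2 : ℝ) ^ p.1 *
      (Set.Ici 13).indicator (fun k => (1 / 2) ^ k) p.2) (2 * (1 / 2) ^ 12) :=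
    hasSum_geometric_two.mul h2 (summable_geometric_two.mul_of_nonneg h2.summable
      (fun _ => by positivity) (fun _ => Set.indicator_nonneg (fun _ _ => by positivity) _))
  refine (hasSum_le varTermExt_le summable_varTermExt.hasSum (h1.add (h3.mul_left _))).trans ?_
  have h4 : ∑ p ∈ Finset.range 13 ×ˢ Finset.range 13, varTermExt p =
      ∑ k ∈ Finset.range 13, ∑ l ∈ Finset.Ico 1 k, varTerm l k :=
    sum_indicator_lt_eq (fun p => varTerm p.1 p.2) 13
  rw [h4]
  have h5 := sum_varTerm_le
  norm_num at h5 ⊢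
  linarith

lemma variance_numeric {V S : ℝ} (hV : V = 1 / Real.pi * S + 1 / 6 * (1 - 2 / Real.pi))
    (h1 : 0.0612675 ≤ S) (h2 : S ≤ 0.061293) : |V - 0.08007| ≤ 0.000005 := by
  have hp := Real.pi_pos
  have hp1 := Real.pi_gt_d20
  have hp2 := Real.pi_lt_d20
  have e : V - 0.08007 = (S - 1 / 3 + (1 / 6 - 0.08007) * Real.pi) / Real.pi := by
    rw [hV]; field_simp; ring
  -- After clearing the denominator everything is linear in `S` and `π`.
  rw [e, abs_le, le_div_iff₀ hp, div_le_iff₀ hp]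
  norm_num at *
  constructor <;> linarith

/-- From `v_l = 2^(-l) (1 - 2^(-l))`: the square root of the second factor lies between `1 -
2^(-17)` and `1`, so the tail is geometric up to a negligible factor. -/
lemma tail_sqrt_blockVar_bounds {l : ℕ} (hl : 17 ≤ l) :
    (1 - (1 / 2) ^ 17) * (√2)⁻¹ ^ l ≤ √(blockVar l) ∧ √(blockVar l) ≤ (√2)⁻¹ ^ l := by
  have h2 : ((√2)⁻¹ ^ l : ℝ) ^ 2 = (1 / 2) ^ l := by
    rw [← inv_sqrt_two_sq, ← pow_mul, ← pow_mul, mul_comm]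
  have hr : (0 : ℝ) ≤ (√2)⁻¹ ^ l := by positivity
  have hle : (1 / 2 : ℝ) ^ l ≤ (1 / 2) ^ 17 := pow_le_pow_of_le_one (by norm_num) (by norm_num) hl
  have h0 : (0 : ℝ) < (1 / 2) ^ l := by positivity
  constructor
  · refine Real.le_sqrt_of_sq_le ?_
    rw [mul_pow, h2, blockVar_eq, pow_mul']
    have : (1 - (1 / 2 : ℝ) ^ 17) ^ 2 ≤ 1 - (1 / 2) ^ l := by
      refine le_trans ?_ (sub_le_sub_left hle 1)
      norm_num
    nlinarith
  · refine Real.sqrt_le_iff.2 ⟨hr, ?_⟩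
    rw [h2]; exact blockVar_le l

lemma hasSum_tail_geometric : HasSum (fun l : ℕ => ((√2)⁻¹ : ℝ) ^ (l + 16 + 1))
    ((√2 + 1) / 256) := by
  have h1 : (√2)⁻¹ < 1 := inv_lt_one_of_one_lt₀ (by rw [Real.lt_sqrt] <;> norm_num)
  have h := (hasSum_geometric_of_lt_one (by positivity) h1).mul_left ((√2)⁻¹ ^ 17 : ℝ)
  have e : (√2)⁻¹ ^ 17 * (1 - (√2)⁻¹)⁻¹ = (√2 + 1) / 256 := by
    have h2 : √2 ^ 2 = 2 := Real.sq_sqrt (by norm_num)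
    have h3 : 1 < √2 := by rw [Real.lt_sqrt] <;> norm_num
    have h4 : ((√2)⁻¹ : ℝ) ^ 17 = 1 / 256 * (√2)⁻¹ := by
      rw [show 17 = 2 * 8 + 1 by rfl, pow_succ, pow_mul, inv_sqrt_two_sq]; norm_num
    have h5 : √2 - 1 ≠ 0 := by linarith
    have h6 : 1 - (√2)⁻¹ = (√2 - 1) / √2 := by field_simp
    rw [h4, h6]
    field_simp
    linarith
  rw [e] at h
  refine Eq.mpr (congrArg (fun f => HasSum f _) (funext fun l => ?_)) h
  rw [← pow_add]; congr 1; omega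

lemma tsum_sqrt_blockVar_bounds :
    2.10504688 ≤ ∑' l, √(blockVar (l + 1)) ∧ ∑' l, √(blockVar (l + 1)) ≤ 2.10504720 := by
  have hs := summable_sqrt_blockVar
  rw [← hs.sum_add_tsum_nat_add 16]
  have hs' : Summable fun l : ℕ => √(blockVar (l + 16 + 1)) := (summable_nat_add_iff 16).2 hs
  have t1 := hasSum_le (fun l => (tail_sqrt_blockVar_bounds (l := l + 16 + 1) (by omega)).1)
    (hasSum_tail_geometric.mul_left _) hs'.hasSum
  have t2 := hasSum_le (fun l => (tail_sqrt_blockVar_bounds (l := l + 16 + 1) (by omega)).2)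
    hs'.hasSum hasSum_tail_geometric
  have f1 : ∑ l ∈ Finset.range 16, sqrtTable (l + 1) / 10 ^ 9 ≤
      ∑ l ∈ Finset.range 16, √(blockVar (l + 1)) := Finset.sum_le_sum fun l hl =>
    (sqrt_blockVar_mem (by omega) (by have := Finset.mem_range.1 hl; omega)).1
  have f2 : ∑ l ∈ Finset.range 16, √(blockVar (l + 1)) ≤
      ∑ l ∈ Finset.range 16, (sqrtTable (l + 1) + 1) / 10 ^ 9 := Finset.sum_le_sum fun l hl =>
    (sqrt_blockVar_mem (by omega) (by have := Finset.mem_range.1 hl; omega)).2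
  have r1 : 1.414213562 ≤ √2 := Real.le_sqrt_of_sq_le (by norm_num)
  have r2 : √2 ≤ 1.414213563 := Real.sqrt_le_iff.2 ⟨by norm_num, by norm_num⟩
  norm_num [Finset.sum_range_succ, sqrtTable] at f1 f2 t1 t2 r1 r2 ⊢
  constructor <;> linarith

lemma mean_numeric {S : ℝ} (h1 : 2.10504688 ≤ S) (h2 : S ≤ 2.10504720) :
    |(√(2 * Real.pi))⁻¹ * S - 0.839792| ≤ 0.0000005 := by
  have hp1 := Real.pi_gt_d20
  have hp2 := Real.pi_lt_d20
  have q1 : 2.5066282 ≤ √(2 * Real.pi) :=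
    Real.le_sqrt_of_sq_le (by norm_num at *; linarith)
  have q2 : √(2 * Real.pi) ≤ 2.5066283 :=
    Real.sqrt_le_iff.2 ⟨by norm_num, by norm_num at *; linarith⟩
  have hq : 0 < √(2 * Real.pi) := by linarith
  have e : (√(2 * Real.pi))⁻¹ * S - 0.839792 =
      (S - 0.839792 * √(2 * Real.pi)) / √(2 * Real.pi) := by field_simp
  rw [e, abs_le, le_div_iff₀ hq, div_le_iff₀ hq]
  norm_num at *
  constructor <;> linarith

/-! ### The coupling with a Brownian motion -/

lemma sqrt_two_mul_inv : √2 * (√2)⁻¹ = 1 := mul_inv_cancel₀ (by positivity)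

lemma two_pow_eq (i : ℕ) : (2 : ℝ) ^ i = √2 ^ i * √2 ^ i := by
  rw [← mul_pow, Real.mul_self_sqrt (by norm_num)]

lemma half_pow_eq (i : ℕ) : (1 / 2 : ℝ) ^ i = (√2)⁻¹ ^ i * (√2)⁻¹ ^ i := by
  rw [← mul_pow, ← sq, inv_sqrt_two_sq]

lemma sqrt_two_sq : √2 ^ 2 = 2 := Real.sq_sqrt (by norm_num)

/-- The normalized increments of the Brownian motion that has the bridge `bridge y` and the
value `y 0` at time `1`. -/
def brownianInc {V : Type*} [AddCommGroup V] [Module ℝ V] (y : ℕ → V) (l : ℕ) : V :=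
  (√2 ^ (l + 1) : ℝ) • bridgeInc y l + ((√2)⁻¹ ^ (l + 1) : ℝ) • y 0

/-- The normalized unit currents: the block sums of `ξ` are replaced by given values `X`. -/
def stdUnit {V : Type*} [AddCommGroup V] [Module ℝ V] (X ξ : ℕ → V) (N j : ℕ) : V :=
  ξ j + ((√2)⁻¹ ^ Nat.log 2 j : ℝ) • (X (N - 1 - Nat.log 2 j) - ((√2)⁻¹ ^ Nat.log 2 j : ℝ) •
    ∑ m ∈ Finset.Ico (2 ^ Nat.log 2 j) (2 ^ (Nat.log 2 j + 1)), ξ m)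

lemma log_two_of_mem {i j : ℕ} (hj : j ∈ Finset.Ico (2 ^ i) (2 ^ (i + 1))) : Nat.log 2 j = i := by
  rw [Finset.mem_Ico] at hj
  exact Nat.log_eq_of_pow_le_of_lt_pow hj.1 hj.2

lemma mem_Ico_log {j i : ℕ} (hj : 1 ≤ j) :
    j ∈ Finset.Ico (2 ^ i) (2 ^ (i + 1)) ↔ Nat.log 2 j = i := by
  refine ⟨log_two_of_mem, ?_⟩
  rintro rfl
  exact Finset.mem_Ico.2 ⟨Nat.pow_log_le_self 2 (by omega), Nat.lt_pow_succ_log_self (by norm_num) j⟩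

lemma log_lt {N j : ℕ} (hj : j ∈ Set.Icc 1 (numUnits N)) : Nat.log 2 j < N := by
  have := Nat.one_le_two_pow (n := N)
  have h1 := hj.1
  have h2 := hj.2
  unfold numUnits at h2
  exact Nat.log_lt_of_lt_pow (by omega) (by omega)

lemma card_block (i : ℕ) : (Finset.Ico (2 ^ i) (2 ^ (i + 1))).card = 2 ^ i := by
  rw [Nat.card_Ico, pow_succ]; omega

lemma two_pow_mul_inv_sqrt (i : ℕ) : (2 : ℝ) ^ i * (√2)⁻¹ ^ i * (√2)⁻¹ ^ i = 1 := by
  rw [mul_assoc, ← mul_pow, ← mul_pow, ← sq, inv_sqrt_two_sq]; norm_num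

/-- The correction removes the block sum of `ξ` and distributes the prescribed value evenly over the
`2 ^ i` currents. The most significant bit `i = N - 1` receives `X 0`, the increment over the
longest dyadic interval. -/
lemma sum_block_stdUnit {V : Type*} [AddCommGroup V] [Module ℝ V] (X ξ : ℕ → V) (N i : ℕ) :
    ∑ j ∈ Finset.Ico (2 ^ i) (2 ^ (i + 1)), stdUnit X ξ N j = (√2 ^ i : ℝ) • X (N - 1 - i) := by
  have h : ∀ j ∈ Finset.Ico (2 ^ i) (2 ^ (i + 1)), stdUnit X ξ N j =
      ξ j + ((√2)⁻¹ ^ i : ℝ) • (X (N - 1 - i) - ((√2)⁻¹ ^ i : ℝ) •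
        ∑ m ∈ Finset.Ico (2 ^ i) (2 ^ (i + 1)), ξ m) := by
    intro j hj
    rw [stdUnit, log_two_of_mem hj]
  rw [Finset.sum_congr rfl h, Finset.sum_add_distrib, Finset.sum_const, card_block,
    ← Nat.cast_smul_eq_nsmul ℝ, smul_sub, smul_sub, smul_smul, smul_smul, smul_smul]
  push_cast
  rw [two_pow_mul_inv_sqrt, one_smul]
  have : (2 : ℝ) ^ i * (√2)⁻¹ ^ i = √2 ^ i := by
    rw [two_pow_eq, mul_assoc, ← mul_pow, sqrt_two_mul_inv, one_pow, mul_one]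
  rw [this]
  abel

section Covariance

variable {Ω : Type*} [MeasurableSpace Ω] {P : Measure Ω} [IsProbabilityMeasure P]
  {X ξ : ℕ → Ω → ℝ}

lemma cov_block_sum (hξ : ∀ j, MemLp (ξ j) 2 P) (h1 : ∀ j, cov[ξ j, ξ j; P] = 1)
    (h0 : ∀ i j, i ≠ j → cov[ξ i, ξ j; P] = 0) (s : Finset ℕ) (a : ℕ) :
    cov[ξ a, ∑ m ∈ s, ξ m; P] = if a ∈ s then 1 else 0 := by
  rw [covariance_sum_right' (fun i _ => hξ i) (hξ a)]
  have : ∀ m ∈ s, cov[ξ a, ξ m; P] = if a = m then 1 else 0 := by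
    intro m _
    split_ifs with h
    · rw [h, h1]
    · exact h0 _ _ h
  rw [Finset.sum_congr rfl this, Finset.sum_ite_eq]

/-- In a block of length `2 ^ i`, one normalized standard direction is exchanged for another
independent one. Each of the two cross terms between `ξ` and the correction contributes `-2^(-i)`,
the corrections among themselves `2 · 2^(-i)`; these cancel. Distinct blocks do not interact. -/
lemma cov_stdUnit {N : ℕ} (hX : ∀ j, MemLp (X j) 2 P) (hξ : ∀ j, MemLp (ξ j) 2 P)
    (hX1 : ∀ j, cov[X j, X j; P] = 1) (hX0 : ∀ i j, i ≠ j → cov[X i, X j; P] = 0)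
    (hξ1 : ∀ j, cov[ξ j, ξ j; P] = 1) (hξ0 : ∀ i j, i ≠ j → cov[ξ i, ξ j; P] = 0)
    (hXξ : ∀ i j, cov[X i, ξ j; P] = 0) {a b : ℕ} (ha : a ∈ Set.Icc 1 (numUnits N))
    (hb : b ∈ Set.Icc 1 (numUnits N)) :
    cov[stdUnit X ξ N a, stdUnit X ξ N b; P] = cov[ξ a, ξ b; P] := by
  have hS : ∀ s : Finset ℕ, MemLp (∑ m ∈ s, ξ m) 2 P := fun s => memLp_finsetSum' s fun m _ => hξ m
  set B : ℕ → Finset ℕ := fun i => Finset.Ico (2 ^ i) (2 ^ (i + 1)) with hB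
  set r : ℝ := (√2)⁻¹ with hr
  let e : ℕ → Ω → ℝ := fun i => X (N - 1 - i) - r ^ i • ∑ m ∈ B i, ξ m
  have he : ∀ i, MemLp (e i) 2 P := fun i => (hX _).sub ((hS _).const_smul _)
  have hu : ∀ j, stdUnit X ξ N j = ξ j + r ^ Nat.log 2 j • e (Nat.log 2 j) := fun j => rfl
  have hXS : ∀ (i : ℕ) (s : Finset ℕ), cov[X i, ∑ m ∈ s, ξ m; P] = 0 := by
    intro i s
    rw [covariance_sum_right' (fun i _ => hξ i) (hX i)]
    exact Finset.sum_eq_zero fun m _ => hXξ i m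
  have hξe : ∀ j i, 1 ≤ j → cov[ξ j, e i; P] = if Nat.log 2 j = i then -r ^ i else 0 := by
    intro j i hj
    simp only [e]
    rw [covariance_sub_right (hξ j) (hX _) ((hS _).const_smul _), covariance_smul_right,
      cov_block_sum hξ hξ1 hξ0, covariance_comm, hXξ]
    simp only [hB, mem_Ico_log hj]
    split_ifs <;> simp
  have hSS : ∀ i k, cov[∑ m ∈ B i, ξ m, ∑ m ∈ B k, ξ m; P] = if i = k then 2 ^ i else 0 := by
    intro i k
    rw [covariance_sum_left' (fun i _ => hξ i) (hS _)]
    have : ∀ m ∈ B i, cov[ξ m, ∑ m ∈ B k, ξ m; P] = if i = k then 1 else 0 := by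
      intro m hm
      have h1 : 1 ≤ m := Nat.one_le_two_pow.trans (Finset.mem_Ico.1 hm).1
      rw [cov_block_sum hξ hξ1 hξ0]
      simp only [hB, mem_Ico_log h1, log_two_of_mem hm]
    rw [Finset.sum_congr rfl this, Finset.sum_const, hB, card_block]
    split_ifs <;> simp
  have hee : ∀ i k, i < N → k < N → cov[e i, e k; P] = if i = k then 2 else 0 := by
    intro i k hi hk
    have hXX : cov[X (N - 1 - i), X (N - 1 - k); P] = if i = k then 1 else 0 := by
      split_ifs with h
      · rw [h, hX1]
      -- The truncated subtraction `N - 1 - i` is injective only for `i < N`, whence the bounds on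
      -- `i` and `k`.
      · exact hX0 _ _ (by omega)
    simp only [e]
    rw [covariance_sub_sub (hX _) ((hS _).const_smul _) (hX _) ((hS _).const_smul _),
      covariance_smul_right, covariance_smul_left, covariance_smul_left, covariance_smul_right,
      covariance_comm (∑ m ∈ B i, ξ m) (X _), hXS, hXS, hSS, hXX]
    split_ifs with h
    · subst h
      have := two_pow_mul_inv_sqrt i
      rw [← hr] at this
      linear_combination this
    · simp
  rw [hu, hu, covariance_add_left (hξ a) ((he _).const_smul _) ((hξ b).add ((he _).const_smul _)),
    covariance_add_right (hξ a) (hξ b) ((he _).const_smul _),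
    covariance_add_right ((he _).const_smul _) (hξ b) ((he _).const_smul _),
    covariance_smul_left, covariance_smul_left, covariance_smul_right, covariance_smul_right,
    covariance_comm (e _) (ξ b), hξe a _ ha.1, hξe b _ hb.1, hee _ _ (log_lt ha) (log_lt hb)]
  by_cases h : Nat.log 2 a = Nat.log 2 b
  · rw [if_pos h, if_pos h.symm, if_pos h, h]
    ring
  · rw [if_neg h, if_neg (Ne.symm h), if_neg h]
    ring

end Covariance

lemma brownianInc_mem {Ω : Type*} {ζ : ℕ ⊕ ℕ → Ω → ℝ} (l : ℕ) :
    brownianInc (fun j => ζ (.inl j)) l ∈ Submodule.span ℝ (Set.range ζ) :=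
  Submodule.add_mem _ (Submodule.smul_mem _ _ (bridgeInc_mem
    (fun _ _ => Submodule.subset_span (Set.mem_range_self _)) l))
    (Submodule.smul_mem _ _ (Submodule.subset_span (Set.mem_range_self _)))

namespace IsStdGaussian

variable {Ω : Type*} [MeasurableSpace Ω] {P : Measure Ω}

lemma memLp {ι : Type*} {X : ι → Ω → ℝ} (h : IsStdGaussian X P) (i : ι) : MemLp (X i) 2 P :=
  h.memLp_of_mem_span (Submodule.subset_span (Set.mem_range_self i))

/-- Normalized increments of Brownian motion are orthonormal: the correlation `-2^(-(l+1)-(k+1))` of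
the bridge increments is compensated by the common endpoint `Y 0`. -/
lemma cov_brownianInc {ζ : ℕ ⊕ ℕ → Ω → ℝ} (h : IsStdGaussian ζ P) (l k : ℕ) :
    cov[brownianInc (fun j => ζ (.inl j)) l, brownianInc (fun j => ζ (.inl j)) k; P] =
      if l = k then 1 else 0 := by
  have := h.gaussian.isProbabilityMeasure
  set Y : ℕ → Ω → ℝ := fun j => ζ (.inl j) with hY
  have hm : ∀ j, 1 ≤ j → MemLp (Y j) 2 P := fun j _ => h.memLp _
  have h1 : ∀ j, 1 ≤ j → cov[Y j, Y j; P] = 1 := fun j _ => h.cov_self _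
  have h0 : ∀ i j, 1 ≤ i → 1 ≤ j → i ≠ j → cov[Y i, Y j; P] = 0 := fun i j _ _ hij =>
    h.cov_ne _ _ (by simpa using hij)
  have hY0 : MemLp (Y 0) 2 P := h.memLp _
  have hb : ∀ l, cov[bridge Y l, Y 0; P] = 0 := fun l =>
    cov_bridge_eq_zero hm hY0 fun j hj _ => h.cov_ne _ _ (by simp; omega)
  have hi : ∀ l, cov[bridgeInc Y l, Y 0; P] = 0 := by
    intro l
    rw [bridgeInc, covariance_sub_left (memLp_bridge hm _) (memLp_bridge hm _) hY0, hb, hb,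
      sub_zero]
  have hI : ∀ l, MemLp (bridgeInc Y l) 2 P := BinaryDAC.memLp_bridgeInc hm
  rw [brownianInc, brownianInc, covariance_add_left ((hI _).const_smul _) (hY0.const_smul _)
      (((hI _).const_smul _).add (hY0.const_smul _)),
    covariance_add_right ((hI _).const_smul _) ((hI _).const_smul _) (hY0.const_smul _),
    covariance_add_right (hY0.const_smul _) ((hI _).const_smul _) (hY0.const_smul _)]
  simp only [covariance_smul_left, covariance_smul_right, hi, covariance_comm (Y 0) (bridgeInc Y _)]
  rw [show cov[Y 0, Y 0; P] = 1 from h.cov_self _]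
  have hs : √2 ^ (l + 1) * √2 ^ (k + 1) * ((1 / 2 : ℝ) ^ (l + 1 + (k + 1))) =
      (√2)⁻¹ ^ (l + 1) * (√2)⁻¹ ^ (k + 1) := by
    rw [← inv_sqrt_two_sq, ← pow_add, ← pow_add, ← pow_mul, mul_comm 2, pow_mul, sq, ← mul_assoc,
      ← mul_pow, sqrt_two_mul_inv, one_pow, one_mul]
  split_ifs with hlk
  · subst hlk
    rw [BinaryDAC.cov_bridgeInc_self hm h1 h0]
    have h2 : √2 ^ (l + 1) * √2 ^ (l + 1) * (1 / 2 : ℝ) ^ (l + 1) = 1 := by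
      rw [← mul_pow, ← mul_pow, ← sq, sqrt_two_sq]; norm_num
    rw [← two_mul] at hs
    linear_combination h2 - hs
  · rw [BinaryDAC.cov_bridgeInc_ne hm h1 h0 hlk]
    linear_combination -hs

lemma cov_brownianInc_inr {ζ : ℕ ⊕ ℕ → Ω → ℝ} (h : IsStdGaussian ζ P) (l j : ℕ) :
    cov[brownianInc (fun j => ζ (.inl j)) l, ζ (.inr j); P] = 0 := by
  have := h.gaussian.isProbabilityMeasure
  have hm : ∀ j, 1 ≤ j → MemLp (ζ (.inl j)) 2 P := fun j _ => h.memLp _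
  have hb : ∀ l, cov[bridge (fun j => ζ (.inl j)) l, ζ (.inr j); P] = 0 := fun l =>
    cov_bridge_eq_zero hm (h.memLp _) fun j hj _ => h.cov_ne _ _ (by simp)
  rw [brownianInc, covariance_add_left ((BinaryDAC.memLp_bridgeInc hm l).const_smul _)
    ((h.memLp _).const_smul _) (h.memLp _), covariance_smul_left, covariance_smul_left, bridgeInc,
    covariance_sub_left (memLp_bridge hm _) (memLp_bridge hm _) (h.memLp _), hb, hb,
    h.cov_ne _ _ (by simp)]
  simp

/-- The normalized unit currents of the coupling are independent standard normals. -/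
lemma stdUnit {ζ : ℕ ⊕ ℕ → Ω → ℝ} (h : IsStdGaussian ζ P) (N : ℕ) :
    IsStdGaussian (fun j : Set.Icc 1 (numUnits N) =>
      BinaryDAC.stdUnit (brownianInc fun j => ζ (.inl j)) (fun j => ζ (.inr j)) N j) P := by
  have := h.gaussian.isProbabilityMeasure
  have key : ∀ a b : Set.Icc 1 (numUnits N),
      cov[BinaryDAC.stdUnit (brownianInc fun j => ζ (.inl j)) (fun j => ζ (.inr j)) N a,
        BinaryDAC.stdUnit (brownianInc fun j => ζ (.inl j)) (fun j => ζ (.inr j)) N b; P] =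
      cov[ζ (.inr a), ζ (.inr b); P] := fun a b =>
    cov_stdUnit (fun j => h.memLp_of_mem_span (brownianInc_mem j)) (fun j => h.memLp _)
      (fun j => by rw [h.cov_brownianInc, if_pos rfl])
      (fun i j hij => by rw [h.cov_brownianInc, if_neg hij])
      (fun j => h.cov_self _) (fun i j hij => h.cov_ne _ _ (by simpa using hij))
      (fun i j => h.cov_brownianInc_inr i j) a.2 b.2
  refine h.of_mem_span (fun j => ?_) (fun a => ?_) (fun a b hab => ?_)
  · have hin : ∀ i, ζ i ∈ Submodule.span ℝ (Set.range ζ) := fun i =>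
      Submodule.subset_span (Set.mem_range_self _)
    exact Submodule.add_mem _ (hin _) (Submodule.smul_mem _ _ (Submodule.sub_mem _
      (brownianInc_mem _) (Submodule.smul_mem _ _ (Submodule.sum_mem _ fun m _ => hin _))))
  · rw [key, h.cov_self]
  · rw [key, h.cov_ne]
    intro hc
    exact hab (Subtype.ext (Sum.inr_injective hc))

lemma iidGaussianOn {S : Set ℕ} {X : ℕ → Ω → ℝ} (h : IsStdGaussian (fun j : S => X j) P)
    (m : ℝ) {σ : ℝ} : IIDGaussianOn S (fun j ω => m + σ * X j ω) m (σ ^ 2) P where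
  indep := h.iIndepFun.comp (fun _ x => m + σ * x) fun _ => by fun_prop
  law j hj := by
    have hl := h.hasLaw ⟨j, hj⟩
    refine ⟨by have := hl.aemeasurable; fun_prop, ?_⟩
    have : (fun ω => m + σ * X j ω) = (fun x => m + x) ∘ (fun x => σ * x) ∘ X j := rfl
    rw [this, ← AEMeasurable.map_map_of_aemeasurable (by fun_prop)
      ((by fun_prop : Measurable fun x : ℝ => σ * x).comp_aemeasurable hl.aemeasurable),
      ← AEMeasurable.map_map_of_aemeasurable (by fun_prop) hl.aemeasurable, hl.map_eq,
      gaussianReal_map_const_mul, gaussianReal_map_const_add]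
    congr 1
    · simp
    · ext; simp [sq_nonneg]

end IsStdGaussian

lemma brownianInc_apply {Ω : Type*} (Y : ℕ → Ω → ℝ) (l : ℕ) (ω : Ω) :
    brownianInc Y l ω = brownianInc (fun j => Y j ω) l := by
  simp [brownianInc, bridgeInc_apply]

lemma stdUnit_apply {Ω : Type*} (X ξ : ℕ → Ω → ℝ) (N j : ℕ) (ω : Ω) :
    stdUnit X ξ N j ω = stdUnit (fun j => X j ω) (fun j => ξ j ω) N j := by
  simp [stdUnit]

lemma sum_bridgeInc (y : ℕ → ℝ) (N : ℕ) : ∑ l ∈ Finset.range N, bridgeInc y l = -bridge y N := by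
  unfold bridgeInc
  rw [Finset.sum_range_sub']
  simp [bridge]

/-- The unit currents of the coupling, for given values of the driving normals. -/
def coupledUnit (m σ : ℝ) (y ξ : ℕ → ℝ) (N j : ℕ) : ℝ :=
  m + σ * stdUnit (brownianInc y) ξ N j

/-! ### Pathwise comparison of the deviations with `M` -/

section Pathwise

variable (m σ : ℝ) (y ξ : ℕ → ℝ) {N : ℕ}

lemma sum_block_coupledUnit (N i : ℕ) :
    ∑ j ∈ Finset.Ico (2 ^ i) (2 ^ (i + 1)), coupledUnit m σ y ξ N j =
      2 ^ i * m + σ * (√2 ^ i * brownianInc y (N - 1 - i)) := by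
  simp only [coupledUnit]
  rw [Finset.sum_add_distrib, ← Finset.mul_sum, sum_block_stdUnit, Finset.sum_const, card_block]
  simp

lemma sqrt_two_pow_of_lt {i : ℕ} (hi : i < N) : √2 ^ i = √2 ^ N * (√2)⁻¹ ^ (N - 1 - i + 1) := by
  obtain ⟨d, rfl⟩ := Nat.exists_eq_add_of_lt hi
  rw [show i + d + 1 - 1 - i + 1 = d + 1 by omega, show i + d + 1 = i + (d + 1) by ring, pow_add,
    mul_assoc, ← mul_pow, sqrt_two_mul_inv]
  simp

lemma inv_sqrt_mul_brownianInc (l : ℕ) :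
    (√2)⁻¹ ^ (l + 1) * brownianInc y l = bridgeInc y l + (1 / 2) ^ (l + 1) * y 0 := by
  simp only [brownianInc, smul_eq_mul]
  have h1 : ((√2)⁻¹ : ℝ) ^ (l + 1) * √2 ^ (l + 1) = 1 := by
    rw [← mul_pow, mul_comm, sqrt_two_mul_inv, one_pow]
  have h2 : ((√2)⁻¹ : ℝ) ^ (l + 1) * (√2)⁻¹ ^ (l + 1) = (1 / 2) ^ (l + 1) := by
    rw [← mul_pow, ← sq, inv_sqrt_two_sq]
  linear_combination bridgeInc y l * h1 + y 0 * h2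

/-- The block sums telescope to the increment of the Brownian motion between `2^(-N)` and `1`,
scaled by `√2 ^ N`. -/
lemma lsbCurrent_coupledUnit (hN : N ≠ 0) :
    lsbCurrent N (coupledUnit m σ y ξ N) =
      m + σ * (√2 ^ N / numUnits N * ((1 - (1 / 2) ^ N) * y 0 - bridge y N)) := by
  have hn := numUnits_pos hN
  have h1 : ∑ i ∈ Finset.range N, √2 ^ i * brownianInc y (N - 1 - i) =
      √2 ^ N * ((1 - (1 / 2) ^ N) * y 0 - bridge y N) := by
    have e : ∀ i ∈ Finset.range N, √2 ^ i * brownianInc y (N - 1 - i) =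
        √2 ^ N * (bridgeInc y (N - 1 - i) + (1 / 2) ^ (N - 1 - i + 1) * y 0) := by
      intro i hi
      rw [sqrt_two_pow_of_lt (Finset.mem_range.1 hi), mul_assoc, inv_sqrt_mul_brownianInc]
    rw [Finset.sum_congr rfl e, ← Finset.mul_sum,
      Finset.sum_range_reflect (fun l => bridgeInc y l + (1 / 2) ^ (l + 1) * y 0),
      Finset.sum_add_distrib, sum_bridgeInc, ← Finset.sum_mul]
    have h2 : ∑ l ∈ Finset.range N, (1 / 2 : ℝ) ^ (l + 1) = 1 - (1 / 2) ^ N := by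
      simp only [pow_succ']
      rw [← Finset.mul_sum, geom_sum_eq (by norm_num)]
      ring
    rw [h2]; ring
  have h3 : ∑ i ∈ Finset.range N, (2 : ℝ) ^ i = numUnits N := by
    rw [geom_sum_eq (by norm_num), numUnits_cast]; norm_num
  rw [lsbCurrent, ← sum_Ico_two_pow]
  simp only [sum_block_coupledUnit]
  rw [Finset.sum_add_distrib, ← Finset.sum_mul, ← Finset.mul_sum, h1, h3]
  field_simp

/-- The endpoint `y 0` drops out because `(2^N / n)(1 - 2^(-N)) = 1`. The term with `bridge y N` is
the price of the block sums starting at `2^(-N)` instead of `0`. -/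
lemma bitDev_coupledUnit {i : ℕ} (hi : i < N) :
    bitDev N (coupledUnit m σ y ξ N) i = σ * √2 ^ N * (bridgeInc y (N - 1 - i) +
      (1 / 2) ^ (N - 1 - i + 1) * (2 ^ N / numUnits N * bridge y N)) := by
  have hN : N ≠ 0 := by omega
  have hn := numUnits_pos hN
  have hc : (2 : ℝ) ^ N / numUnits N * (1 - (1 / 2) ^ N) = 1 := by
    rw [div_mul_eq_mul_div, div_eq_one_iff_eq hn.ne', numUnits_cast, mul_sub, mul_one, ← mul_pow]
    norm_num
  have h2 : (2 : ℝ) ^ i = 2 ^ N * (1 / 2) ^ (N - 1 - i + 1) := by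
    rw [two_pow_eq i, two_pow_eq N, half_pow_eq, sqrt_two_pow_of_lt hi]
    ring
  have h3 := inv_sqrt_mul_brownianInc y (N - 1 - i)
  rw [bitDev, sum_block_coupledUnit, lsbCurrent_coupledUnit m σ y ξ hN, sqrt_two_pow_of_lt hi, h2]
  linear_combination (σ * √2 ^ N) * h3 -
    (σ * √2 ^ N * (1 / 2) ^ (N - 1 - i + 1) * y 0) * hc

lemma absDevSum_coupledUnit {σ : ℝ} (hσ : 0 < σ) (hN : N ≠ 0) :
    absDevSum σ N (coupledUnit m σ y ξ N) = 1 / 2 * (√(2 ^ N / numUnits N) *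
      ∑ l ∈ Finset.range N, |bridgeInc y l +
        (1 / 2) ^ (l + 1) * (2 ^ N / numUnits N * bridge y N)|) := by
  have hn := numUnits_pos hN
  have hs : 0 < √(numUnits N : ℝ) := Real.sqrt_pos.2 hn
  have hc : √((2 : ℝ) ^ N / numUnits N) = √2 ^ N / √(numUnits N : ℝ) := by
    rw [Real.sqrt_div (by positivity)]
    rw [two_pow_eq, Real.sqrt_mul_self (by positivity)]
  rw [absDevSum]
  congr 1
  rw [Finset.mul_sum, ← Finset.sum_range_reflect (fun l => √((2 : ℝ) ^ N / numUnits N) *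
    |bridgeInc y l + (1 / 2) ^ (l + 1) * (2 ^ N / numUnits N * bridge y N)|)]
  refine Finset.sum_congr rfl fun i hi => ?_
  rw [bitDev_coupledUnit m σ y ξ (Finset.mem_range.1 hi), hc]
  have h0 : 0 < √2 ^ N / √(numUnits N : ℝ) := by positivity
  rw [← abs_of_pos h0, ← abs_mul]
  congr 1
  field_simp

lemma two_pow_div_numUnits (hN : N ≠ 0) :
    1 ≤ (2 : ℝ) ^ N / numUnits N ∧ (2 : ℝ) ^ N / numUnits N ≤ 2 := by
  have hn := numUnits_pos hN
  have h2 : (2 : ℝ) ^ 1 ≤ 2 ^ N := pow_le_pow_right₀ (by norm_num) (by omega)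
  rw [le_div_iff₀ hn, div_le_iff₀ hn, numUnits_cast]
  constructor <;> linarith

/-- The distance of the normalized absolute deviations from their limit. -/
lemma abs_absDevSum_sub_limitM_le {σ : ℝ} (hσ : 0 < σ) (hN : N ≠ 0)
    (hy : Summable fun l => |bridgeInc y l|) :
    |absDevSum σ N (coupledUnit m σ y ξ N) - limitM y| ≤
      (2 ^ N / numUnits N - 1) * limitM y + 2 * |bridge y N| +
        1 / 2 * ∑' l, |bridgeInc y (l + N)| := by
  obtain ⟨hc1, hc2⟩ := two_pow_div_numUnits hN
  rw [absDevSum_coupledUnit m y ξ hσ hN, limitM_eq]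
  set c : ℝ := 2 ^ N / numUnits N
  have hs1 : 1 ≤ √c := Real.one_le_sqrt.2 hc1
  have hsc : √c ≤ c := by
    rw [Real.sqrt_le_iff]; exact ⟨by linarith, by nlinarith⟩
  rw [← hy.sum_add_tsum_nat_add N]
  set A := ∑ l ∈ Finset.range N, |bridgeInc y l + (1 / 2) ^ (l + 1) * (c * bridge y N)|
  set B := ∑ l ∈ Finset.range N, |bridgeInc y l|
  set T := ∑' l, |bridgeInc y (l + N)|
  have hB : 0 ≤ B := Finset.sum_nonneg fun _ _ => abs_nonneg _
  have hT : 0 ≤ T := tsum_nonneg fun _ => abs_nonneg _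
  -- The weights `(1 / 2) ^ (l + 1)` of the correction add up to less than `1`.
  have hAB : |A - B| ≤ c * |bridge y N| := by
    rw [← Finset.sum_sub_distrib]
    refine (Finset.abs_sum_le_sum_abs _ _).trans ?_
    have : ∀ l ∈ Finset.range N, |(|bridgeInc y l + (1 / 2) ^ (l + 1) * (c * bridge y N)| -
        |bridgeInc y l|)| ≤ (1 / 2) ^ (l + 1) * (c * |bridge y N|) := by
      intro l _
      refine (abs_abs_sub_abs_le_abs_sub _ _).trans (le_of_eq ?_)
      rw [add_sub_cancel_left, abs_mul, abs_mul, abs_of_pos (by positivity : (0 : ℝ) < (1 / 2) ^ (l + 1)),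
        abs_of_pos (by linarith : 0 < c)]
    refine (Finset.sum_le_sum this).trans ?_
    rw [← Finset.sum_mul]
    refine mul_le_of_le_one_left (by positivity) ?_
    simp only [pow_succ']
    rw [← Finset.mul_sum, geom_sum_eq (by norm_num)]
    have : (0 : ℝ) ≤ (1 / 2) ^ N := by positivity
    rw [show (1 / 2 : ℝ) * (((1 / 2) ^ N - 1) / (1 / 2 - 1)) = 1 - (1 / 2) ^ N by ring]
    linarith
  have e : 1 / 2 * (√c * A) - 1 / 2 * (B + T) =
      1 / 2 * (√c * (A - B)) + 1 / 2 * ((√c - 1) * B) - 1 / 2 * T := by ring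
  -- Both `√c` and `c` are at most `2`.
  have h1 : |√c * (A - B)| ≤ 4 * |bridge y N| := by
    rw [abs_mul, abs_of_pos (by linarith)]
    have := abs_nonneg (bridge y N)
    calc √c * |A - B| ≤ 2 * (2 * |bridge y N|) := by
          refine mul_le_mul (by linarith) (hAB.trans (by gcongr)) (abs_nonneg _) (by norm_num)
      _ = _ := by ring
  have h2 := abs_le.1 h1
  have h3 : (√c - 1) * B ≤ (c - 1) * (B + T) := by
    refine mul_le_mul (by linarith) (by linarith) hB (by linarith)
  have h4 : 0 ≤ (√c - 1) * B := mul_nonneg (by linarith) hB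
  rw [e, abs_le]
  constructor <;> nlinarith

/-- The same for the scaled maximum of the integrated non-linearity. -/
lemma abs_scaledINLmax_sub_le {σ : ℝ} (hσ : 0 < σ) (x : ℕ → ℝ) :
    |scaledINLmax σ N x - limitM y| ≤ 3 * |absDevSum σ N x - limitM y| +
      2 * {x : ℕ → ℝ | lsbCurrent N x ≤ 0}.indicator (fun _ => limitM y) x := by
  have hM : 0 ≤ limitM y := by
    rw [limitM_eq]; exact mul_nonneg (by norm_num) (tsum_nonneg fun _ => abs_nonneg _)
  by_cases h : lsbCurrent N x ≤ 0
  · rw [Set.indicator_of_mem (show x ∈ {x : ℕ → ℝ | lsbCurrent N x ≤ 0} from h)]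
    -- With the wrong sign the distance is at most `absDevSum + M ≤ |absDevSum - M| + 2 M`; the
    -- factor `3` is generous.
    have h1 := abs_le.1 (abs_scaledINLmax_le hσ N x)
    have h2 := le_abs_self (absDevSum σ N x - limitM y)
    have h3 := absDevSum_nonneg σ N x
    have h4 := abs_nonneg (absDevSum σ N x - limitM y)
    rw [abs_le]
    constructor <;> linarith
  · rw [Set.indicator_of_notMem (show x ∉ {x : ℕ → ℝ | lsbCurrent N x ≤ 0} from h),
      scaledINLmax_eq_absDevSum hσ (not_le.1 h)]
    linarith [abs_nonneg (absDevSum σ N x - limitM y)]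

end Pathwise

/-! ### Vanishing of the errors in `L²` -/

lemma tendsto_two_pow_div_numUnits_sub_one :
    Tendsto (fun N => (2 : ℝ) ^ N / numUnits N - 1) atTop (𝓝 0) := by
  have h : Tendsto (fun N : ℕ => (1 : ℝ) / (1 - (1 / 2) ^ N) - 1) atTop (𝓝 (1 / (1 - 0) - 1)) := by
    refine ((tendsto_const_nhds.div ((tendsto_const_nhds).sub
      (tendsto_pow_atTop_nhds_zero_of_lt_one (by norm_num) (by norm_num))) (by norm_num)).sub_const 1)
  rw [show (1 / (1 - 0) - 1 : ℝ) = 0 by norm_num] at h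
  refine h.congr' ?_
  filter_upwards [eventually_ne_atTop 0] with N hN
  have h1 : (1 : ℝ) < 2 ^ N := one_lt_pow₀ (by norm_num) hN
  rw [numUnits_cast, one_div, one_div, inv_pow]
  have : (2 : ℝ) ^ N - 1 ≠ 0 := by linarith
  have : (2 : ℝ) ^ N ≠ 0 := by positivity
  field_simp

lemma tendsto_sqrt_two_pow_div_numUnits :
    Tendsto (fun N => √2 ^ N / numUnits N) atTop (𝓝 0) := by
  have h : Tendsto (fun N : ℕ => 2 * ((√2)⁻¹ : ℝ) ^ N) atTop (𝓝 (2 * 0)) :=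
    (tendsto_pow_atTop_nhds_zero_of_lt_one (by positivity)
      (inv_lt_one_of_one_lt₀ (by rw [Real.lt_sqrt] <;> norm_num))).const_mul 2
  rw [mul_zero] at h
  refine squeeze_zero' (Eventually.of_forall fun N => by positivity) ?_ h
  filter_upwards [eventually_ne_atTop 0] with N hN
  have h1 := (two_pow_div_numUnits hN).2
  have hn := numUnits_pos hN
  have : √2 ^ N / numUnits N = 2 ^ N / numUnits N * (√2)⁻¹ ^ N := by
    rw [two_pow_eq, inv_pow]; field_simp
  rw [this]
  gcongr

section

variable {Ω : Type*} [MeasurableSpace Ω] {P : Measure Ω} {ζ : ℕ ⊕ ℕ → Ω → ℝ}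

/-- The unit currents of the coupling as random variables. -/
def coupledCurrent (m σ : ℝ) (ζ : ℕ ⊕ ℕ → Ω → ℝ) (N j : ℕ) (ω : Ω) : ℝ :=
  coupledUnit m σ (fun j => ζ (.inl j) ω) (fun j => ζ (.inr j) ω) N j

namespace IsStdGaussian

lemma left (h : IsStdGaussian ζ P) : IsStdGaussian (fun j : Set.Ici 1 => ζ (.inl (j : ℕ))) P :=
  h.comp_injective (Sum.inl_injective.comp Subtype.val_injective)

lemma iidGaussianOn_coupledCurrent (h : IsStdGaussian ζ P) (m σ : ℝ) (N : ℕ) :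
    IIDGaussianOn (Set.Icc 1 (numUnits N)) (coupledCurrent m σ ζ N) m (σ ^ 2) P := by
  have := (h.stdUnit N).iidGaussianOn m (σ := σ)
  convert this using 4 with j
  rw [coupledCurrent, coupledUnit, stdUnit_apply]
  simp only [brownianInc_apply]

lemma cov_bridge_self (hZ : IsStdGaussian ζ P) (N : ℕ) :
    cov[bridge (fun j => ζ (.inl j)) N, bridge (fun j => ζ (.inl j)) N; P] =
      (1 / 2) ^ N * (1 - (1 / 2) ^ N) := by
  have := hZ.gaussian.isProbabilityMeasure
  exact BinaryDAC.cov_bridge_self (fun j _ => hZ.memLp _) (fun j _ => hZ.cov_self _)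
    (fun i j _ _ hij => hZ.cov_ne _ _ (by simpa using hij)) N

lemma memLp_bridge (hZ : IsStdGaussian ζ P) (N : ℕ) :
    MemLp (bridge (fun j => ζ (.inl j)) N) 2 P :=
  BinaryDAC.memLp_bridge (fun _ _ => hZ.memLp _) N

/-- The bridge at `2^(-N)` has variance at most `2^(-N)`, being close to its pinned end. -/
lemma eLpNorm_bridge_le (hZ : IsStdGaussian ζ P) (N : ℕ) :
    eLpNorm (bridge (fun j => ζ (.inl j)) N) 2 P ≤ ENNReal.ofReal ((√2)⁻¹ ^ N) := by
  rw [hZ.eLpNorm_of_mem_span (bridge_mem (fun _ _ => Submodule.subset_span (Set.mem_range_self _)) N),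
    hZ.cov_bridge_self]
  refine ENNReal.ofReal_le_ofReal (Real.sqrt_le_iff.2 ⟨by positivity, ?_⟩)
  have h0 : (0 : ℝ) ≤ (1 / 2) ^ N := by positivity
  have h1 : ((√2)⁻¹ ^ N) ^ 2 = (1 / 2 : ℝ) ^ N := by rw [half_pow_eq]; ring
  rw [h1]
  nlinarith

lemma tendsto_eLpNorm_bridge (hZ : IsStdGaussian ζ P) :
    Tendsto (fun N => eLpNorm (bridge (fun j => ζ (.inl j)) N) 2 P) atTop (𝓝 0) := by
  have h : Tendsto (fun N : ℕ => ENNReal.ofReal (((√2)⁻¹ : ℝ) ^ N)) atTop (𝓝 (ENNReal.ofReal 0)) :=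
    ENNReal.tendsto_ofReal (tendsto_pow_atTop_nhds_zero_of_lt_one (by positivity)
      (inv_lt_one_of_one_lt₀ (by rw [Real.lt_sqrt] <;> norm_num)))
  rw [ENNReal.ofReal_zero] at h
  exact tendsto_of_tendsto_of_tendsto_of_le_of_le tendsto_const_nhds h (fun _ => zero_le)
    hZ.eLpNorm_bridge_le

/-- The `L²` norms of the tails of the series for `M`. -/
lemma eLpNorm_tail_le {Z : ℕ → Ω → ℝ} (hZ : IsStdGaussian (fun j : Set.Ici 1 => Z j) P) (N : ℕ) :
    eLpNorm (fun ω => ∑' l, |bridgeInc Z (l + N) ω|) 2 P ≤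
      ∑' l, ENNReal.ofReal (√(blockVar (l + N + 1))) := by
  have e : ∀ l, eLpNorm (fun ω => |bridgeInc Z (l + N) ω|) 2 P =
      ENNReal.ofReal (√(blockVar (l + N + 1))) := fun l => hZ.eLpNorm_bridgeInc (l + N)
  refine (eLpNorm_tsum_le (by norm_num) (fun l => (hZ.memLp_bridgeInc (l + N)).abs.1) ?_).trans ?_
  · change ∑' l, eLpNorm (fun ω => |bridgeInc Z (l + N) ω|) 2 P ≠ ⊤
    simp_rw [e]
    exact ((summable_nat_add_iff N).2 summable_sqrt_blockVar).tsum_ofReal_ne_top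
  · change ∑' l, eLpNorm (fun ω => |bridgeInc Z (l + N) ω|) 2 P ≤ _
    simp_rw [e]
    exact le_rfl

/-- The bound of `abs_absDevSum_sub_limitM_le` as a random variable. -/
def errorBound (Y : ℕ → Ω → ℝ) (N : ℕ) (ω : Ω) : ℝ :=
  (2 ^ N / numUnits N - 1) * (limitM fun j => Y j ω) + 2 * |bridge Y N ω| +
    1 / 2 * ∑' l, |bridgeInc Y (l + N) ω|

lemma aestronglyMeasurable_tail {Z : ℕ → Ω → ℝ}
    (hZ : IsStdGaussian (fun j : Set.Ici 1 => Z j) P) (N : ℕ) :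
    AEStronglyMeasurable (fun ω => ∑' l, |bridgeInc Z (l + N) ω|) P := by
  refine aestronglyMeasurable_of_tendsto_ae atTop
    (f := fun n ω => ∑ l ∈ Finset.range n, |bridgeInc Z (l + N) ω|) (fun n => ?_) ?_
  · exact Finset.aestronglyMeasurable_fun_sum _ fun l _ => (hZ.memLp_bridgeInc (l + N)).abs.1
  · filter_upwards [hZ.ae_summable_bridgeInc] with ω hω
    exact ((summable_nat_add_iff N).2 hω).hasSum.tendsto_sum_nat

lemma eLpNorm_errorBound_le (hZ : IsStdGaussian ζ P) (N : ℕ) :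
    eLpNorm (errorBound (fun j => ζ (.inl j)) N) 2 P ≤
      ‖(2 ^ N / numUnits N - 1 : ℝ)‖ₑ *
        eLpNorm (fun ω => limitM fun j => ζ (.inl j) ω) 2 P +
      ‖(2 : ℝ)‖ₑ * eLpNorm (bridge (fun j => ζ (.inl j)) N) 2 P +
      ‖(1 / 2 : ℝ)‖ₑ * ∑' l, ENNReal.ofReal (√(blockVar (l + N + 1))) := by
  have hM := hZ.left.memLp_limitM (Z := fun j => ζ (.inl j))
  have hb := hZ.memLp_bridge N
  have m1 : AEStronglyMeasurable (fun ω => (2 ^ N / numUnits N - 1 : ℝ) *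
    limitM fun j => ζ (.inl j) ω) P := hM.1.const_mul _
  have m2 : AEStronglyMeasurable (fun ω => 2 * |bridge (fun j => ζ (.inl j)) N ω|) P :=
    hb.abs.1.const_mul _
  have m3 : AEStronglyMeasurable
      (fun ω => 1 / 2 * ∑' l, |bridgeInc (fun j => ζ (.inl j)) (l + N) ω|) P :=
    (hZ.left.aestronglyMeasurable_tail (Z := fun j => ζ (.inl j)) N).const_mul _
  have hn : eLpNorm (fun ω => |bridge (fun j => ζ (.inl j)) N ω|) 2 P =
      eLpNorm (bridge (fun j => ζ (.inl j)) N) 2 P :=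
    eLpNorm_norm (bridge (fun j => ζ (.inl j)) N)
  refine (eLpNorm_add_le (m1.add m2) m3 (by norm_num)).trans (add_le_add
    ((eLpNorm_add_le m1 m2 (by norm_num)).trans (add_le_add ?_ ?_)) ?_)
  · exact eLpNorm_const_smul_le (c := (2 ^ N / numUnits N - 1 : ℝ))
  · refine (eLpNorm_const_smul_le (c := (2 : ℝ))
      (f := fun ω => |bridge (fun j => ζ (.inl j)) N ω|)).trans (le_of_eq ?_)
    rw [hn]
  · refine (eLpNorm_const_smul_le (c := (1 / 2 : ℝ))
      (f := fun ω => ∑' l, |bridgeInc (fun j => ζ (.inl j)) (l + N) ω|)).trans ?_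
    gcongr
    exact hZ.left.eLpNorm_tail_le (Z := fun j => ζ (.inl j)) N

lemma tendsto_eLpNorm_errorBound (hZ : IsStdGaussian ζ P) :
    Tendsto (fun N => eLpNorm (errorBound (fun j => ζ (.inl j)) N) 2 P) atTop (𝓝 0) := by
  have hM := hZ.left.memLp_limitM (Z := fun j => ζ (.inl j))
  have t1 : Tendsto (fun N => ‖(2 ^ N / numUnits N - 1 : ℝ)‖ₑ *
      eLpNorm (fun ω => limitM fun j => ζ (.inl j) ω) 2 P) atTop (𝓝 0) := by
    have := ENNReal.Tendsto.mul_const (b := eLpNorm (fun ω => limitM fun j => ζ (.inl j) ω) 2 P)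
      tendsto_two_pow_div_numUnits_sub_one.enorm (Or.inr hM.2.ne)
    simpa using this
  have t2 : Tendsto (fun N => ‖(2 : ℝ)‖ₑ * eLpNorm (bridge (fun j => ζ (.inl j)) N) 2 P)
      atTop (𝓝 0) := by
    have := ENNReal.Tendsto.const_mul (a := ‖(2 : ℝ)‖ₑ) hZ.tendsto_eLpNorm_bridge
      (Or.inr enorm_ne_top)
    simpa using this
  have t3 : Tendsto (fun N => ‖(1 / 2 : ℝ)‖ₑ * ∑' l, ENNReal.ofReal (√(blockVar (l + N + 1))))
      atTop (𝓝 0) := by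
    have := ENNReal.Tendsto.const_mul (a := ‖(1 / 2 : ℝ)‖ₑ)
      (ENNReal.tendsto_sum_nat_add (fun l => ENNReal.ofReal (√(blockVar (l + 1))))
        summable_sqrt_blockVar.tsum_ofReal_ne_top) (Or.inr enorm_ne_top)
    rw [mul_zero] at this
    exact this
  have t := (t1.add t2).add t3
  rw [add_zero, add_zero] at t
  exact tendsto_of_tendsto_of_tendsto_of_le_of_le tendsto_const_nhds t (fun _ => zero_le)
    hZ.eLpNorm_errorBound_le

lemma memLp_errorBound (hZ : IsStdGaussian ζ P) (N : ℕ) :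
    MemLp (errorBound (fun j => ζ (.inl j)) N) 2 P := by
  have hM := hZ.left.memLp_limitM (Z := fun j => ζ (.inl j))
  refine ⟨((hM.1.const_mul _).add ((hZ.memLp_bridge N).abs.1.const_mul _)).add
    ((hZ.left.aestronglyMeasurable_tail (Z := fun j => ζ (.inl j)) N).const_mul _),
    (hZ.eLpNorm_errorBound_le N).trans_lt ?_⟩
  refine ENNReal.add_lt_top.2 ⟨ENNReal.add_lt_top.2 ⟨?_, ?_⟩, ?_⟩
  · exact ENNReal.mul_lt_top enorm_lt_top hM.2
  · exact ENNReal.mul_lt_top enorm_lt_top (hZ.memLp_bridge N).2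
  · exact ENNReal.mul_lt_top enorm_lt_top
      (((summable_nat_add_iff N).2 summable_sqrt_blockVar).tsum_ofReal_ne_top).lt_top

/-- The probability of a nonpositive LSB current tends to zero. -/
lemma tendsto_measure_lsbCurrent_nonpos (hZ : IsStdGaussian ζ P) {m σ : ℝ} (hm : 0 < m)
    (hσ : 0 < σ) :
    Tendsto (fun N => P {ω | lsbCurrent N (fun j => coupledCurrent m σ ζ N j ω) ≤ 0}) atTop
      (𝓝 0) := by
  -- `W N` is the normalized fluctuation of the LSB current, which equals `m + σ W N`. A nonpositive
  -- value forces `|W N| ≥ m / σ`, and `W N` tends to zero in `L²`, hence in probability.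
  let W : ℕ → Ω → ℝ := fun N => (√2 ^ N / numUnits N : ℝ) •
    ((1 - (1 / 2) ^ N : ℝ) • ζ (.inl 0) - bridge (fun j => ζ (.inl j)) N)
  have hY0 : eLpNorm (ζ (.inl 0)) 2 P = 1 := by
    rw [hZ.eLpNorm_of_mem_span (Submodule.subset_span (Set.mem_range_self _)), hZ.cov_self]
    simp
  have hle : ∀ N, eLpNorm (W N) 2 P ≤ ‖(√2 ^ N / numUnits N : ℝ)‖ₑ * 2 := by
    intro N
    refine eLpNorm_const_smul_le.trans ?_
    gcongr
    refine (eLpNorm_sub_le ((hZ.memLp _).const_smul _).1 (hZ.memLp_bridge N).1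
      (by norm_num)).trans ?_
    refine (add_le_add (b := 1) (d := 1) ?_ ((hZ.eLpNorm_bridge_le N).trans ?_)).trans
      one_add_one_eq_two.le
    · refine eLpNorm_const_smul_le.trans ?_
      rw [hY0, mul_one, Real.enorm_eq_ofReal_abs, ENNReal.ofReal_le_one, abs_le]
      have h0 : (0 : ℝ) ≤ (1 / 2) ^ N := by positivity
      have h1 : (1 / 2 : ℝ) ^ N ≤ 1 := pow_le_one₀ (by norm_num) (by norm_num)
      constructor <;> linarith
    · rw [ENNReal.ofReal_le_one]
      refine pow_le_one₀ (by positivity) (inv_le_one_of_one_le₀ ?_)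
      rw [Real.one_le_sqrt]; norm_num
  have hW : Tendsto (fun N => eLpNorm (W N - 0) 2 P) atTop (𝓝 0) := by
    have t := ENNReal.Tendsto.mul_const (b := 2) tendsto_sqrt_two_pow_div_numUnits.enorm
      (Or.inr (by norm_num))
    rw [enorm_zero, zero_mul] at t
    simp only [sub_zero]
    exact tendsto_of_tendsto_of_tendsto_of_le_of_le tendsto_const_nhds t (fun _ => zero_le) hle
  have hWm : ∀ N, AEStronglyMeasurable (W N) P := fun N =>
    ((((hZ.memLp _).const_smul _).sub (hZ.memLp_bridge N)).const_smul _).1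
  have hin := tendstoInMeasure_of_tendsto_eLpNorm (p := 2) (by norm_num) hWm
    aestronglyMeasurable_zero hW
  have hpr := tendstoInMeasure_iff_norm.1 hin (m / σ) (by positivity)
  refine tendsto_of_tendsto_of_tendsto_of_le_of_le' tendsto_const_nhds hpr
    (Eventually.of_forall fun _ => zero_le) ?_
  filter_upwards [eventually_ne_atTop 0] with N hN
  refine measure_mono fun ω hω => ?_
  simp only [Set.mem_ofPred_eq] at hω ⊢
  rw [show (fun j => coupledCurrent m σ ζ N j ω) = coupledUnit m σ (fun j => ζ (.inl j) ω)
    (fun j => ζ (.inr j) ω) N from rfl, lsbCurrent_coupledUnit _ _ _ _ hN] at hω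
  have hWω : W N ω = √2 ^ N / numUnits N * ((1 - (1 / 2) ^ N) * ζ (.inl 0) ω -
      bridge (fun j => ζ (.inl j) ω) N) := by
    simp [W, bridge_apply]
  rw [← hWω] at hω
  rw [div_le_iff₀ hσ]
  simp only [Pi.zero_apply, sub_zero, Real.norm_eq_abs]
  have := neg_abs_le (W N ω)
  nlinarith

end IsStdGaussian

end

/-! ### Independence of the realization -/

section Law

variable {Ω Ω' : Type*} [MeasurableSpace Ω] [MeasurableSpace Ω'] {P : Measure Ω}

/-- A measurable function of i.i.d. normals has a law that does not depend on the realization. -/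
lemma IIDGaussianOn.identDistrib {P' : Measure Ω'} {S : Set ℕ} {X : ℕ → Ω → ℝ} {X' : ℕ → Ω' → ℝ} {m v : ℝ}
    (hX : IIDGaussianOn S X m v P) (hX' : IIDGaussianOn S X' m v P') {f : (ℕ → ℝ) → ℝ}
    (hf : Measurable f) (hfS : ∀ x y : ℕ → ℝ, (∀ j ∈ S, x j = y j) → f x = f y) :
    IdentDistrib (fun ω => f fun j => X j ω) (fun ω => f fun j => X' j ω) P P' := by
  classical
  -- Only the coordinates in `S` have a known joint law, so the sequence is filled up by zeros;
  -- `hfS` says that `f` does not notice.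
  let ext : (S → ℝ) → ℕ → ℝ := fun y j => if h : j ∈ S then y ⟨j, h⟩ else 0
  have hext : Measurable ext := by
    refine measurable_pi_lambda _ fun j => ?_
    by_cases h : j ∈ S
    · simp only [ext, h, dite_true]; fun_prop
    · simp only [ext, h, dite_false]; fun_prop
  have h1 := iIndepFun.hasLaw_infinitePi (fun j : S => hX.law j j.2) hX.indep
    (aemeasurable_pi_lambda _ fun j => (hX.law j j.2).aemeasurable)
  have h2 := iIndepFun.hasLaw_infinitePi (fun j : S => hX'.law j j.2) hX'.indep
    (aemeasurable_pi_lambda _ fun j => (hX'.law j j.2).aemeasurable)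
  have hid : IdentDistrib (fun ω (j : S) => X j ω) (fun ω (j : S) => X' j ω) P P' :=
    ⟨h1.aemeasurable, h2.aemeasurable, h1.map_eq.trans h2.map_eq.symm⟩
  have e : ∀ x : ℕ → ℝ, f (ext fun j => x j) = f x := fun x =>
    hfS _ _ fun j hj => by simp [ext, hj]
  rw [← funext fun ω => e fun j => X j ω, ← funext fun ω => e fun j => X' j ω]
  exact hid.comp (hf.comp hext)

end Law

lemma measurable_bridge (l : ℕ) : Measurable fun z : ℕ → ℝ => bridge z l := by
  induction l with
  | zero => exact measurable_const
  | succ l ih => 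
    simp only [bridge, smul_eq_mul]
    fun_prop

lemma measurable_bridgeInc (l : ℕ) : Measurable fun z : ℕ → ℝ => bridgeInc z l :=
  (measurable_bridge l).sub (measurable_bridge (l + 1))

/-- Valid on all sequences, including those where the series diverges and `tsum` takes its default
value `0`. -/
lemma measurable_limitM : Measurable limitM := by
  have h : limitM = fun z => 1 / 2 * ∑' l, |bridgeInc z l| := funext limitM_eq
  rw [h]
  exact (Measurable.tsum fun l => (measurable_bridgeInc l).abs).const_mul _

lemma bridge_congr {x y : ℕ → ℝ} (h : ∀ j ∈ Set.Ici 1, x j = y j) (l : ℕ) :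
    bridge x l = bridge y l := by
  induction l with
  | zero => rfl
  | succ l ih => rw [bridge, bridge, ih, h (l + 1) (by simp)]

/-- The coordinate `0` plays no part in `M`; the coupling uses it for the endpoint of the Brownian
motion. -/
lemma limitM_congr {x y : ℕ → ℝ} (h : ∀ j ∈ Set.Ici 1, x j = y j) : limitM x = limitM y := by
  simp only [limitM_eq, bridgeInc, bridge_congr h]

/-! ### `L²` convergence of the scaled maximum -/

namespace IsStdGaussian

variable {Ω : Type*} [MeasurableSpace Ω] {P : Measure Ω} {ζ : ℕ ⊕ ℕ → Ω → ℝ}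

lemma measurable_coupledCurrent (hm : ∀ i, Measurable (ζ i)) (m σ : ℝ) (N j : ℕ) :
    Measurable (coupledCurrent m σ ζ N j) := by
  have h1 : ∀ l, Measurable fun ω => bridgeInc (fun j => ζ (.inl j) ω) l := fun l =>
    (measurable_bridgeInc l).comp (measurable_pi_lambda _ fun j => hm _)
  unfold coupledCurrent coupledUnit BinaryDAC.stdUnit brownianInc
  simp only [smul_eq_mul]
  fun_prop

lemma ae_abs_sub_le (hZ : IsStdGaussian ζ P) {m σ : ℝ} (hσ : 0 < σ) {N : ℕ} (hN : N ≠ 0) :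
    ∀ᵐ ω ∂P, |scaledINLmax σ N (fun j => coupledCurrent m σ ζ N j ω) -
      limitM (fun j => ζ (.inl j) ω)| ≤ 3 * errorBound (fun j => ζ (.inl j)) N ω +
        2 * {ω | lsbCurrent N (fun j => coupledCurrent m σ ζ N j ω) ≤ 0}.indicator
          (fun ω => limitM fun j => ζ (.inl j) ω) ω := by
  filter_upwards [hZ.left.ae_summable_bridgeInc (Z := fun j => ζ (.inl j))] with ω hω
  simp only [bridgeInc_apply] at hω
  have h1 := abs_absDevSum_sub_limitM_le m (fun j => ζ (.inl j) ω) (fun j => ζ (.inr j) ω) hσ hN hω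
  have h2 := abs_scaledINLmax_sub_le (N := N) (fun j => ζ (.inl j) ω) hσ
    (fun j => coupledCurrent m σ ζ N j ω)
  refine h2.trans (add_le_add ?_ (le_of_eq ?_))
  · simp only [errorBound, bridge_apply, bridgeInc_apply]
    exact mul_le_mul_of_nonneg_left h1 (by norm_num)
  · rfl

lemma eLpNorm_sub_le (hZ : IsStdGaussian ζ P) (hm : ∀ i, Measurable (ζ i)) {m σ : ℝ} (hσ : 0 < σ)
    {N : ℕ} (hN : N ≠ 0) :
    eLpNorm (fun ω => scaledINLmax σ N (fun j => coupledCurrent m σ ζ N j ω) -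
      limitM fun j => ζ (.inl j) ω) 2 P ≤
      ‖(3 : ℝ)‖ₑ * eLpNorm (errorBound (fun j => ζ (.inl j)) N) 2 P + ‖(2 : ℝ)‖ₑ *
        eLpNorm ({ω | lsbCurrent N (fun j => coupledCurrent m σ ζ N j ω) ≤ 0}.indicator
          (fun ω => limitM fun j => ζ (.inl j) ω)) 2 P := by
  have hA : MeasurableSet {ω | lsbCurrent N (fun j => coupledCurrent m σ ζ N j ω) ≤ 0} :=
    measurableSet_le ((measurable_lsbCurrent N).comp (measurable_pi_lambda _ fun j =>
      measurable_coupledCurrent hm m σ N j)) measurable_const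
  have hM := hZ.left.memLp_limitM (Z := fun j => ζ (.inl j))
  refine (eLpNorm_mono_ae_real (hZ.ae_abs_sub_le hσ hN)).trans ?_
  refine (eLpNorm_add_le ((hZ.memLp_errorBound N).1.const_mul _)
    ((hM.1.indicator hA).const_mul _) (by norm_num)).trans (add_le_add ?_ ?_)
  · exact eLpNorm_const_smul_le (c := (3 : ℝ))
  · exact eLpNorm_const_smul_le (c := (2 : ℝ))

lemma memLp_scaledINLmax (hZ : IsStdGaussian ζ P) (hm : ∀ i, Measurable (ζ i)) {m σ : ℝ}
    (hσ : 0 < σ) (N : ℕ) :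
    MemLp (fun ω => scaledINLmax σ N fun j => coupledCurrent m σ ζ N j ω) 2 P := by
  have hP := hZ.gaussian.isProbabilityMeasure
  rcases eq_or_ne N 0 with rfl | hN
  · simp [scaledINLmax, numUnits]
  have hM := hZ.left.memLp_limitM (Z := fun j => ζ (.inl j))
  have hmeas : Measurable fun ω => scaledINLmax σ N fun j => coupledCurrent m σ ζ N j ω :=
    (measurable_scaledINLmax hσ N).comp (measurable_pi_lambda _ fun j =>
      measurable_coupledCurrent hm m σ N j)
  have hd : MemLp (fun ω => scaledINLmax σ N (fun j => coupledCurrent m σ ζ N j ω) -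
      limitM fun j => ζ (.inl j) ω) 2 P := by
    refine ⟨hmeas.aestronglyMeasurable.sub hM.1, (hZ.eLpNorm_sub_le hm hσ hN).trans_lt ?_⟩
    refine ENNReal.add_lt_top.2 ⟨ENNReal.mul_lt_top enorm_lt_top (hZ.memLp_errorBound N).2,
      ENNReal.mul_lt_top enorm_lt_top ((eLpNorm_indicator_le _).trans_lt hM.2)⟩
  refine (hd.add hM).ae_eq (ae_of_all _ fun ω => ?_)
  simp

/-- The error bound vanishes in `L²`. On the event of a nonpositive LSB current, the single function
`M` has small `L²` norm by absolute continuity of the integral, since the probability of the event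
tends to zero. -/
lemma tendsto_eLpNorm_sub (hZ : IsStdGaussian ζ P) (hm : ∀ i, Measurable (ζ i)) {m σ : ℝ}
    (hm0 : 0 < m) (hσ : 0 < σ) :
    Tendsto (fun N => eLpNorm (fun ω => scaledINLmax σ N (fun j => coupledCurrent m σ ζ N j ω) -
      limitM fun j => ζ (.inl j) ω) 2 P) atTop (𝓝 0) := by
  have hM := hZ.left.memLp_limitM (Z := fun j => ζ (.inl j))
  have hA : ∀ N, MeasurableSet {ω | lsbCurrent N (fun j => coupledCurrent m σ ζ N j ω) ≤ 0} :=
    fun N => measurableSet_le ((measurable_lsbCurrent N).comp (measurable_pi_lambda _ fun j =>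
      measurable_coupledCurrent hm m σ N j)) measurable_const
  have hind : Tendsto (fun N => eLpNorm
      ({ω | lsbCurrent N (fun j => coupledCurrent m σ ζ N j ω) ≤ 0}.indicator
        (fun ω => limitM fun j => ζ (.inl j) ω)) 2 P) atTop (𝓝 0) := by
    rw [ENNReal.tendsto_nhds_zero]
    intro ε hε
    rcases eq_or_ne ε ⊤ with rfl | hε'
    · exact Eventually.of_forall fun _ => le_top
    obtain ⟨δ, hδ, h⟩ := hM.eLpNorm_indicator_le (by norm_num) (by norm_num)
      (ENNReal.toReal_pos hε.ne' hε')
    filter_upwards [(ENNReal.tendsto_nhds_zero.1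
      (hZ.tendsto_measure_lsbCurrent_nonpos hm0 hσ)) (ENNReal.ofReal δ) (by simpa using hδ)] with N hN
    have := h _ (hA N) hN
    rwa [ENNReal.ofReal_toReal hε'] at this
  have t := (ENNReal.Tendsto.const_mul (a := ‖(3 : ℝ)‖ₑ) hZ.tendsto_eLpNorm_errorBound
      (Or.inr enorm_ne_top)).add
    (ENNReal.Tendsto.const_mul (a := ‖(2 : ℝ)‖ₑ) hind (Or.inr enorm_ne_top))
  rw [mul_zero, mul_zero, add_zero] at t
  refine tendsto_of_tendsto_of_tendsto_of_le_of_le' tendsto_const_nhds t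
    (Eventually.of_forall fun _ => zero_le) ?_
  filter_upwards [eventually_ne_atTop 0] with N hN
  exact hZ.eLpNorm_sub_le hm hσ hN

end IsStdGaussian

/-! ### The coupling space and the theorem -/

/-- The space of the coupling: the coordinates are independent standard normals. -/
def couplingMeasure : Measure (ℕ ⊕ ℕ → ℝ) := Measure.infinitePi fun _ => gaussianReal 0 1

instance : IsProbabilityMeasure couplingMeasure := by
  unfold couplingMeasure; infer_instance

lemma isStdGaussian_coupling :
    IsStdGaussian (fun (i : ℕ ⊕ ℕ) (ω : ℕ ⊕ ℕ → ℝ) => ω i) couplingMeasure :=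
  isStdGaussian_of_iIndepFun
    (iIndepFun_infinitePi (P := fun _ : ℕ ⊕ ℕ => gaussianReal 0 1) (X := fun _ x => x)
      (fun _ => measurable_id))
    fun i => (measurePreserving_eval_infinitePi (fun _ => gaussianReal 0 1) i).hasLaw

end BinaryDAC

end

/-- The currents may live on a different probability space for each resolution `N`. Convergence
in distribution is claimed for arbitrary realizations; convergence in `L¹` and `L²`, which
compares random variables on one space, is claimed for a realization of all the currents and of
the `Z l` on a common probability space. -/
theorem mainTheorem1
    (Ibar σ : ℝ) (hIbar : 0 < Ibar) (hσ : 0 < σ)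
    {Ω : ℕ → Type*} [∀ N, MeasurableSpace (Ω N)]
    (P : (N : ℕ) → Measure (Ω N)) [∀ N, IsProbabilityMeasure (P N)]
    (I : (N : ℕ) → ℕ → Ω N → ℝ)
    (hI : ∀ N, BinaryDAC.IIDGaussianOn (Set.Icc 1 (BinaryDAC.numUnits N)) (I N) Ibar (σ ^ 2) (P N))
    {Ω' : Type*} [MeasurableSpace Ω'] (Q : Measure Ω') [IsProbabilityMeasure Q]
    (Z : ℕ → Ω' → ℝ) (hZ : BinaryDAC.IIDGaussianOn (Set.Ici 1) Z 0 1 Q) :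
    -- the series defining `M` converges almost surely, and `M` is square integrable
    (∀ᵐ ω ∂Q, Summable fun l : ℕ => BinaryDAC.limitTerm (fun j => Z j ω) (l + 1)) ∧
    MemLp (fun ω => BinaryDAC.limitM fun j => Z j ω) 2 Q ∧
    -- convergence in distribution
    TendstoInDistribution
      (fun N ω => BinaryDAC.scaledINLmax σ N fun j => I N j ω) atTop
      (fun ω => BinaryDAC.limitM fun j => Z j ω) P Q ∧
    -- convergence in `L¹` and in `L²`
    (∃ (Ω₀ : Type) (_ : MeasurableSpace Ω₀) (R : Measure Ω₀) (_ : IsProbabilityMeasure R)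
      (J : ℕ → ℕ → Ω₀ → ℝ) (Y : ℕ → Ω₀ → ℝ),
      (∀ N, BinaryDAC.IIDGaussianOn (Set.Icc 1 (BinaryDAC.numUnits N)) (J N) Ibar (σ ^ 2) R) ∧
      BinaryDAC.IIDGaussianOn (Set.Ici 1) Y 0 1 R ∧
      (∀ N, MemLp (fun ω => BinaryDAC.scaledINLmax σ N fun j => J N j ω) 2 R) ∧
      Tendsto (fun N => eLpNorm (fun ω =>
        BinaryDAC.scaledINLmax σ N (fun j => J N j ω) -
          BinaryDAC.limitM fun j => Y j ω) 1 R) atTop (𝓝 0) ∧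
      Tendsto (fun N => eLpNorm (fun ω =>
        BinaryDAC.scaledINLmax σ N (fun j => J N j ω) -
          BinaryDAC.limitM fun j => Y j ω) 2 R) atTop (𝓝 0)) ∧
    -- the expectation of `M`
    (Summable fun l : ℕ => √(BinaryDAC.blockVar (l + 1))) ∧
    (∫ ω, (BinaryDAC.limitM fun j => Z j ω) ∂Q) =
      (√(2 * Real.pi))⁻¹ * (∑' l : ℕ, √(BinaryDAC.blockVar (l + 1))) ∧
    |(∫ ω, (BinaryDAC.limitM fun j => Z j ω) ∂Q) - 0.839792| ≤ 0.0000005 ∧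
    -- the variance of `M`
    (Summable fun p : {p : ℕ × ℕ // 1 ≤ p.1 ∧ p.1 < p.2} =>
      BinaryDAC.varTerm p.1.1 p.1.2) ∧
    variance (fun ω => BinaryDAC.limitM fun j => Z j ω) Q =
      1 / Real.pi * (∑' p : {p : ℕ × ℕ // 1 ≤ p.1 ∧ p.1 < p.2},
        BinaryDAC.varTerm p.1.1 p.1.2) + 1 / 6 * (1 - 2 / Real.pi) ∧
    |variance (fun ω => BinaryDAC.limitM fun j => Z j ω) Q - 0.08007| ≤ 0.000005 := by
  have hZs := hZ.isStdGaussian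
  have hζ := BinaryDAC.isStdGaussian_coupling
  have hm : ∀ i : ℕ ⊕ ℕ, Measurable fun ω : ℕ ⊕ ℕ → ℝ => ω i := fun i => measurable_pi_apply i
  have hJ := hζ.iidGaussianOn_coupledCurrent Ibar σ
  have hY : BinaryDAC.IIDGaussianOn (Set.Ici 1) (fun j (ω : ℕ ⊕ ℕ → ℝ) => ω (.inl j)) 0 1
      BinaryDAC.couplingMeasure := by
    simpa using hζ.left.iidGaussianOn (X := fun j (ω : ℕ ⊕ ℕ → ℝ) => ω (.inl j)) 0 (σ := 1)
  have hL2 := hζ.tendsto_eLpNorm_sub hm hIbar hσ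
  have hmem := fun N => hζ.memLp_scaledINLmax hm (m := Ibar) hσ N
  have hlim := hζ.left.memLp_limitM (Z := fun j (ω : ℕ ⊕ ℕ → ℝ) => ω (.inl j))
  -- On the coupling space, `L²` convergence implies convergence in measure and thus in
  -- distribution.
  have hdist := (tendstoInMeasure_of_tendsto_eLpNorm (p := 2) (by norm_num)
    (fun N => (hmem N).1) hlim.1 hL2).tendstoInDistribution fun N => (hmem N).1.aemeasurable
  have hid := fun N => (hI N).identDistrib (hJ N) (BinaryDAC.measurable_scaledINLmax hσ N)
    fun x y h => BinaryDAC.scaledINLmax_congr hσ h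
  have hidM := hZ.identDistrib hY BinaryDAC.measurable_limitM
    fun x y h => BinaryDAC.limitM_congr h
  have hmean := hZs.integral_limitM
  have hvar := hZs.variance_limitM
  have hS := BinaryDAC.tsum_sqrt_blockVar_bounds
  refine ⟨?_, hZs.memLp_limitM, ⟨fun N => (hid N).aemeasurable_fst, hidM.aemeasurable_fst, ?_⟩,
    ⟨ℕ ⊕ ℕ → ℝ, inferInstance, BinaryDAC.couplingMeasure, inferInstance,
      BinaryDAC.coupledCurrent Ibar σ fun i ω => ω i, fun j ω => ω (.inl j), hJ, hY, hmem, ?_, hL2⟩,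
    BinaryDAC.summable_sqrt_blockVar, hmean, ?_, BinaryDAC.summable_varTerm, hvar, ?_⟩
  · simpa only [BinaryDAC.limitTerm_succ, BinaryDAC.bridgeInc_apply]
      using hZs.ae_summable_bridgeInc
  -- Convergence in distribution sees only the image measures, which agree with those of the
  -- coupling.
  · have e1 : ∀ N, (⟨(P N).map _, Measure.isProbabilityMeasure_map (hid N).aemeasurable_fst⟩ :
        ProbabilityMeasure ℝ) = ⟨_, Measure.isProbabilityMeasure_map (hid N).aemeasurable_snd⟩ :=
      fun N => Subtype.ext (hid N).map_eq
    have e2 : (⟨Q.map _, Measure.isProbabilityMeasure_map hidM.aemeasurable_fst⟩ :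
        ProbabilityMeasure ℝ) = ⟨_, Measure.isProbabilityMeasure_map hidM.aemeasurable_snd⟩ :=
      Subtype.ext hidM.map_eq
    simp only [e1, e2]
    exact hdist.tendsto
  · refine tendsto_of_tendsto_of_tendsto_of_le_of_le tendsto_const_nhds hL2
      (fun _ => zero_le) fun N => ?_
    -- On a probability space the `L¹` norm is at most the `L²` norm.
    exact eLpNorm_le_eLpNorm_of_exponent_le (by norm_num) ((hmem N).1.sub hlim.1)
  · rw [hmean]
    exact BinaryDAC.mean_numeric hS.1 hS.2
  · rw [BinaryDAC.tsum_varTerm] at hvar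
    exact BinaryDAC.variance_numeric hvar BinaryDAC.le_tsum_varTermExt
      BinaryDAC.tsum_varTermExt_le
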